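/- **Setting.** All Hilbert spaces are finite-dimensional and nonzero, with fixed orthonormal bases. $X\le Y$ is the Loewner order ($Y-X$ positive semidefinite) and $|X|\le Y$ means $-Y\le X\le Y$. Superscripts with fewer systems denote partial traces, $T_S$ is the partial transpose on $S$, and identities are omitted in products such as $\rho^{A'}\mathbb 1^{BC}$. Let $\mathcal N^{A'\to BC}$ be a quantum channel (completely positive and trace preserving), let $N^{A'BC}=\sum_{ij}|i\rangle\langle j|\otimes\mathcal N(|i\rangle\langle j|)$ be its Choi matrix, and let $r_1,r_2\ge 1$ be integers. A *forward-assisted code* of size $(r_1,r_2)$ consists of a finite-dimensional register $R$, an isometry $V\colon A_1A_2\to A'R$ and a channel $\mathcal D^{RBC\to B'C'}$, where $|A_1|=|B'|=r_1$ and $|A_2|=|C'|=r_2$. With $A=A_1A_2$ and $\mathcal E(X)=VXV^\dagger$, its tripartite operation is $\mathcal Z^{ABC\to A'B'C'}=\mathcal D\circ\mathcal E$. Let $\phi$ denote normalized EPR pairs. The average channel input is $\rho^{A'}=\operatorname{Tr}_{\widetilde A_1\widetilde A_2R}\mathcal E(\phi^{A_1\widetilde A_1}\phi^{A_2\widetilde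 A_2})$, and the channel fidelity is $f_c=\operatorname{Tr}\,\phi^{\widetilde A_1B'}\phi^{\widetilde A_2C'}\,\mathcal M(\phi^{A_1\widetilde A_1}\phi^{A_2\widetilde A_2})$ with $\mathcal M=\mathcal D\circ\mathcal N\circ\mathcal E$. The code satisfies $A\not\to BC$ if $\operatorname{Tr}_{A'}\circ\mathcal Z=\mathcal Z_{bc}\circ\operatorname{Tr}_A$ for some channel $\mathcal Z_{bc}^{BC\to B'C'}$; the conditions $B\not\to AC$ and $C\not\to AB$ are defined likewise. It is *no-signalling* (NS) if all three hold. It is *PPT-preserving* (PPT) if the Choi matrix $Z$ of $\mathcal Z$ satisfies $Z^{T_{AA'}},Z^{T_{BB'}},Z^{T_{CC'}}\ge 0$. **Constraints.** For operators $E_1^{A'BC}$, $E_2^{A'B}$, $E_3^{A'C}$ put $$X=\big(E_1^{A'B}+(r_2^2-1)E_2^{A'B}\big)\otimes\tfrac{\mathbb 1^C}{|C|},\qquad Y=\big(E_1^{A'C}+(r_1^2-1)E_3^{A'C}\big)\otimes\tfrac{\mathbb 1^B}{|B|}.$$ (a) Base constraints: $\rho^{A'}\ge 0$, $\operatorname{Tr}\rho^{A'}=1$,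 and $$f_c=\operatorname{Tr}E_1^{A'BC}(N^{A'BC})^T,\qquad 0\le E_1^{A'BC}\le Y,\qquad E_1^{A'BC}\le X,\qquad X+Y\le\rho^{A'}\mathbb 1^{BC}+E_1^{A'BC}.$$ (b) Marginal constraints: $$E_1^{BC}=\frac{\mathbb 1^{BC}}{r_1^2r_2^2},\qquad E_3^{C}=\frac{|B|\,\mathbb 1^{C}}{r_1^2r_2^2},\qquad E_2^{B}=\frac{|C|\,\mathbb 1^{B}}{r_1^2r_2^2}.$$ (c) PPT constraints: $$\Big|\tfrac1{r_2}X^{T_B}+\tfrac1{r_1}Y^{T_C}\Big|\le\tfrac1{r_1r_2}\rho^{A'}\mathbb 1^{BC}+E_1^{T_{BC}},\qquad \Big|\tfrac1{r_2}X^{T_B}-\tfrac1{r_1}Y^{T_C}\Big|\le\tfrac1{r_1r_2}\rho^{A'}\mathbb 1^{BC}-E_1^{T_{BC}},$$ $$|E_1^{T_B}|\le\tfrac1{r_1}Y,\qquad |r_1X^{T_B}-r_1E_1^{T_B}|\le\rho^{A'}\mathbb 1^{BC}-Y,$$ $$|E_1^{T_C}|\le\tfrac1{r_2}X,\qquad |r_2Y^{T_C}-r_2E_1^{T_C}|\le\rho^{A'}\mathbb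 1^{BC}-X.$$ **Proposition.** Let $\rho^{A'}$ be an operator and $f_c$ a real number. 1. There is an NS forward-assisted code of size $(r_1,r_2)$ with average channel input $\rho^{A'}$ and channel fidelity $f_c$ if and only if some $E_1^{A'BC},E_2^{A'B},E_3^{A'C}$ satisfy (a) and (b). 2. There is such a code that is both NS and PPT if and only if some $E_1^{A'BC},E_2^{A'B},E_3^{A'C}$ satisfy (a), (b) and (c). 3. Let $r_1r_2>1$. There is a PPT forward-assisted code of size $(r_1,r_2)$ with average channel input $\rho^{A'}$ and channel fidelity $f_c$ that satisfies $B\not\to AC$ and $C\not\to AB$ (while $A$ may signal) if and only if some $E_1^{A'BC},E_2^{A'B},E_3^{A'C}$ satisfy (a) and (c). 4. Let $r_1r_2>1$. There is a PPT forward-assisted code of size $(r_1,r_2)$ with average channel input $\rho^{A'}$ and channel fidelity $f_c$ (no no-signalling condition is imposed) if and only if there are operators $E_1,E_2,E_3\ge0$ on $A'BC$, with $\rho^{A'}\ge0$ and $\operatorname{Tr}\rho^{A'}=1$, such that $f_c=\operatorname{Tr}E_1N^T$, $\;E_1+(r_2^2-1)E_2+(r_1^2-1)E_3\le\rho^{A'}\mathbb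 1^{BC}$, and $$-\tfrac{1}{r_1r_2}\rho^{A'}\mathbb 1^{BC}-\big(1+\tfrac1{r_2}+\tfrac1{r_1}\big)E_1^{T_{BC}}\le\tfrac{r_2^2-1}{r_2}E_2^{T_{BC}}+\tfrac{r_1^2-1}{r_1}E_3^{T_{BC}}\le\tfrac{1}{r_1r_2}\rho^{A'}\mathbb 1^{BC}+\big(1-\tfrac1{r_2}-\tfrac1{r_1}\big)E_1^{T_{BC}},$$ $$-\tfrac{1}{r_1r_2}\rho^{A'}\mathbb 1^{BC}+\big(1-\tfrac1{r_2}+\tfrac1{r_1}\big)E_1^{T_{BC}}\le\tfrac{r_2^2-1}{r_2}E_2^{T_{BC}}-\tfrac{r_1^2-1}{r_1}E_3^{T_{BC}}\le\tfrac{1}{r_1r_2}\rho^{A'}\mathbb 1^{BC}-\big(1+\tfrac1{r_2}-\tfrac1{r_1}\big)E_1^{T_{BC}},$$ $$-(r_1-1)E_3^{T_B}\le E_1^{T_B}\le(r_1+1)E_3^{T_B},\qquad |r_1(r_2^2-1)E_2^{T_B}|\le\rho^{A'}\mathbb 1^{BC}-(r_1^2-1)E_3^{T_B}-E_1^{T_B},$$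 $$-(r_2-1)E_2^{T_C}\le E_1^{T_C}\le(r_2+1)E_2^{T_C},\qquad |r_2(r_1^2-1)E_3^{T_C}|\le\rho^{A'}\mathbb 1^{BC}-(r_2^2-1)E_2^{T_C}-E_1^{T_C}.$$ -/

import Mathlib

open scoped Matrix ComplexOrder MatrixOrder Kronecker

noncomputable section

namespace BroadcastCode

/-- Operators on the finite-dimensional Hilbert space with standard orthonormal basis `n`. -/
abbrev Op (n : Type*) := Matrix n n ℂ

section Basic

variable {κ m n : Type*}

/-- Partial trace over the first tensor factor. -/
def trFst [Fintype m] (X : Op (m × n)) : Op n :=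
  Matrix.of fun p q => ∑ i, X (i, p) (i, q)

/-- Partial trace over the second tensor factor. -/
def trSnd [Fintype n] (X : Op (m × n)) : Op m :=
  Matrix.of fun p q => ∑ i, X (p, i) (q, i)

/-- Partial transpose on the second tensor factor. -/
def ptSnd (X : Op (m × n)) : Op (m × n) :=
  Matrix.of fun p q => X (p.1, q.2) (q.1, p.2)

/-- `|X| ≤ Y` in the sense `-Y ≤ X ≤ Y` (Loewner order). -/
def AbsLE [Fintype n] (X Y : Op n) : Prop := -Y ≤ X ∧ X ≤ Y

/-- A density operator. -/
def IsDensity [Fintype n] (ρ : Op n) : Prop := ρ.PosSemidef ∧ ρ.trace = 1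

/-- `id ⊗ Φ`, where the identity acts on the operators of the reference system `κ`. -/
def amplify (κ : Type*) (Φ : Op m →ₗ[ℂ] Op n) : Op (κ × m) →ₗ[ℂ] Op (κ × n) where
  toFun X := Matrix.of fun p q => Φ (X.submatrix (Prod.mk p.1) (Prod.mk q.1)) p.2 q.2
  map_add' X Y := by
    ext p q
    have h : (X + Y).submatrix (Prod.mk p.1) (Prod.mk q.1)
        = X.submatrix (Prod.mk p.1) (Prod.mk q.1) + Y.submatrix (Prod.mk p.1) (Prod.mk q.1) := rfl
    simp [h]
  map_smul' t X := by
    ext p q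
    have h : (t • X).submatrix (Prod.mk p.1) (Prod.mk q.1)
        = t • X.submatrix (Prod.mk p.1) (Prod.mk q.1) := rfl
    simp [h]

/-- A quantum channel: a completely positive, trace-preserving linear map. -/
def IsChannel [Fintype m] [Fintype n] (Φ : Op m →ₗ[ℂ] Op n) : Prop :=
  (∀ (k : ℕ) (X : Op (Fin k × m)), X.PosSemidef → (amplify (Fin k) Φ X).PosSemidef) ∧
    ∀ X : Op m, (Φ X).trace = X.trace

/-- The unnormalized maximally entangled operator `∑ i j, |ii⟩⟨jj|`. -/
def maxEnt (n : Type*) [DecidableEq n] : Op (n × n) :=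
  Matrix.of fun p q => if p.1 = p.2 ∧ q.1 = q.2 then 1 else 0

/-- The (normalized) EPR pair. For a product index type `m × n` it is the tensor product of the
EPR pair on `m` and the EPR pair on `n`. -/
def epr (n : Type*) [Fintype n] [DecidableEq n] : Op (n × n) :=
  ((Fintype.card n : ℂ)⁻¹) • maxEnt n

/-- Choi matrix, with respect to the unnormalized maximally entangled operator. -/
def choi [DecidableEq m] (Φ : Op m →ₗ[ℂ] Op n) : Op (m × n) := amplify m Φ (maxEnt m)

/-- Channel fidelity of a map whose output space is a copy of its input space. -/
def channelFidelity [Fintype n] [DecidableEq n] (Φ : Op n →ₗ[ℂ] Op n) : ℂ :=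
  (epr n * amplify n Φ (epr n)).trace

/-- The map `X ↦ V X V†`. -/
def conjMap [Fintype m] (V : Matrix n m ℂ) : Op m →ₗ[ℂ] Op n where
  toFun X := V * X * Vᴴ
  map_add' X Y := by simp [Matrix.mul_add, Matrix.add_mul]
  map_smul' t X := by simp

end Basic

section Tripartite

variable {α β γ α' β' γ' : Type*}

/-- Partial trace over the second of three tensor factors. -/
def trMid [Fintype β] (X : Op (α × β × γ)) : Op (α × γ) :=
  Matrix.of fun p q => ∑ i, X (p.1, i, p.2) (q.1, i, q.2)

/-- Partial trace over the third of three tensor factors. -/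
def trLast [Fintype γ] (X : Op (α × β × γ)) : Op (α × β) :=
  Matrix.of fun p q => ∑ i, X (p.1, p.2, i) (q.1, q.2, i)

/-- Partial transpose on the second of three tensor factors. -/
def ptMid (X : Op (α × β × γ)) : Op (α × β × γ) :=
  Matrix.of fun p q => X (p.1, q.2.1, p.2.2) (q.1, p.2.1, q.2.2)

/-- Partial transpose on the third of three tensor factors. -/
def ptLast (X : Op (α × β × γ)) : Op (α × β × γ) :=
  Matrix.of fun p q => X (p.1, p.2.1, q.2.2) (q.1, q.2.1, p.2.2)

/-- `S ⊗ 1 / |β|`, for `S` on `α ⊗ γ` and the identity on the middle factor `β`. -/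
def padMid [Fintype β] [DecidableEq β] (S : Op (α × γ)) : Op (α × β × γ) :=
  Matrix.of fun p q =>
    if p.2.1 = q.2.1 then S (p.1, p.2.2) (q.1, q.2.2) / (Fintype.card β : ℂ) else 0

/-- `S ⊗ 1 / |γ|`, for `S` on `α ⊗ β` and the identity on the last factor `γ`. -/
def padLast [Fintype γ] [DecidableEq γ] (S : Op (α × β)) : Op (α × β × γ) :=
  Matrix.of fun p q =>
    if p.2.2 = q.2.2 then S (p.1, p.2.1) (q.1, q.2.1) / (Fintype.card γ : ℂ) else 0

/-- Alice cannot signal to Bob and Charlie. -/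
def NoSignalA [Fintype α] [Fintype α'] [Fintype β] [Fintype γ] [Fintype β'] [Fintype γ']
    (Z : Op (α × β × γ) →ₗ[ℂ] Op (α' × β' × γ')) : Prop :=
  ∃ Ψ : Op (β × γ) →ₗ[ℂ] Op (β' × γ'), IsChannel Ψ ∧ ∀ X, trFst (Z X) = Ψ (trFst X)

/-- Bob cannot signal to Alice and Charlie. -/
def NoSignalB [Fintype α] [Fintype α'] [Fintype β] [Fintype γ] [Fintype β'] [Fintype γ']
    (Z : Op (α × β × γ) →ₗ[ℂ] Op (α' × β' × γ')) : Prop :=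
  ∃ Ψ : Op (α × γ) →ₗ[ℂ] Op (α' × γ'), IsChannel Ψ ∧ ∀ X, trMid (Z X) = Ψ (trMid X)

/-- Charlie cannot signal to Alice and Bob. -/
def NoSignalC [Fintype α] [Fintype α'] [Fintype β] [Fintype γ] [Fintype β'] [Fintype γ']
    (Z : Op (α × β × γ) →ₗ[ℂ] Op (α' × β' × γ')) : Prop :=
  ∃ Ψ : Op (α × β) →ₗ[ℂ] Op (α' × β'), IsChannel Ψ ∧ ∀ X, trLast (Z X) = Ψ (trLast X)

/-- Partial transpose of a tripartite Choi matrix on Alice's input and output. -/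
def ptA (X : Op ((α × β × γ) × (α' × β' × γ'))) : Op ((α × β × γ) × (α' × β' × γ')) :=
  Matrix.of fun p q =>
    X ((q.1.1, p.1.2), (q.2.1, p.2.2)) ((p.1.1, q.1.2), (p.2.1, q.2.2))

/-- Partial transpose of a tripartite Choi matrix on Bob's input and output. -/
def ptB (X : Op ((α × β × γ) × (α' × β' × γ'))) : Op ((α × β × γ) × (α' × β' × γ')) :=
  Matrix.of fun p q =>
    X ((p.1.1, q.1.2.1, p.1.2.2), (p.2.1, q.2.2.1, p.2.2.2))
      ((q.1.1, p.1.2.1, q.1.2.2), (q.2.1, p.2.2.1, q.2.2.2))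

/-- Partial transpose of a tripartite Choi matrix on Charlie's input and output. -/
def ptC (X : Op ((α × β × γ) × (α' × β' × γ'))) : Op ((α × β × γ) × (α' × β' × γ')) :=
  Matrix.of fun p q =>
    X ((p.1.1, p.1.2.1, q.1.2.2), (p.2.1, p.2.2.1, q.2.2.2))
      ((q.1.1, q.1.2.1, p.1.2.2), (q.2.1, q.2.2.1, p.2.2.2))

/-- PPT-preserving tripartite operation: the Choi matrix is PPT across each of the three cuts
(this is also known as completely PPT-preserving). -/
def IsPPT [Fintype α] [Fintype α'] [Fintype β] [Fintype γ] [Fintype β'] [Fintype γ']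
    [DecidableEq α] [DecidableEq β] [DecidableEq γ]
    (Z : Op (α × β × γ) →ₗ[ℂ] Op (α' × β' × γ')) : Prop :=
  (ptA (choi Z)).PosSemidef ∧ (ptB (choi Z)).PosSemidef ∧ (ptC (choi Z)).PosSemidef

end Tripartite

/-- A forward-assisted code of size `(r₁, r₂)` for channels from `a` to `b ⊗ c`: an encoding
isometry `A₁ A₂ → A' R` and a joint decoding channel `R B C → B' C'`, with
`|A₁| = |B'| = r₁` and `|A₂| = |C'| = r₂`; the register `R` has an arbitrary finite dimension. -/
structure ForwardCode (a b c : Type*) [Fintype a] [Fintype b] [Fintype c] (r₁ r₂ : ℕ) where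
  dimR : ℕ
  enc : Matrix (a × Fin dimR) (Fin r₁ × Fin r₂) ℂ
  enc_isometry : encᴴ * enc = 1
  dec : Op (Fin dimR × b × c) →ₗ[ℂ] Op (Fin r₁ × Fin r₂)
  dec_channel : IsChannel dec

namespace ForwardCode

variable {a b c : Type*} [Fintype a] [Fintype b] [Fintype c] [DecidableEq b] [DecidableEq c]
  {r₁ r₂ : ℕ}

/-- The tripartite operation `A B C → A' B' C'` of the code, with `A = A₁ A₂`. -/
def operation (K : ForwardCode a b c r₁ r₂) :
    Op ((Fin r₁ × Fin r₂) × b × c) →ₗ[ℂ] Op (a × Fin r₁ × Fin r₂) :=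
  amplify a K.dec ∘ₗ
    (Matrix.reindexLinearEquiv ℂ ℂ (Equiv.prodAssoc a (Fin K.dimR) (b × c))
      (Equiv.prodAssoc a (Fin K.dimR) (b × c))).toLinearMap ∘ₗ
    conjMap (K.enc ⊗ₖ (1 : Op (b × c)))

/-- The channel `A₁ A₂ → B' C'` that the code makes out of `N : A' → B C`. -/
def induced (K : ForwardCode a b c r₁ r₂) (N : Op a →ₗ[ℂ] Op (b × c)) :
    Op (Fin r₁ × Fin r₂) →ₗ[ℂ] Op (Fin r₁ × Fin r₂) :=
  K.dec ∘ₗ amplify (Fin K.dimR) N ∘ₗ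
    (Matrix.reindexLinearEquiv ℂ ℂ (Equiv.prodComm a (Fin K.dimR))
      (Equiv.prodComm a (Fin K.dimR))).toLinearMap ∘ₗ
    conjMap K.enc

/-- The average channel input: the encoder is applied to halves of the EPR pairs, and everything
but `A'` is traced out. -/
def avgInput (K : ForwardCode a b c r₁ r₂) : Op a :=
  trSnd (trFst (amplify (Fin r₁ × Fin r₂) (conjMap K.enc) (epr (Fin r₁ × Fin r₂))))

/-- No party can signal to the other two. -/
def IsNS (K : ForwardCode a b c r₁ r₂) : Prop :=
  NoSignalA K.operation ∧ NoSignalB K.operation ∧ NoSignalC K.operation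

/-- The code has average channel input `ρ`, and channel fidelity `f` on the channel `N`. -/
def Attains (K : ForwardCode a b c r₁ r₂) (N : Op a →ₗ[ℂ] Op (b × c)) (ρ : Op a) (f : ℝ) : Prop :=
  K.avgInput = ρ ∧ channelFidelity (K.induced N) = (f : ℂ)

end ForwardCode

section Constraints

variable {a b c : Type*} [Fintype a] [Fintype b] [Fintype c]
  [DecidableEq a] [DecidableEq b] [DecidableEq c]

/-- `(E₁^{A'B} + (r₂² - 1) E₂^{A'B}) ⊗ 1^C / |C|`. -/
def opB (r₂ : ℕ) (E₁ : Op (a × b × c)) (E₂ : Op (a × b)) : Op (a × b × c) :=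
  padLast (trLast E₁ + ((r₂ : ℂ) ^ 2 - 1) • E₂)

/-- `(E₁^{A'C} + (r₁² - 1) E₃^{A'C}) ⊗ 1^B / |B|`. -/
def opC (r₁ : ℕ) (E₁ : Op (a × b × c)) (E₃ : Op (a × c)) : Op (a × b × c) :=
  padMid (trMid E₁ + ((r₁ : ℂ) ^ 2 - 1) • E₃)

/-- `((E₁^{A'B})^{T_B} + (r₂² - 1) (E₂^{A'B})^{T_B}) ⊗ 1^C / |C|`. -/
def opBT (r₂ : ℕ) (E₁ : Op (a × b × c)) (E₂ : Op (a × b)) : Op (a × b × c) :=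
  padLast (ptSnd (trLast E₁) + ((r₂ : ℂ) ^ 2 - 1) • ptSnd E₂)

/-- `((E₁^{A'C})^{T_C} + (r₁² - 1) (E₃^{A'C})^{T_C}) ⊗ 1^B / |B|`. -/
def opCT (r₁ : ℕ) (E₁ : Op (a × b × c)) (E₃ : Op (a × c)) : Op (a × b × c) :=
  padMid (ptSnd (trMid E₁) + ((r₁ : ℂ) ^ 2 - 1) • ptSnd E₃)

/-- The constraints common to all classes of codes: the fidelity, `ρ` is a state, and the
operator inequalities without partial transposes. -/
def BaseConstraints (N : Op a →ₗ[ℂ] Op (b × c)) (r₁ r₂ : ℕ) (ρ : Op a) (f : ℝ)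
    (E₁ : Op (a × b × c)) (E₂ : Op (a × b)) (E₃ : Op (a × c)) : Prop :=
  (f : ℂ) = (E₁ * (choi N)ᵀ).trace ∧
  IsDensity ρ ∧
  0 ≤ E₁ ∧
  E₁ ≤ opC r₁ E₁ E₃ ∧
  E₁ ≤ opB r₂ E₁ E₂ ∧
  opB r₂ E₁ E₂ + opC r₁ E₁ E₃ ≤ ρ ⊗ₖ (1 : Op (b × c)) + E₁

/-- The constraints on the marginals on `BC`, `C` and `B`. -/
def MarginalConstraints (r₁ r₂ : ℕ)
    (E₁ : Op (a × b × c)) (E₂ : Op (a × b)) (E₃ : Op (a × c)) : Prop :=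
  trFst E₁ = (1 / ((r₁ : ℂ) ^ 2 * (r₂ : ℂ) ^ 2)) • (1 : Op (b × c)) ∧
  trFst E₃ = ((Fintype.card b : ℂ) / ((r₁ : ℂ) ^ 2 * (r₂ : ℂ) ^ 2)) • (1 : Op c) ∧
  trFst E₂ = ((Fintype.card c : ℂ) / ((r₁ : ℂ) ^ 2 * (r₂ : ℂ) ^ 2)) • (1 : Op b)

/-- The constraints with partial transposes. -/
def PPTConstraints (r₁ r₂ : ℕ) (ρ : Op a)
    (E₁ : Op (a × b × c)) (E₂ : Op (a × b)) (E₃ : Op (a × c)) : Prop :=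
  AbsLE ((1 / (r₂ : ℂ)) • opBT r₂ E₁ E₂ + (1 / (r₁ : ℂ)) • opCT r₁ E₁ E₃)
    ((1 / ((r₁ : ℂ) * (r₂ : ℂ))) • (ρ ⊗ₖ (1 : Op (b × c))) + ptSnd E₁) ∧
  AbsLE ((1 / (r₂ : ℂ)) • opBT r₂ E₁ E₂ - (1 / (r₁ : ℂ)) • opCT r₁ E₁ E₃)
    ((1 / ((r₁ : ℂ) * (r₂ : ℂ))) • (ρ ⊗ₖ (1 : Op (b × c))) - ptSnd E₁) ∧
  AbsLE (ptMid E₁) ((1 / (r₁ : ℂ)) • opC r₁ E₁ E₃) ∧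
  AbsLE ((r₁ : ℂ) • opBT r₂ E₁ E₂ - (r₁ : ℂ) • ptMid E₁)
    (ρ ⊗ₖ (1 : Op (b × c)) - opC r₁ E₁ E₃) ∧
  AbsLE (ptLast E₁) ((1 / (r₂ : ℂ)) • opB r₂ E₁ E₂) ∧
  AbsLE ((r₂ : ℂ) • opCT r₁ E₁ E₃ - (r₂ : ℂ) • ptLast E₁)
    (ρ ⊗ₖ (1 : Op (b × c)) - opB r₂ E₁ E₂)

/-- The constraints for codes without any no-signalling requirement, where the operators `E₂` and
`E₃` on `A'BC` cannot be eliminated: the fidelity, `ρ` is a state, complete positivity, and the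
three PPT conditions. -/
def UnreducedPPTConstraints (N : Op a →ₗ[ℂ] Op (b × c)) (r₁ r₂ : ℕ) (ρ : Op a) (f : ℝ)
    (E₁ E₂ E₃ : Op (a × b × c)) : Prop :=
  let R : Op (a × b × c) := ρ ⊗ₖ (1 : Op (b × c))
  let s : ℂ := r₁
  let t : ℂ := r₂
  (f : ℂ) = (E₁ * (choi N)ᵀ).trace ∧
  IsDensity ρ ∧
  0 ≤ E₁ ∧ 0 ≤ E₂ ∧ 0 ≤ E₃ ∧
  E₁ + (t ^ 2 - 1) • E₂ + (s ^ 2 - 1) • E₃ ≤ R ∧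
  -- partial transpose on `A`, written as a partial transpose on `BC`
  -((1 / (s * t)) • R) - (1 + 1 / t + 1 / s) • ptSnd E₁
    ≤ ((t ^ 2 - 1) / t) • ptSnd E₂ + ((s ^ 2 - 1) / s) • ptSnd E₃ ∧
  ((t ^ 2 - 1) / t) • ptSnd E₂ + ((s ^ 2 - 1) / s) • ptSnd E₃
    ≤ (1 / (s * t)) • R + (1 - 1 / t - 1 / s) • ptSnd E₁ ∧
  -((1 / (s * t)) • R) + (1 - 1 / t + 1 / s) • ptSnd E₁
    ≤ ((t ^ 2 - 1) / t) • ptSnd E₂ - ((s ^ 2 - 1) / s) • ptSnd E₃ ∧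
  ((t ^ 2 - 1) / t) • ptSnd E₂ - ((s ^ 2 - 1) / s) • ptSnd E₃
    ≤ (1 / (s * t)) • R - (1 + 1 / t - 1 / s) • ptSnd E₁ ∧
  -- partial transpose on `B`
  -((s - 1) • ptMid E₃) ≤ ptMid E₁ ∧ ptMid E₁ ≤ (s + 1) • ptMid E₃ ∧
  AbsLE ((s * (t ^ 2 - 1)) • ptMid E₂) (R - (s ^ 2 - 1) • ptMid E₃ - ptMid E₁) ∧
  -- partial transpose on `C`
  -((t - 1) • ptLast E₂) ≤ ptLast E₁ ∧ ptLast E₁ ≤ (t + 1) • ptLast E₂ ∧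
  AbsLE ((t * (s ^ 2 - 1)) • ptLast E₃) (R - (t ^ 2 - 1) • ptLast E₂ - ptLast E₁)

end Constraints

end BroadcastCode

end

open scoped Matrix ComplexOrder MatrixOrder Kronecker

noncomputable section

namespace BroadcastCode

section Maps

variable {κ l m n o : Type*}

theorem posSemidef_kronecker [Fintype m] [Fintype n] {X : Op m} {Y : Op n} (hX : X.PosSemidef)
    (hY : Y.PosSemidef) : (X ⊗ₖ Y).PosSemidef := hX.kronecker hY

/-- Summing all blocks of a positive semidefinite matrix preserves positivity. -/
theorem posSemidef_sum_blocks [Fintype l] [Fintype m] [Fintype n] {M : Op l} (hM : M.PosSemidef)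
    (f : m → n → l) :
    (Matrix.of fun x y => ∑ u, ∑ v, M (f u x) (f v y) : Op n).PosSemidef := by
  classical
  have hK := hM.submatrix (fun p : m × n => f p.1 p.2)
  have := hK.conjTranspose_mul_mul_same
    (Matrix.of fun (p : m × n) (x : n) => if p.2 = x then (1 : ℂ) else 0)
  convert this using 1
  ext x y
  simp only [Matrix.of_apply, Matrix.mul_apply, Matrix.conjTranspose_apply, Matrix.submatrix_apply,
    Fintype.sum_prod_type, apply_ite star, star_one, star_zero, ite_mul, one_mul, zero_mul,
    mul_ite, mul_one, mul_zero, Finset.sum_ite_eq', Finset.mem_univ, if_true]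
  rw [Finset.sum_comm]

theorem posSemidef_sum_diag_blocks [Fintype l] [Fintype m] [Fintype n] {M : Op l}
    (hM : M.PosSemidef) (f : m → n → l) :
    (Matrix.of fun x y => ∑ u, M (f u x) (f u y) : Op n).PosSemidef := by
  have := Matrix.posSemidef_sum Finset.univ (fun u _ => hM.submatrix (f u))
  convert this using 1
  ext x y
  simp [Matrix.sum_apply]

theorem choi_apply [DecidableEq m] (Φ : Op m →ₗ[ℂ] Op n) (p q : m × n) :
    choi Φ p q = Φ (Matrix.single p.1 q.1 1) p.2 q.2 := by
  have : (maxEnt m).submatrix (Prod.mk p.1) (Prod.mk q.1) = Matrix.single p.1 q.1 (1 : ℂ) := by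
    ext i j
    simp [maxEnt, Matrix.single_apply]
  simp [choi, amplify, this]

theorem apply_eq_sum_choi [Fintype m] [DecidableEq m] (Φ : Op m →ₗ[ℂ] Op n) (X : Op m) (p q : n) :
    Φ X p q = ∑ i, ∑ j, X i j * choi Φ (i, p) (j, q) := by
  conv_lhs => rw [Matrix.matrix_eq_sum_single X]
  simp only [map_sum, Matrix.sum_apply, choi_apply]
  refine Finset.sum_congr rfl fun i _ => Finset.sum_congr rfl fun j _ => ?_
  rw [← mul_one (X i j), ← smul_eq_mul, ← Matrix.smul_single, map_smul]
  simp

/-- The linear map with a given Choi matrix. -/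
def ofChoi [Fintype m] (J : Op (m × n)) : Op m →ₗ[ℂ] Op n where
  toFun X := Matrix.of fun p q => ∑ i, ∑ j, X i j * J (i, p) (j, q)
  map_add' X Y := by
    ext p q
    simp [add_mul, Finset.sum_add_distrib]
  map_smul' t X := by
    ext p q
    simp [Finset.mul_sum, mul_assoc]

theorem choi_ofChoi [Fintype m] [DecidableEq m] (J : Op (m × n)) : choi (ofChoi J) = J := by
  ext p q
  rw [choi_apply]
  simp only [ofChoi, LinearMap.coe_mk, AddHom.coe_mk, Matrix.of_apply, Matrix.single_apply,
    ite_and, ite_mul, one_mul, zero_mul]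
  simp

theorem amplify_apply (Φ : Op m →ₗ[ℂ] Op n) (X : Op (κ × m)) (p q : κ × n) :
    amplify κ Φ X p q = Φ (X.submatrix (Prod.mk p.1) (Prod.mk q.1)) p.2 q.2 := rfl

theorem amplify_comp (Φ : Op m →ₗ[ℂ] Op n) (Ψ : Op n →ₗ[ℂ] Op o) :
    amplify κ (Ψ ∘ₗ Φ) = amplify κ Ψ ∘ₗ amplify κ Φ := rfl

theorem IsChannel.comp [Fintype m] [Fintype n] [Fintype o] {Φ : Op m →ₗ[ℂ] Op n}
    {Ψ : Op n →ₗ[ℂ] Op o} (hΨ : IsChannel Ψ) (hΦ : IsChannel Φ) : IsChannel (Ψ ∘ₗ Φ) :=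
  ⟨fun k X hX => by
    rw [amplify_comp]
    exact hΨ.1 k _ (hΦ.1 k X hX), fun X => by simp [hΨ.2, hΦ.2]⟩

theorem posSemidef_maxEnt [Fintype m] [DecidableEq m] : (maxEnt m).PosSemidef := by
  have := Matrix.posSemidef_vecMulVec_self_star
    (fun p : m × m => if p.1 = p.2 then (1 : ℂ) else 0)
  convert this using 1
  ext p q
  by_cases h : p.1 = p.2 <;> by_cases h' : q.1 = q.2 <;>
    simp [maxEnt, Matrix.vecMulVec_apply, h, h']

theorem posSemidef_amplify [Fintype κ] [Fintype m] [Fintype n] [DecidableEq m]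
    {Φ : Op m →ₗ[ℂ] Op n}
    (hΦ : (choi Φ).PosSemidef) {X : Op (κ × m)} (hX : X.PosSemidef) :
    (amplify κ Φ X).PosSemidef := by
  have h := posSemidef_sum_blocks (posSemidef_kronecker hX hΦ)
    (fun (i : m) (p : κ × n) => ((p.1, i), (i, p.2)))
  have e : amplify κ Φ X = Matrix.of fun (p q : κ × n) => ∑ i, ∑ j,
      (X ⊗ₖ choi Φ) ((p.1, i), (i, p.2)) ((q.1, j), (j, q.2)) := by
    ext p q
    simp [amplify_apply, apply_eq_sum_choi]
  rw [e]
  exact h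

theorem IsChannel.choi_posSemidef [Fintype m] [Fintype n] [DecidableEq m] {Φ : Op m →ₗ[ℂ] Op n}
    (hΦ : IsChannel Φ) : (choi Φ).PosSemidef := by
  let e := Fintype.equivFin m
  have h := (hΦ.1 (Fintype.card m) ((maxEnt m).submatrix (Prod.map e.symm id)
    (Prod.map e.symm id)) (posSemidef_maxEnt.submatrix _)).submatrix (Prod.map e id)
  convert h using 1
  ext p q
  have e' : ((maxEnt m).submatrix (Prod.map e.symm id) (Prod.map e.symm id)).submatrix
      (Prod.mk (e p.1)) (Prod.mk (e q.1)) = (maxEnt m).submatrix (Prod.mk p.1) (Prod.mk q.1) := by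
    ext i j
    simp
  simp only [choi, amplify_apply, Matrix.submatrix_apply, Prod.map_fst, Prod.map_snd, id, e']

theorem IsChannel.sum_choi [Fintype m] [Fintype n] [DecidableEq m] {Φ : Op m →ₗ[ℂ] Op n}
    (hΦ : IsChannel Φ) (i j : m) : ∑ p, choi Φ (i, p) (j, p) = if i = j then 1 else 0 := by
  have := hΦ.2 (Matrix.single i j 1)
  simp only [Matrix.trace, Matrix.diag_apply, Matrix.single_apply] at this
  simp only [choi_apply, this]
  by_cases h : i = j
  · subst h; simp
  · rw [if_neg h]
    exact Finset.sum_eq_zero fun x _ => if_neg fun hx => h (hx.1.trans hx.2.symm)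

theorem isChannel_of_choi [Fintype m] [Fintype n] [DecidableEq m] {Φ : Op m →ₗ[ℂ] Op n}
    (hΦ : (choi Φ).PosSemidef)
    (htr : ∀ i j, ∑ p, choi Φ (i, p) (j, p) = if i = j then 1 else 0) : IsChannel Φ := by
  refine ⟨fun k X hX => posSemidef_amplify hΦ hX, fun X => ?_⟩
  simp only [Matrix.trace, Matrix.diag_apply, apply_eq_sum_choi]
  rw [Finset.sum_comm]
  refine Finset.sum_congr rfl fun i _ => ?_
  rw [Finset.sum_comm]
  simp [← Finset.mul_sum, htr]

/-- If the marginal output of a channel depends only on the marginal input, it is obtained from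
the marginal input by a channel. -/
theorem IsChannel.exists_factor {m' n' : Type*} [Fintype m] [Fintype n] [Fintype m'] [Fintype n']
    {Z : Op m →ₗ[ℂ] Op n} (hZ : IsChannel Z) {S : Op m' →ₗ[ℂ] Op m} (hS : IsChannel S)
    {T : Op n →ₗ[ℂ] Op n'} (hT : IsChannel T) (tr : Op m → Op m')
    (h : ∀ X, T (Z X) = T (Z (S (tr X)))) :
    ∃ Ψ : Op m' →ₗ[ℂ] Op n', IsChannel Ψ ∧ ∀ X, T (Z X) = Ψ (tr X) :=
  ⟨T ∘ₗ Z ∘ₗ S, hT.comp (hZ.comp hS), h⟩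

end Maps

section Marginals

variable {α β γ : Type*} [Fintype α] [Fintype β] [Fintype γ]

/-- Partial trace over the first factor as a linear map. -/
def trFstMap (α γ : Type*) [Fintype α] : Op (α × γ) →ₗ[ℂ] Op γ where
  toFun := trFst
  map_add' X Y := by ext; simp [trFst, Finset.sum_add_distrib]
  map_smul' t X := by ext; simp [trFst, Finset.mul_sum]

/-- Partial trace over the middle factor as a linear map. -/
def trMidMap (α β γ : Type*) [Fintype β] : Op (α × β × γ) →ₗ[ℂ] Op (α × γ) where
  toFun := trMid
  map_add' X Y := by ext; simp [trMid, Finset.sum_add_distrib]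
  map_smul' t X := by ext; simp [trMid, Finset.mul_sum]

/-- Partial trace over the last factor as a linear map. -/
def trLastMap (α β γ : Type*) [Fintype γ] : Op (α × β × γ) →ₗ[ℂ] Op (α × β) where
  toFun := trLast
  map_add' X Y := by ext; simp [trLast, Finset.sum_add_distrib]
  map_smul' t X := by ext; simp [trLast, Finset.mul_sum]

theorem isChannel_trFstMap : IsChannel (trFstMap α γ) :=
  ⟨fun k X hX => posSemidef_sum_diag_blocks hX (fun (u : α) (x : Fin k × γ) => (x.1, u, x.2)),
    fun X => by
      simp only [trFstMap, trFst, LinearMap.coe_mk, AddHom.coe_mk, Matrix.trace,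
        Matrix.diag_apply, Matrix.of_apply, Fintype.sum_prod_type]
      rw [Finset.sum_comm]⟩

theorem isChannel_trMidMap : IsChannel (trMidMap α β γ) :=
  ⟨fun k X hX => posSemidef_sum_diag_blocks hX
      (fun (u : β) (x : Fin k × α × γ) => (x.1, x.2.1, u, x.2.2)),
    fun X => by
      simp only [trMidMap, trMid, LinearMap.coe_mk, AddHom.coe_mk, Matrix.trace,
        Matrix.diag_apply, Matrix.of_apply, Fintype.sum_prod_type]
      refine Finset.sum_congr rfl fun _ _ => ?_
      rw [Finset.sum_comm]⟩

theorem isChannel_trLastMap : IsChannel (trLastMap α β γ) :=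
  ⟨fun k X hX => posSemidef_sum_diag_blocks hX
      (fun (u : γ) (x : Fin k × α × β) => (x.1, x.2.1, x.2.2, u)),
    fun X => by
      simp only [trLastMap, trLast, LinearMap.coe_mk, AddHom.coe_mk, Matrix.trace,
        Matrix.diag_apply, Matrix.of_apply, Fintype.sum_prod_type]⟩

variable [DecidableEq α] [DecidableEq β] [DecidableEq γ]

/-- Tensoring with the maximally mixed state on the first factor. -/
def padFst (S : Op γ) : Op (α × γ) :=
  Matrix.of fun p q => if p.1 = q.1 then S p.2 q.2 / (Fintype.card α : ℂ) else 0

/-- `padFst` as a linear map. -/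
def padFstMap (α γ : Type*) [Fintype α] [DecidableEq α] : Op γ →ₗ[ℂ] Op (α × γ) where
  toFun := padFst
  map_add' X Y := by ext p q; simp only [padFst, Matrix.of_apply, Matrix.add_apply]; split_ifs <;> ring
  map_smul' t X := by
    ext p q; simp only [padFst, Matrix.of_apply, Matrix.smul_apply, smul_eq_mul, RingHom.id_apply]
    split_ifs <;> ring

/-- `padMid` as a linear map. -/
def padMidMap (α β γ : Type*) [Fintype β] [DecidableEq β] :
    Op (α × γ) →ₗ[ℂ] Op (α × β × γ) where
  toFun := padMid
  map_add' X Y := by ext p q; simp only [padMid, Matrix.of_apply, Matrix.add_apply]; split_ifs <;> ring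
  map_smul' t X := by
    ext p q; simp only [padMid, Matrix.of_apply, Matrix.smul_apply, smul_eq_mul, RingHom.id_apply]
    split_ifs <;> ring

/-- `padLast` as a linear map. -/
def padLastMap (α β γ : Type*) [Fintype γ] [DecidableEq γ] :
    Op (α × β) →ₗ[ℂ] Op (α × β × γ) where
  toFun := padLast
  map_add' X Y := by ext p q; simp only [padLast, Matrix.of_apply, Matrix.add_apply]; split_ifs <;> ring
  map_smul' t X := by
    ext p q; simp only [padLast, Matrix.of_apply, Matrix.smul_apply, smul_eq_mul, RingHom.id_apply]
    split_ifs <;> ring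

theorem posSemidef_maximallyMixed (n : Type*) [Fintype n] [DecidableEq n] :
    ((Fintype.card n : ℂ)⁻¹ • (1 : Op n)).PosSemidef :=
  Matrix.PosSemidef.one.smul (by positivity)

theorem isChannel_padFstMap [Nonempty α] : IsChannel (padFstMap α γ) := by
  refine ⟨fun k X hX => ?_, fun X => ?_⟩
  · convert (posSemidef_kronecker (posSemidef_maximallyMixed α) hX).submatrix
      (fun x : Fin k × α × γ => (x.2.1, x.1, x.2.2)) using 1
    ext p q
    simp [amplify_apply, padFstMap, padFst, Matrix.one_apply, div_eq_inv_mul]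
  · simp [padFstMap, padFst, Matrix.trace, Fintype.sum_prod_type, ← Finset.sum_div]

theorem isChannel_padMidMap [Nonempty β] : IsChannel (padMidMap α β γ) := by
  refine ⟨fun k X hX => ?_, fun X => ?_⟩
  · convert (posSemidef_kronecker (posSemidef_maximallyMixed β) hX).submatrix
      (fun x : Fin k × α × β × γ => (x.2.2.1, x.1, x.2.1, x.2.2.2)) using 1
    ext p q
    simp [amplify_apply, padMidMap, padMid, Matrix.one_apply, div_eq_inv_mul]
  · simp [padMidMap, padMid, Matrix.trace, Fintype.sum_prod_type, ← Finset.sum_div,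
      ← Finset.mul_sum]

theorem isChannel_padLastMap [Nonempty γ] : IsChannel (padLastMap α β γ) := by
  refine ⟨fun k X hX => ?_, fun X => ?_⟩
  · convert (posSemidef_kronecker (posSemidef_maximallyMixed γ) hX).submatrix
      (fun x : Fin k × α × β × γ => (x.2.2.2, x.1, x.2.1, x.2.2.1)) using 1
    ext p q
    simp [amplify_apply, padLastMap, padLast, Matrix.one_apply, div_eq_inv_mul]
  · simp [padLastMap, padLast, Matrix.trace, Fintype.sum_prod_type, ← Finset.sum_div,
      ← Finset.mul_sum]

end Marginals

theorem conjMap_single {m n : Type*} [Fintype m] [DecidableEq m] (V : Matrix n m ℂ) (i j : m)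
    (p q : n) : conjMap V (Matrix.single i j 1) p q = V p i * star (V q j) := by
  simp only [conjMap, LinearMap.coe_mk, AddHom.coe_mk, Matrix.mul_apply, Matrix.single_apply,
    Matrix.conjTranspose_apply, ite_and, mul_ite, mul_one, mul_zero]
  rw [Finset.sum_eq_single j]
  · simp
  · intro k _ hk
    simp [hk.symm]
  · simp

theorem sum_reorder {R X U : Type*} [Fintype R] [Fintype X] [Fintype U]
    (F : R → X → R → X → U → U → ℂ) :
    ∑ r, ∑ x, ∑ r', ∑ y, ∑ u, ∑ v, F r x r' y u v =
      ∑ u, ∑ v, ∑ x, ∑ y, ∑ r, ∑ r', F r x r' y u v := by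
  let e : R × X × R × X × U × U ≃ U × U × X × X × R × R :=
    { toFun := fun k => (k.2.2.2.2.1, k.2.2.2.2.2, k.2.1, k.2.2.2.1, k.1, k.2.2.1)
      invFun := fun k => (k.2.2.2.2.1, k.2.2.1, k.2.2.2.2.2, k.2.2.2.1, k.1, k.2.1)
      left_inv := fun _ => rfl
      right_inv := fun _ => rfl }
  have h := Fintype.sum_equiv e
    (fun k => F k.1 k.2.1 k.2.2.1 k.2.2.2.1 k.2.2.2.2.1 k.2.2.2.2.2)
    (fun k => F k.2.2.2.2.1 k.2.2.1 k.2.2.2.2.2 k.2.2.2.1 k.1 k.2.1) fun _ => rfl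
  simpa only [Fintype.sum_prod_type] using h

namespace ForwardCode

variable {a b c : Type*} [Fintype a] [Fintype b] [Fintype c] [DecidableEq b] [DecidableEq c]
  {r₁ r₂ : ℕ}

theorem operation_apply (K : ForwardCode a b c r₁ r₂) (X : Op ((Fin r₁ × Fin r₂) × b × c))
    (p q : Fin r₁ × Fin r₂) (u v : a) :
    K.operation X (u, p) (v, q) =
      K.dec (Matrix.of fun z w => conjMap (K.enc ⊗ₖ (1 : Op (b × c))) X
        ((u, z.1), z.2) ((v, w.1), w.2)) p q := rfl

theorem induced_apply (K : ForwardCode a b c r₁ r₂) (N : Op a →ₗ[ℂ] Op (b × c))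
    (X : Op (Fin r₁ × Fin r₂)) :
    K.induced N X = K.dec (Matrix.of fun z w =>
      N (Matrix.of fun u v => conjMap K.enc X (u, z.1) (v, w.1)) z.2 w.2) := rfl

theorem choi_operation_apply (K : ForwardCode a b c r₁ r₂) (i j p q : Fin r₁ × Fin r₂)
    (x y : b × c) (u v : a) :
    choi K.operation ((i, x), (u, p)) ((j, y), (v, q)) =
      ∑ r, ∑ r', K.enc (u, r) i * star (K.enc (v, r') j) *
        choi K.dec ((r, x), p) ((r', y), q) := by
  rw [choi_apply, operation_apply, apply_eq_sum_choi]
  simp only [conjMap_single, Matrix.of_apply, Matrix.kroneckerMap_apply, Matrix.one_apply,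
    Fintype.sum_prod_type (α₁ := Fin K.dimR), mul_ite, mul_one, mul_zero, ite_mul, zero_mul,
    apply_ite star, star_zero, Finset.sum_ite_eq', Finset.mem_univ, if_true,
    Finset.sum_ite_irrel, Finset.sum_const_zero]

theorem choi_induced_apply [DecidableEq a] (K : ForwardCode a b c r₁ r₂)
    (N : Op a →ₗ[ℂ] Op (b × c)) (i j p q : Fin r₁ × Fin r₂) :
    choi (K.induced N) (i, p) (j, q) =
      ∑ u, ∑ v, ∑ x, ∑ y, choi N (u, x) (v, y) *
        choi K.operation ((i, x), (u, p)) ((j, y), (v, q)) := by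
  rw [choi_apply, induced_apply, apply_eq_sum_choi]
  simp only [choi_operation_apply, apply_eq_sum_choi N, conjMap_single, Matrix.of_apply,
    Finset.mul_sum, Finset.sum_mul, Fintype.sum_prod_type (α₁ := Fin K.dimR)]
  rw [sum_reorder]
  refine Finset.sum_congr rfl fun u _ => Finset.sum_congr rfl fun v _ =>
    Finset.sum_congr rfl fun x _ => Finset.sum_congr rfl fun y _ =>
    Finset.sum_congr rfl fun r _ => Finset.sum_congr rfl fun r' _ => ?_
  ring

theorem avgInput_apply (K : ForwardCode a b c r₁ r₂) (u v : a) :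
    K.avgInput u v = ((r₁ : ℂ) * r₂)⁻¹ * ∑ r, ∑ i, K.enc (u, r) i * star (K.enc (v, r) i) := by
  have h : ∀ k : Fin r₁ × Fin r₂, (epr (Fin r₁ × Fin r₂)).submatrix (Prod.mk k) (Prod.mk k) =
      ((r₁ : ℂ) * r₂)⁻¹ • Matrix.single k k 1 := by
    intro k
    ext i j
    simp [epr, maxEnt, Matrix.single_apply]
  simp only [avgInput, trSnd, trFst, Matrix.of_apply, amplify_apply, h, map_smul,
    Matrix.smul_apply, conjMap_single, smul_eq_mul, Finset.mul_sum]

theorem choi_operation_posSemidef (K : ForwardCode a b c r₁ r₂) :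
    (choi K.operation).PosSemidef := by
  let w : (a × Fin K.dimR) × (Fin r₁ × Fin r₂) → ℂ := fun k => K.enc k.1 k.2
  have h := posSemidef_sum_blocks
    (posSemidef_kronecker (Matrix.posSemidef_vecMulVec_self_star w)
      K.dec_channel.choi_posSemidef)
    (fun (r : Fin K.dimR) (k : ((Fin r₁ × Fin r₂) × b × c) × (a × Fin r₁ × Fin r₂)) =>
      (((k.2.1, r), k.1.1), ((r, k.1.2), k.2.2)))
  convert h using 1
  ext ⟨⟨i, x⟩, u, p⟩ ⟨⟨j, y⟩, v, q⟩
  rw [choi_operation_apply]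
  simp [w, Matrix.vecMulVec_apply]

theorem sum_choi_operation (K : ForwardCode a b c r₁ r₂) (i j : Fin r₁ × Fin r₂) (x y : b × c)
    (u v : a) :
    ∑ p, choi K.operation ((i, x), (u, p)) ((j, y), (v, p)) =
      if x = y then ∑ r, K.enc (u, r) i * star (K.enc (v, r) j) else 0 := by
  simp only [choi_operation_apply]
  rw [Finset.sum_comm]
  have h : ∀ r : Fin K.dimR, ∑ p, ∑ r', K.enc (u, r) i * star (K.enc (v, r') j) *
      choi K.dec ((r, x), p) ((r', y), p) =
        if x = y then K.enc (u, r) i * star (K.enc (v, r) j) else 0 := by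
    intro r
    rw [Finset.sum_comm]
    simp only [← Finset.mul_sum, K.dec_channel.sum_choi]
    by_cases h : x = y <;> simp [h]
  simp only [h]
  split_ifs <;> simp

theorem sum_sum_choi_operation (K : ForwardCode a b c r₁ r₂) (hr : r₁ * r₂ ≠ 0) (x y : b × c)
    (u v : a) :
    ∑ i, ∑ p, choi K.operation ((i, x), (u, p)) ((i, y), (v, p)) =
      (r₁ * r₂ : ℂ) * (K.avgInput ⊗ₖ (1 : Op (b × c))) (u, x) (v, y) := by
  have : (r₁ * r₂ : ℂ) ≠ 0 := by exact_mod_cast hr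
  simp only [sum_choi_operation, Matrix.kroneckerMap_apply, avgInput_apply, Matrix.one_apply]
  split_ifs
  · rw [Finset.sum_comm, mul_one, mul_inv_cancel_left₀ this]
  · simp

theorem isChannel_operation [DecidableEq a] (K : ForwardCode a b c r₁ r₂) :
    IsChannel K.operation := by
  refine isChannel_of_choi K.choi_operation_posSemidef ?_
  rintro ⟨i, x⟩ ⟨j, y⟩
  have h := congrFun₂ K.enc_isometry j i
  simp only [Matrix.mul_apply, Matrix.conjTranspose_apply, Matrix.one_apply] at h
  rw [Fintype.sum_prod_type]
  simp only [sum_choi_operation, Prod.mk.injEq]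
  by_cases hxy : x = y
  · simp only [hxy, if_true, and_true, eq_comm (a := i), ← h, Fintype.sum_prod_type, mul_comm]
  · simp [hxy]

theorem isDensity_avgInput (K : ForwardCode a b c r₁ r₂) (hr : r₁ * r₂ ≠ 0) :
    IsDensity K.avgInput := by
  have hr' : (r₁ * r₂ : ℂ) ≠ 0 := by exact_mod_cast hr
  constructor
  · have h := (posSemidef_sum_diag_blocks (Matrix.posSemidef_vecMulVec_self_star
      (fun k : (a × Fin K.dimR) × (Fin r₁ × Fin r₂) => K.enc k.1 k.2))
      (fun (k : Fin K.dimR × (Fin r₁ × Fin r₂)) (u : a) => ((u, k.1), k.2))).smul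
      (show (0 : ℂ) ≤ ((r₁ : ℂ) * r₂)⁻¹ by positivity)
    convert h using 1
    ext u v
    simp [avgInput_apply, Matrix.vecMulVec_apply, Fintype.sum_prod_type (α₁ := Fin K.dimR)]
  · have h := congrArg Matrix.trace K.enc_isometry
    simp only [Matrix.trace, Matrix.diag_apply, Matrix.mul_apply, Matrix.conjTranspose_apply,
      Matrix.one_apply_eq, Finset.sum_const, Finset.card_univ, Fintype.card_prod, Fintype.card_fin,
      nsmul_eq_mul, mul_one] at h
    simp only [Matrix.trace, Matrix.diag_apply, avgInput_apply, ← Finset.mul_sum]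
    rw [Finset.sum_comm, Fintype.sum_prod_type] at h
    rw [inv_mul_eq_one₀ hr']
    push_cast at h
    simp only [← h, Fintype.sum_prod_type, mul_comm]

end ForwardCode

section WeightedTrace

variable {m n : Type*}

/-- The partial trace of `(P ⊗ 1) K` over the first factor. -/
def wtr [Fintype m] (P : Op m) (K : Op (m × n)) : Op n :=
  Matrix.of fun x y => ∑ p : m × m, P p.2 p.1 * K (p.1, x) (p.2, y)

theorem wtr_add_left [Fintype m] (P Q : Op m) (K : Op (m × n)) :
    wtr (P + Q) K = wtr P K + wtr Q K := by
  ext; simp [wtr, add_mul, Finset.sum_add_distrib]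

theorem wtr_sub_left [Fintype m] (P Q : Op m) (K : Op (m × n)) :
    wtr (P - Q) K = wtr P K - wtr Q K := by
  ext; simp [wtr, sub_mul, Finset.sum_sub_distrib]

theorem wtr_smul_left [Fintype m] (t : ℂ) (P : Op m) (K : Op (m × n)) :
    wtr (t • P) K = t • wtr P K := by
  ext; simp [wtr, Finset.mul_sum, mul_assoc]

theorem wtr_add [Fintype m] (P : Op m) (K L : Op (m × n)) :
    wtr P (K + L) = wtr P K + wtr P L := by
  ext; simp [wtr, mul_add, Finset.sum_add_distrib]

theorem wtr_sub [Fintype m] (P : Op m) (K L : Op (m × n)) :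
    wtr P (K - L) = wtr P K - wtr P L := by
  ext; simp [wtr, mul_sub, Finset.sum_sub_distrib]

theorem wtr_smul [Fintype m] (t : ℂ) (P : Op m) (K : Op (m × n)) :
    wtr P (t • K) = t • wtr P K := by
  ext; simp [wtr, Finset.mul_sum, mul_left_comm]

theorem wtr_kronecker [Fintype m] (P A : Op m) (M : Op n) :
    wtr P (A ⊗ₖ M) = (P * A).trace • M := by
  ext x y
  simp only [wtr, Matrix.of_apply, Matrix.kroneckerMap_apply, Matrix.smul_apply, Matrix.trace,
    Matrix.diag_apply, Matrix.mul_apply, smul_eq_mul, Finset.sum_mul, Fintype.sum_prod_type]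
  rw [Finset.sum_comm]
  simp only [mul_assoc]

theorem wtr_posSemidef [Fintype m] [Fintype n] {P : Op m} {K : Op (m × n)} (hP : P.PosSemidef)
    (hK : K.PosSemidef) : (wtr P K).PosSemidef := by
  have h := posSemidef_sum_blocks (posSemidef_kronecker hP.transpose hK)
    (fun (u : m) (x : n) => (u, (u, x)))
  convert h using 1
  ext x y
  simp [wtr, Fintype.sum_prod_type]

end WeightedTrace

section LocalOperators

variable {n : Type*} [Fintype n] [DecidableEq n]

/-- The swap operator. -/
def flip (n : Type*) [DecidableEq n] : Op (n × n) :=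
  Matrix.of fun p q => if p.1 = q.2 ∧ p.2 = q.1 then 1 else 0

theorem ptSnd_maxEnt : ptSnd (maxEnt n) = flip n := by
  ext p q
  simp [ptSnd, maxEnt, flip, eq_comm]

theorem ptSnd_flip : ptSnd (flip n) = maxEnt n := by
  ext p q
  simp [ptSnd, maxEnt, flip, eq_comm]

theorem ptSnd_one : ptSnd (1 : Op (n × n)) = 1 := by
  ext p q
  simp [ptSnd, Matrix.one_apply, Prod.ext_iff, eq_comm]

theorem ptSnd_add {m n : Type*} (X Y : Op (m × n)) : ptSnd (X + Y) = ptSnd X + ptSnd Y := rfl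

theorem ptSnd_sub {m n : Type*} (X Y : Op (m × n)) : ptSnd (X - Y) = ptSnd X - ptSnd Y := rfl

theorem ptSnd_smul {m n : Type*} (t : ℂ) (X : Op (m × n)) : ptSnd (t • X) = t • ptSnd X := rfl

theorem transpose_maxEnt : (maxEnt n)ᵀ = maxEnt n := by
  ext p q
  simp [maxEnt, and_comm]

theorem flip_mul_flip : flip n * flip n = 1 := by
  ext p q
  simp only [Matrix.mul_apply, flip, Matrix.of_apply, Matrix.one_apply, Fintype.sum_prod_type,
    ite_and, mul_ite, mul_one, mul_zero, Prod.ext_iff]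
  rw [Finset.sum_eq_single p.2, Finset.sum_eq_single p.1]
  · simp [← ite_and, and_comm]
  · intro k _ hk
    simp [hk.symm]
  · simp
  · intro k _ hk
    simp [hk.symm]
  · simp

theorem conjTranspose_flip : (flip n)ᴴ = flip n := by
  ext p q
  simp only [flip, Matrix.conjTranspose_apply, Matrix.of_apply, apply_ite star, star_one, star_zero]
  congr 1
  simp [eq_comm, and_comm]

theorem maxEnt_mul_maxEnt : maxEnt n * maxEnt n = (Fintype.card n : ℂ) • maxEnt n := by
  ext p q
  simp only [Matrix.mul_apply, maxEnt, Matrix.of_apply, Fintype.sum_prod_type, ite_and, mul_ite,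
    mul_one, mul_zero, Matrix.smul_apply, smul_eq_mul]
  by_cases h : p.1 = p.2 <;> by_cases h' : q.1 = q.2 <;> simp [h, h']

theorem trace_maxEnt : (maxEnt n).trace = Fintype.card n := by
  simp only [maxEnt, Matrix.trace, Matrix.diag_apply, Matrix.of_apply, and_self,
    Fintype.sum_prod_type, Finset.sum_ite_eq, Finset.mem_univ, if_true]
  simp

theorem epr_mul_epr [Nonempty n] : epr n * epr n = epr n := by
  have : (Fintype.card n : ℂ) ≠ 0 := by simp
  simp only [epr, smul_mul_assoc, mul_smul_comm, maxEnt_mul_maxEnt, smul_smul]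
  congr 1
  field_simp

theorem trace_epr [Nonempty n] : (epr n).trace = 1 := by
  simp [epr, trace_maxEnt]

theorem card_smul_epr [Nonempty n] : (Fintype.card n : ℂ) • epr n = maxEnt n := by
  simp [epr, smul_smul]

theorem epr_posSemidef : (epr n).PosSemidef :=
  posSemidef_maxEnt.smul (by positivity)

theorem one_sub_epr_posSemidef [Nonempty n] : (1 - epr n).PosSemidef := by
  have h := Matrix.posSemidef_conjTranspose_mul_self (1 - epr n)
  rwa [Matrix.conjTranspose_sub, Matrix.conjTranspose_one, epr_posSemidef.isHermitian.eq,
    mul_sub, sub_mul, mul_one, mul_one, sub_mul, one_mul, epr_mul_epr, sub_self, sub_zero] at h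

theorem one_add_flip_posSemidef : (1 + flip n).PosSemidef := by
  have h := (Matrix.posSemidef_conjTranspose_mul_self (1 + flip n)).smul
    (show (0 : ℂ) ≤ 1 / 2 by positivity)
  rw [Matrix.conjTranspose_add, Matrix.conjTranspose_one, conjTranspose_flip, mul_add, add_mul,
    mul_one, mul_one, add_mul, one_mul, flip_mul_flip] at h
  convert h using 1
  module

theorem one_sub_flip_posSemidef : (1 - flip n).PosSemidef := by
  have h := (Matrix.posSemidef_conjTranspose_mul_self (1 - flip n)).smul
    (show (0 : ℂ) ≤ 1 / 2 by positivity)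
  rw [Matrix.conjTranspose_sub, Matrix.conjTranspose_one, conjTranspose_flip, mul_sub, sub_mul,
    mul_one, mul_one, sub_mul, one_mul, flip_mul_flip] at h
  convert h using 1
  module

theorem epr_eq_one [Subsingleton n] [Nonempty n] : epr n = 1 := by
  have h : Fintype.card n = 1 := le_antisymm (Fintype.card_le_one_iff_subsingleton.2 ‹_›)
    Fintype.card_pos
  ext p q
  simp [epr, maxEnt, h, Matrix.one_apply, Subsingleton.elim p q, eq_iff_true_of_subsingleton]

end LocalOperators

section Compression

variable {a b c : Type*} {r₁ r₂ : ℕ}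

/-- The Choi space of a tripartite operation, ordered as `(A₁ B') (A₂ C') (A' B C)`. -/
def regroup (a b c : Type*) (r₁ r₂ : ℕ) :
    (Fin r₁ × Fin r₁) × (Fin r₂ × Fin r₂) × (a × b × c) ≃
      ((Fin r₁ × Fin r₂) × b × c) × (a × Fin r₁ × Fin r₂) where
  toFun k := (((k.1.1, k.2.1.1), k.2.2.2), (k.2.2.1, (k.1.2, k.2.1.2)))
  invFun k := ((k.1.1.1, k.2.2.1), (k.1.1.2, k.2.2.2), (k.2.1, k.1.2))
  left_inv _ := rfl
  right_inv _ := rfl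

/-- The compression `Tr_{A B' C'} (P ⊗ Q ⊗ 1) J` of a tripartite Choi matrix. -/
def compress (P : Op (Fin r₁ × Fin r₁)) (Q : Op (Fin r₂ × Fin r₂))
    (J : Op (((Fin r₁ × Fin r₂) × b × c) × (a × Fin r₁ × Fin r₂))) : Op (a × b × c) :=
  wtr Q (wtr P (J.submatrix (regroup a b c r₁ r₂) (regroup a b c r₁ r₂)))

theorem compress_posSemidef [Fintype a] [Fintype b] [Fintype c]
    {P : Op (Fin r₁ × Fin r₁)} {Q : Op (Fin r₂ × Fin r₂)}
    {J : Op (((Fin r₁ × Fin r₂) × b × c) × (a × Fin r₁ × Fin r₂))} (hP : P.PosSemidef)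
    (hQ : Q.PosSemidef) (hJ : J.PosSemidef) : (compress P Q J).PosSemidef :=
  wtr_posSemidef hQ (wtr_posSemidef hP (hJ.submatrix _))

/-- Exchange the second components of a pair of pairs. -/
def swapSnd (m n : Type*) : (m × n) × (m × n) ≃ (m × n) × (m × n) where
  toFun p := ((p.1.1, p.2.2), (p.2.1, p.1.2))
  invFun p := ((p.1.1, p.2.2), (p.2.1, p.1.2))
  left_inv _ := rfl
  right_inv _ := rfl

/-- Exchange the first components of a pair of pairs. -/
def swapFst (m n : Type*) : (m × n) × (m × n) ≃ (m × n) × (m × n) where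
  toFun p := ((p.2.1, p.1.2), (p.1.1, p.2.2))
  invFun p := ((p.2.1, p.1.2), (p.1.1, p.2.2))
  left_inv _ := rfl
  right_inv _ := rfl

theorem compress_ptB (P : Op (Fin r₁ × Fin r₁)) (Q : Op (Fin r₂ × Fin r₂))
    (J : Op (((Fin r₁ × Fin r₂) × b × c) × (a × Fin r₁ × Fin r₂))) :
    compress P Q (ptB J) = ptMid (compress (ptSnd P) Q J) := by
  ext x y
  refine Finset.sum_congr rfl fun q _ => ?_
  congr 1
  exact Fintype.sum_equiv (swapSnd _ _) _ _ fun p => rfl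

theorem compress_ptC (P : Op (Fin r₁ × Fin r₁)) (Q : Op (Fin r₂ × Fin r₂))
    (J : Op (((Fin r₁ × Fin r₂) × b × c) × (a × Fin r₁ × Fin r₂))) :
    compress P Q (ptC J) = ptLast (compress P (ptSnd Q) J) := by
  ext x y
  refine Fintype.sum_equiv (swapSnd _ _) _ _ fun q => ?_
  congr 1

theorem compress_ptA (P : Op (Fin r₁ × Fin r₁)) (Q : Op (Fin r₂ × Fin r₂))
    (J : Op (((Fin r₁ × Fin r₂) × b × c) × (a × Fin r₁ × Fin r₂))) :
    compress P Q (ptA J) = (ptSnd (compress (ptSnd P)ᵀ (ptSnd Q)ᵀ J))ᵀ := by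
  ext x y
  refine Fintype.sum_equiv (swapFst _ _) _ _ fun q => ?_
  congr 1
  exact Fintype.sum_equiv (swapFst _ _) _ _ fun p => rfl

end Compression

theorem channelFidelity_eq {n : Type*} [Fintype n] [DecidableEq n] (Φ : Op n →ₗ[ℂ] Op n) :
    channelFidelity Φ = ((Fintype.card n : ℂ) ^ 2)⁻¹ * ∑ i, ∑ j, choi Φ (i, i) (j, j) := by
  have h : ∀ k l : n, (epr n).submatrix (Prod.mk k) (Prod.mk l) =
      (Fintype.card n : ℂ)⁻¹ • Matrix.single k l 1 := by
    intro k l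
    ext i j
    simp [epr, maxEnt, Matrix.single_apply]
  simp only [channelFidelity, Matrix.trace, Matrix.diag_apply, Matrix.mul_apply, amplify_apply, h,
    map_smul, Matrix.smul_apply, choi_apply]
  simp only [epr, maxEnt, Matrix.of_apply, Matrix.smul_apply, smul_eq_mul,
    Fintype.sum_prod_type, ite_and, mul_ite, mul_one, mul_zero, ite_mul, zero_mul,
    Finset.sum_ite_irrel, Finset.sum_const_zero, Finset.sum_ite_eq, Finset.mem_univ, if_true]
  rw [Finset.sum_comm]
  simp only [Finset.mul_sum, sq, mul_inv, mul_assoc]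

section PartialTraces

variable {β β' m m' n n' : Type*} [Fintype β] [Fintype β'] [Fintype m] [Fintype m']
  [DecidableEq β] [DecidableEq m] [DecidableEq m']

theorem sum_choi_of_factor {Z : Op m →ₗ[ℂ] Op n} {Ψ : Op m' →ₗ[ℂ] Op n'} (e : β × m' ≃ m)
    (o : β' → n' → n)
    (h : ∀ X p' q', ∑ i, Z X (o i p') (o i q') =
      Ψ (Matrix.of fun p q => ∑ k, X (e (k, p)) (e (k, q))) p' q')
    (k l : β) (p q : m') (p' q' : n') :
    ∑ i, choi Z (e (k, p), o i p') (e (l, q), o i q') =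
      if k = l then choi Ψ (p, p') (q, q') else 0 := by
  simp only [choi_apply, h]
  split_ifs with hkl
  · subst hkl
    have : (Matrix.of fun i j => ∑ x, Matrix.single (e (k, p)) (e (k, q)) (1 : ℂ)
        (e (x, i)) (e (x, j)) : Op m') = Matrix.single p q 1 := by
      ext i j
      simp only [Matrix.of_apply, Matrix.single_apply, EmbeddingLike.apply_eq_iff_eq,
        Prod.mk.injEq]
      by_cases h1 : p = i <;> by_cases h2 : q = j <;> simp [h1, h2]
    rw [this]
  · have : (Matrix.of fun i j => ∑ x, Matrix.single (e (k, p)) (e (l, q)) (1 : ℂ)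
        (e (x, i)) (e (x, j)) : Op m') = 0 := by
      ext i j
      simp only [Matrix.of_apply, Matrix.single_apply, EmbeddingLike.apply_eq_iff_eq,
        Prod.mk.injEq, Matrix.zero_apply]
      refine Finset.sum_eq_zero fun x _ => if_neg ?_
      rintro ⟨⟨rfl, -⟩, rfl, -⟩
      exact hkl rfl
    rw [this]
    simp

theorem marginal_eq_of_sum_choi {Z : Op m →ₗ[ℂ] Op n} (e : β × m' ≃ m) (o : β' → n' → n)
    {L : Op (m' × n')}
    (h : ∀ k l p q p' q', ∑ i, choi Z (e (k, p), o i p') (e (l, q), o i q') =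
      if k = l then L (p, p') (q, q') else 0) (X : Op m) (p' q' : n') :
    ∑ i, Z X (o i p') (o i q') =
      ∑ p, ∑ q, (∑ k, X (e (k, p)) (e (k, q))) * L (p, p') (q, q') := by
  have hs : ∀ F : m → ℂ, ∑ x, F x = ∑ p, ∑ k, F (e (k, p)) := fun F => by
    rw [← e.sum_comp, Fintype.sum_prod_type, Finset.sum_comm]
  simp only [apply_eq_sum_choi Z, hs]
  rw [Finset.sum_comm]
  refine Finset.sum_congr rfl fun p _ => ?_
  rw [Finset.sum_comm]
  have h1 : ∀ k, ∑ i, ∑ q, ∑ l, X (e (k, p)) (e (l, q)) *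
      choi Z (e (k, p), o i p') (e (l, q), o i q') =
        ∑ q, X (e (k, p)) (e (k, q)) * L (p, p') (q, q') := by
    intro k
    rw [Finset.sum_comm]
    refine Finset.sum_congr rfl fun q _ => ?_
    rw [Finset.sum_comm]
    simp [← Finset.mul_sum, h]
  simp only [h1]
  rw [Finset.sum_comm]
  simp only [Finset.sum_mul]

end PartialTraces

section NoSignalling

variable {α β γ α' β' γ' : Type*} [Fintype α] [Fintype β] [Fintype γ] [Fintype α'] [Fintype β']
  [Fintype γ'] [DecidableEq α] [DecidableEq β] [DecidableEq γ]
  {Z : Op (α × β × γ) →ₗ[ℂ] Op (α' × β' × γ')}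

/-- Move the middle factor to the front. -/
def midFirst (α β γ : Type*) : β × (α × γ) ≃ α × β × γ where
  toFun k := (k.2.1, k.1, k.2.2)
  invFun k := (k.2.1, k.1, k.2.2)
  left_inv _ := rfl
  right_inv _ := rfl

/-- Move the last factor to the front. -/
def lastFirst (α β γ : Type*) : γ × (α × β) ≃ α × β × γ where
  toFun k := (k.2.1, k.2.2, k.1)
  invFun k := (k.2.2, k.1, k.2.1)
  left_inv _ := rfl
  right_inv _ := rfl

theorem NoSignalA.sum_choi (h : NoSignalA Z) : ∃ L : Op ((β × γ) × (β' × γ')),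
    (∀ y z, ∑ p, L (y, p) (z, p) = if y = z then 1 else 0) ∧
    ∀ k l p q p' q', ∑ i, choi Z ((k, p), (i, p')) ((l, q), (i, q')) =
      if k = l then L (p, p') (q, q') else 0 := by
  obtain ⟨Ψ, hΨ, h⟩ := h
  exact ⟨choi Ψ, hΨ.sum_choi, sum_choi_of_factor (Equiv.refl _) Prod.mk
    fun X p' q' => congrFun₂ (h X) p' q'⟩

theorem NoSignalB.sum_choi (h : NoSignalB Z) : ∃ L : Op ((α × γ) × (α' × γ')),
    ∀ k l p q p' q', ∑ i, choi Z (midFirst α β γ (k, p), midFirst α' β' γ' (i, p'))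
      (midFirst α β γ (l, q), midFirst α' β' γ' (i, q')) =
        if k = l then L (p, p') (q, q') else 0 := by
  obtain ⟨Ψ, hΨ, h⟩ := h
  exact ⟨choi Ψ, sum_choi_of_factor (midFirst α β γ) (fun i p => midFirst α' β' γ' (i, p))
    fun X p' q' => congrFun₂ (h X) p' q'⟩

theorem NoSignalC.sum_choi (h : NoSignalC Z) : ∃ L : Op ((α × β) × (α' × β')),
    ∀ k l p q p' q', ∑ i, choi Z (lastFirst α β γ (k, p), lastFirst α' β' γ' (i, p'))
      (lastFirst α β γ (l, q), lastFirst α' β' γ' (i, q')) =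
        if k = l then L (p, p') (q, q') else 0 := by
  obtain ⟨Ψ, hΨ, h⟩ := h
  exact ⟨choi Ψ, sum_choi_of_factor (lastFirst α β γ) (fun i p => lastFirst α' β' γ' (i, p))
    fun X p' q' => congrFun₂ (h X) p' q'⟩

theorem trFst_padFst [Nonempty α] (S : Op γ) : trFst (padFst S : Op (α × γ)) = S := by
  ext; simp [trFst, padFst, mul_div_cancel₀]

theorem trMid_padMid [Nonempty β] (S : Op (α × γ)) : trMid (padMid S : Op (α × β × γ)) = S := by
  ext; simp [trMid, padMid, mul_div_cancel₀]

theorem trLast_padLast [Nonempty γ] (S : Op (α × β)) :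
    trLast (padLast S : Op (α × β × γ)) = S := by
  ext; simp [trLast, padLast, mul_div_cancel₀]

theorem noSignalA_of_sum_choi [Nonempty α] (hZ : IsChannel Z) {L : Op ((β × γ) × (β' × γ'))}
    (h : ∀ k l p q p' q', ∑ i, choi Z ((k, p), (i, p')) ((l, q), (i, q')) =
      if k = l then L (p, p') (q, q') else 0) : NoSignalA Z := by
  have key := marginal_eq_of_sum_choi (Equiv.refl (α × β × γ)) (Prod.mk (α := α')) h
  have key' : ∀ X Y, trFst X = trFst Y → trFst (Z X) = trFst (Z Y) := by
    intro X Y hXY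
    ext p q
    refine (key X p q).trans (Eq.trans ?_ (key Y p q).symm)
    exact Finset.sum_congr rfl fun u _ => Finset.sum_congr rfl fun v _ =>
      congrArg (· * _) (congrFun₂ hXY u v)
  exact hZ.exists_factor (isChannel_padFstMap (α := α)) isChannel_trFstMap trFst
    fun X => key' _ _ (trFst_padFst _).symm

theorem noSignalB_of_sum_choi [Nonempty β] (hZ : IsChannel Z) {L : Op ((α × γ) × (α' × γ'))}
    (h : ∀ k l p q p' q', ∑ i, choi Z (midFirst α β γ (k, p), midFirst α' β' γ' (i, p'))
      (midFirst α β γ (l, q), midFirst α' β' γ' (i, q')) =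
        if k = l then L (p, p') (q, q') else 0) : NoSignalB Z := by
  have key := marginal_eq_of_sum_choi (midFirst α β γ) (fun i p => midFirst α' β' γ' (i, p)) h
  have key' : ∀ X Y, trMid X = trMid Y → trMid (Z X) = trMid (Z Y) := by
    intro X Y hXY
    ext p q
    refine (key X p q).trans (Eq.trans ?_ (key Y p q).symm)
    exact Finset.sum_congr rfl fun u _ => Finset.sum_congr rfl fun v _ =>
      congrArg (· * _) (congrFun₂ hXY u v)
  exact hZ.exists_factor (isChannel_padMidMap (β := β)) isChannel_trMidMap trMid
    fun X => key' _ _ (trMid_padMid _).symm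

theorem noSignalC_of_sum_choi [Nonempty γ] (hZ : IsChannel Z) {L : Op ((α × β) × (α' × β'))}
    (h : ∀ k l p q p' q', ∑ i, choi Z (lastFirst α β γ (k, p), lastFirst α' β' γ' (i, p'))
      (lastFirst α β γ (l, q), lastFirst α' β' γ' (i, q')) =
        if k = l then L (p, p') (q, q') else 0) : NoSignalC Z := by
  have key := marginal_eq_of_sum_choi (lastFirst α β γ) (fun i p => lastFirst α' β' γ' (i, p)) h
  have key' : ∀ X Y, trLast X = trLast Y → trLast (Z X) = trLast (Z Y) := by
    intro X Y hXY
    ext p q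
    refine (key X p q).trans (Eq.trans ?_ (key Y p q).symm)
    exact Finset.sum_congr rfl fun u _ => Finset.sum_congr rfl fun v _ =>
      congrArg (· * _) (congrFun₂ hXY u v)
  exact hZ.exists_factor (isChannel_padLastMap (γ := γ)) isChannel_trLastMap trLast
    fun X => key' _ _ (trLast_padLast _).symm

end NoSignalling

section CompressApply

variable {a b c : Type*} {r₁ r₂ : ℕ}

theorem sum_reorder_four {s t : Type*} [Fintype s] [Fintype t] (F : t → t → s → s → ℂ) :
    ∑ i, ∑ j, ∑ k, ∑ l, F i j k l = ∑ k, ∑ i, ∑ l, ∑ j, F i j k l := by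
  let e : t × t × s × s ≃ s × t × s × t :=
    { toFun := fun k => (k.2.2.1, k.1, k.2.2.2, k.2.1)
      invFun := fun k => (k.2.1, k.2.2.2, k.1, k.2.2.1)
      left_inv := fun _ => rfl
      right_inv := fun _ => rfl }
  have h := Fintype.sum_equiv e (fun k => F k.1 k.2.1 k.2.2.1 k.2.2.2)
    (fun k => F k.2.1 k.2.2.2 k.1 k.2.2.1) fun _ => rfl
  simpa only [Fintype.sum_prod_type] using h

theorem compress_epr_epr_apply
    (J : Op (((Fin r₁ × Fin r₂) × b × c) × (a × Fin r₁ × Fin r₂))) (x y : a × b × c) :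
    compress (epr (Fin r₁)) (epr (Fin r₂)) J x y =
      ((r₁ : ℂ) * r₂)⁻¹ * ∑ i, ∑ j, J ((i, x.2), (x.1, i)) ((j, y.2), (y.1, j)) := by
  simp only [compress, wtr, epr, maxEnt, Matrix.of_apply, Matrix.smul_apply, smul_eq_mul,
    Fintype.sum_prod_type, ite_and, mul_ite, mul_one, mul_zero, ite_mul, zero_mul,
    Matrix.submatrix_apply, regroup, Equiv.coe_fn_mk, Fintype.card_fin,
    Finset.sum_ite_irrel, Finset.sum_const_zero, Finset.sum_ite_eq, Finset.mem_univ, if_true,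
    ← Finset.mul_sum]
  rw [sum_reorder_four, mul_inv]
  ring

theorem wtr_one_apply {m n : Type*} [Fintype m] [DecidableEq m] (K : Op (m × n)) (x y : n) :
    wtr 1 K x y = ∑ u, K (u, x) (u, y) := by
  simp [wtr, Fintype.sum_prod_type, Matrix.one_apply]

theorem compress_one_one_apply
    (J : Op (((Fin r₁ × Fin r₂) × b × c) × (a × Fin r₁ × Fin r₂))) (x y : a × b × c) :
    compress 1 1 J x y = ∑ i, ∑ p, J ((i, x.2), (x.1, p)) ((i, y.2), (y.1, p)) := by
  simp only [compress, wtr_one_apply, Fintype.sum_prod_type, Matrix.submatrix_apply, regroup,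
    Equiv.coe_fn_mk]
  rw [sum_reorder_four]

theorem sum_reorder_six {A U X : Type*} [Fintype A] [Fintype U] [Fintype X]
    (F : A → A → U → U → X → X → ℂ) :
    ∑ i, ∑ j, ∑ u, ∑ v, ∑ x, ∑ y, F i j u v x y =
      ∑ p : U × X, ∑ q : U × X, ∑ i, ∑ j, F i j p.1 q.1 p.2 q.2 := by
  let e : A × A × U × U × X × X ≃ (U × X) × (U × X) × A × A :=
    { toFun := fun k => ((k.2.2.1, k.2.2.2.2.1), (k.2.2.2.1, k.2.2.2.2.2), k.1, k.2.1)
      invFun := fun k => (k.2.2.1, k.2.2.2, k.1.1, k.2.1.1, k.1.2, k.2.1.2)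
      left_inv := fun _ => rfl
      right_inv := fun _ => rfl }
  have h := Fintype.sum_equiv e
    (fun k => F k.1 k.2.1 k.2.2.1 k.2.2.2.1 k.2.2.2.2.1 k.2.2.2.2.2)
    (fun k => F k.2.2.1 k.2.2.2 k.1.1 k.2.1.1 k.1.2 k.2.1.2) fun _ => rfl
  simpa only [Fintype.sum_prod_type] using h

/-- The fidelity of a code is determined by the compression of its Choi matrix to EPR pairs. -/
theorem ForwardCode.channelFidelity_induced [Fintype a] [Fintype b] [Fintype c] [DecidableEq a]
    [DecidableEq b] [DecidableEq c] (K : ForwardCode a b c r₁ r₂) (N : Op a →ₗ[ℂ] Op (b × c)) :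
    channelFidelity (K.induced N) = ((((r₁ : ℂ) * r₂)⁻¹ •
      compress (epr (Fin r₁)) (epr (Fin r₂)) (choi K.operation)) * (choi N)ᵀ).trace := by
  have h' := sum_reorder_six fun i j u v x y => choi N (u, x) (v, y) *
      choi K.operation ((i, x), (u, i)) ((j, y), (v, j))
  simp only [channelFidelity_eq, K.choi_induced_apply, Matrix.trace, Matrix.diag_apply,
    Matrix.mul_apply, Matrix.transpose_apply, Matrix.smul_apply, smul_eq_mul,
    compress_epr_epr_apply, h', ← Finset.mul_sum, Fintype.card_prod, Fintype.card_fin]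
  rw [Finset.mul_sum]
  refine Finset.sum_congr rfl fun X _ => ?_
  rw [Finset.mul_sum]
  refine Finset.sum_congr rfl fun Y _ => ?_
  push_cast
  rw [sq, mul_inv]
  ring

end CompressApply

section PadSelf

variable {α β γ : Type*}

theorem eq_padMid_trMid [Fintype β] [DecidableEq β] [Nonempty β] {Y : Op (α × β × γ)}
    {M : Op (α × γ)}
    (h : ∀ x y, Y x y = if x.2.1 = y.2.1 then M (x.1, x.2.2) (y.1, y.2.2) else 0) :
    Y = padMid (trMid Y) := by
  ext x y
  simp [h, padMid, trMid]

theorem eq_padLast_trLast [Fintype γ] [DecidableEq γ] [Nonempty γ] {X : Op (α × β × γ)}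
    {M : Op (α × β)}
    (h : ∀ x y, X x y = if x.2.2 = y.2.2 then M (x.1, x.2.1) (y.1, y.2.1) else 0) :
    X = padLast (trLast X) := by
  ext x y
  simp [h, padLast, trLast]

end PadSelf

section CompressMarginals

variable {a b c : Type*} {r₁ r₂ : ℕ}

theorem sum_mul_ite_fst {s : Type*} [Fintype s] [DecidableEq s] {P : Op (s × s)} {κ : ℂ}
    (hP : ∀ k l, ∑ i, P (i, k) (i, l) = if k = l then κ else 0) (F : s → s → ℂ) :
    ∑ p : (s × s) × (s × s), P p.2 p.1 * (if p.1.1 = p.2.1 then F p.1.2 p.2.2 else 0) =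
      κ * ∑ k, F k k := by
  simp only [Fintype.sum_prod_type, mul_ite, mul_zero, Finset.sum_ite_irrel,
    Finset.sum_const_zero, Finset.sum_ite_eq, Finset.mem_univ, if_true]
  rw [Finset.sum_comm, Finset.mul_sum]
  refine Finset.sum_congr rfl fun k _ => ?_
  rw [Finset.sum_comm]
  simp [← Finset.sum_mul, hP]

theorem sum_epr_fst {s : Type*} [Fintype s] [DecidableEq s] (k l : s) :
    ∑ i, epr s (i, k) (i, l) = if k = l then (Fintype.card s : ℂ)⁻¹ else 0 := by
  simp only [epr, maxEnt, Matrix.smul_apply, Matrix.of_apply, smul_eq_mul, mul_ite, mul_one,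
    mul_zero, ite_and, Finset.sum_ite_eq', Finset.mem_univ, if_true]

theorem sum_one_fst {s : Type*} [Fintype s] [DecidableEq s] (k l : s) :
    ∑ i, (1 : Op (s × s)) (i, k) (i, l) = if k = l then (Fintype.card s : ℂ) else 0 := by
  by_cases h : k = l <;> simp [Matrix.one_apply, h]

theorem trFst_compress [Fintype a] [DecidableEq b] [DecidableEq c]
    {J : Op (((Fin r₁ × Fin r₂) × b × c) × (a × Fin r₁ × Fin r₂))}
    {L : Op ((b × c) × (Fin r₁ × Fin r₂))}
    (hL : ∀ y z, ∑ p, L (y, p) (z, p) = if y = z then 1 else 0)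
    (hJ : ∀ k l p q p' q', ∑ i, J ((k, p), (i, p')) ((l, q), (i, q')) =
      if k = l then L (p, p') (q, q') else 0)
    {P : Op (Fin r₁ × Fin r₁)} {Q : Op (Fin r₂ × Fin r₂)} {κ μ : ℂ}
    (hP : ∀ k l, ∑ i, P (i, k) (i, l) = if k = l then κ else 0)
    (hQ : ∀ k l, ∑ i, Q (i, k) (i, l) = if k = l then μ else 0) :
    trFst (compress P Q J) = (κ * μ) • (1 : Op (b × c)) := by
  ext y z
  have h1 : ∀ q : (Fin r₂ × Fin r₂) × (Fin r₂ × Fin r₂), ∑ p : (Fin r₁ × Fin r₁) × (Fin r₁ × Fin r₁),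
      P p.2 p.1 * ∑ u, J (((p.1.1, q.1.1), y), (u, (p.1.2, q.1.2)))
        (((p.2.1, q.2.1), z), (u, (p.2.2, q.2.2))) =
      κ * if q.1.1 = q.2.1 then ∑ k, L (y, (k, q.1.2)) (z, (k, q.2.2)) else 0 := by
    intro q
    have := sum_mul_ite_fst hP fun k l =>
      if q.1.1 = q.2.1 then L (y, (k, q.1.2)) (z, (l, q.2.2)) else 0
    simp only [hJ, Prod.mk.injEq, ite_and]
    rw [this]
    split_ifs <;> simp
  have h2 := sum_mul_ite_fst hQ fun k' l' => ∑ k, L (y, (k, k')) (z, (k, l'))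
  calc trFst (compress P Q J) y z
      = ∑ q : (Fin r₂ × Fin r₂) × (Fin r₂ × Fin r₂), Q q.2 q.1 *
          ∑ p : (Fin r₁ × Fin r₁) × (Fin r₁ × Fin r₁),
            P p.2 p.1 * ∑ u, J (((p.1.1, q.1.1), y), (u, (p.1.2, q.1.2)))
              (((p.2.1, q.2.1), z), (u, (p.2.2, q.2.2))) := by
        simp only [trFst, compress, wtr, Matrix.of_apply, Matrix.submatrix_apply, regroup,
          Equiv.coe_fn_mk]
        rw [Finset.sum_comm]
        refine Finset.sum_congr rfl fun q _ => ?_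
        rw [← Finset.mul_sum, Finset.sum_comm]
        simp only [Finset.mul_sum]
    _ = ((κ * μ) • (1 : Op (b × c))) y z := by
        simp only [h1, mul_left_comm _ κ, ← Finset.mul_sum, h2]
        have h3 := hL y z
        rw [Fintype.sum_prod_type, Finset.sum_comm] at h3
        rw [h3, Matrix.smul_apply, Matrix.one_apply, smul_eq_mul, mul_assoc]

theorem compress_one_eq_padMid [Fintype b] [DecidableEq b] [Nonempty b]
    {J : Op (((Fin r₁ × Fin r₂) × b × c) × (a × Fin r₁ × Fin r₂))}
    {L : Op (((Fin r₁ × Fin r₂) × c) × (a × Fin r₂))}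
    (hJ : ∀ k l p q p' q', ∑ i, J (midFirst (Fin r₁ × Fin r₂) b c (k, p),
        midFirst a (Fin r₁) (Fin r₂) (i, p'))
      (midFirst (Fin r₁ × Fin r₂) b c (l, q), midFirst a (Fin r₁) (Fin r₂) (i, q')) =
        if k = l then L (p, p') (q, q') else 0) (Q : Op (Fin r₂ × Fin r₂)) :
    compress 1 Q J = padMid (trMid (compress 1 Q J)) := by
  refine eq_padMid_trMid (M := Matrix.of fun x y => ∑ q : (Fin r₂ × Fin r₂) × (Fin r₂ × Fin r₂),
    Q q.2 q.1 * ∑ i, L (((i, q.1.1), x.2), (x.1, q.1.2)) (((i, q.2.1), y.2), (y.1, q.2.2))) ?_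
  intro x y
  have h : compress 1 Q J x y = ∑ q : (Fin r₂ × Fin r₂) × (Fin r₂ × Fin r₂), Q q.2 q.1 *
      ∑ i, ∑ k, J (((i, q.1.1), x.2), (x.1, (k, q.1.2))) (((i, q.2.1), y.2), (y.1, (k, q.2.2))) := by
    refine Finset.sum_congr rfl fun q _ => ?_
    rw [wtr_one_apply, Fintype.sum_prod_type]
    rfl
  have h' : ∀ (q : (Fin r₂ × Fin r₂) × (Fin r₂ × Fin r₂)) (i : Fin r₁),
      ∑ k, J (((i, q.1.1), x.2), (x.1, (k, q.1.2))) (((i, q.2.1), y.2), (y.1, (k, q.2.2))) =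
        if x.2.1 = y.2.1 then L (((i, q.1.1), x.2.2), (x.1, q.1.2))
          (((i, q.2.1), y.2.2), (y.1, q.2.2)) else 0 := fun q i =>
    hJ x.2.1 y.2.1 ((i, q.1.1), x.2.2) ((i, q.2.1), y.2.2) (x.1, q.1.2) (y.1, q.2.2)
  simp only [h, h', Matrix.of_apply]
  split_ifs <;> simp

theorem compress_one_eq_padLast [Fintype c] [DecidableEq c] [Nonempty c]
    {J : Op (((Fin r₁ × Fin r₂) × b × c) × (a × Fin r₁ × Fin r₂))}
    {L : Op (((Fin r₁ × Fin r₂) × b) × (a × Fin r₁))}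
    (hJ : ∀ k l p q p' q', ∑ i, J (lastFirst (Fin r₁ × Fin r₂) b c (k, p),
        lastFirst a (Fin r₁) (Fin r₂) (i, p'))
      (lastFirst (Fin r₁ × Fin r₂) b c (l, q), lastFirst a (Fin r₁) (Fin r₂) (i, q')) =
        if k = l then L (p, p') (q, q') else 0) (P : Op (Fin r₁ × Fin r₁)) :
    compress P 1 J = padLast (trLast (compress P 1 J)) := by
  refine eq_padLast_trLast (M := Matrix.of fun x y => ∑ i, ∑ p : (Fin r₁ × Fin r₁) × (Fin r₁ × Fin r₁),
    P p.2 p.1 * L (((p.1.1, i), x.2), (x.1, p.1.2)) (((p.2.1, i), y.2), (y.1, p.2.2))) ?_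
  intro x y
  have h : compress P 1 J x y = ∑ i, ∑ p : (Fin r₁ × Fin r₁) × (Fin r₁ × Fin r₁), P p.2 p.1 *
      ∑ k, J (((p.1.1, i), x.2), (x.1, (p.1.2, k))) (((p.2.1, i), y.2), (y.1, (p.2.2, k))) := by
    simp only [compress, wtr_one_apply, Fintype.sum_prod_type (α₁ := Fin r₂), Finset.mul_sum]
    refine Finset.sum_congr rfl fun i _ => ?_
    rw [Finset.sum_comm]
    rfl
  have h' : ∀ (p : (Fin r₁ × Fin r₁) × (Fin r₁ × Fin r₁)) (i : Fin r₂),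
      ∑ k, J (((p.1.1, i), x.2), (x.1, (p.1.2, k))) (((p.2.1, i), y.2), (y.1, (p.2.2, k))) =
        if x.2.2 = y.2.2 then L (((p.1.1, i), x.2.1), (x.1, p.1.2))
          (((p.2.1, i), y.2.1), (y.1, p.2.2)) else 0 := fun p i =>
    hJ x.2.2 y.2.2 ((p.1.1, i), x.2.1) ((p.2.1, i), y.2.1) (x.1, p.1.2) (y.1, p.2.2)
  simp only [h, h', Matrix.of_apply]
  split_ifs <;> simp

end CompressMarginals

section CoreData

variable {a b c : Type*} [Fintype a] [Fintype b] [Fintype c] [DecidableEq b] [DecidableEq c]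

/-- The compressions `E`, `X`, `Y` of the Choi matrix of a code to the EPR pairs on `A₁B'` and
`A₂C'`, on `A₁B'` only and on `A₂C'` only, satisfy these constraints. -/
structure CoreData (r₁ r₂ : ℕ) (ρ : Op a) (E X Y : Op (a × b × c)) : Prop where
  density : IsDensity ρ
  pos_both : E.PosSemidef
  pos_left : (X - E).PosSemidef
  pos_right : (Y - E).PosSemidef
  pos_none : (ρ ⊗ₖ (1 : Op (b × c)) - X - Y + E).PosSemidef
  left_trivial : r₁ = 1 → X = ρ ⊗ₖ (1 : Op (b × c)) ∧ Y = E
  right_trivial : r₂ = 1 → Y = ρ ⊗ₖ (1 : Op (b × c)) ∧ X = E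

/-- The PPT conditions in terms of `E`, `X` and `Y`. -/
structure CorePPT (r₁ r₂ : ℕ) (ρ : Op a) (E X Y : Op (a × b × c)) : Prop where
  sender : ∀ ε δ : ℂ, ε ^ 2 = 1 → δ ^ 2 = 1 →
    (ρ ⊗ₖ (1 : Op (b × c)) + (ε * r₁) • ptSnd X + (δ * r₂) • ptSnd Y +
      (ε * δ * r₁ * r₂) • ptSnd E).PosSemidef
  bob_pos : ∀ ε : ℂ, ε ^ 2 = 1 → (ptMid Y + (ε * r₁) • ptMid E).PosSemidef
  bob_neg : ∀ ε : ℂ, ε ^ 2 = 1 → (ρ ⊗ₖ (1 : Op (b × c)) - ptMid Y +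
    (ε * r₁) • (ptMid X - ptMid E)).PosSemidef
  charlie_pos : ∀ ε : ℂ, ε ^ 2 = 1 → (ptLast X + (ε * r₂) • ptLast E).PosSemidef
  charlie_neg : ∀ ε : ℂ, ε ^ 2 = 1 → (ρ ⊗ₖ (1 : Op (b × c)) - ptLast X +
    (ε * r₂) • (ptLast Y - ptLast E)).PosSemidef

/-- The marginals of `E`, `X` and `Y` when the sender cannot signal. -/
structure CoreMarginals (r₁ r₂ : ℕ) (E X Y : Op (a × b × c)) : Prop where
  both : trFst E = (1 / ((r₁ : ℂ) ^ 2 * (r₂ : ℂ) ^ 2)) • (1 : Op (b × c))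
  left : trFst X = (1 / (r₁ : ℂ) ^ 2) • (1 : Op (b × c))
  right : trFst Y = (1 / (r₂ : ℂ) ^ 2) • (1 : Op (b × c))

end CoreData

section Forward

variable {a b c : Type*} [Fintype a] [Fintype b] [Fintype c] [DecidableEq b] [DecidableEq c]
  {r₁ r₂ : ℕ}

theorem posSemidef_of_eq {n : Type*} {X Y : Op n} (hX : X.PosSemidef) (h : X = Y) :
    Y.PosSemidef := h ▸ hX

theorem ptSnd_kronecker_one (ρ : Op a) :
    ptSnd (ρ ⊗ₖ (1 : Op (b × c))) = ρ ⊗ₖ (1 : Op (b × c)) := by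
  ext x y
  simp [ptSnd, Matrix.one_apply, eq_comm]

theorem ptMid_kronecker_one (ρ : Op a) :
    ptMid (ρ ⊗ₖ (1 : Op (b × c))) = ρ ⊗ₖ (1 : Op (b × c)) := by
  ext x y
  simp [ptMid, Matrix.one_apply, Prod.ext_iff, eq_comm]

theorem ptLast_kronecker_one (ρ : Op a) :
    ptLast (ρ ⊗ₖ (1 : Op (b × c))) = ρ ⊗ₖ (1 : Op (b × c)) := by
  ext x y
  simp [ptLast, Matrix.one_apply, Prod.ext_iff, eq_comm]

theorem trFst_smul {α γ : Type*} [Fintype α] (t : ℂ) (X : Op (α × γ)) :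
    trFst (t • X) = t • trFst X := (trFstMap α γ).map_smul t X

theorem trMid_smul {α β γ : Type*} [Fintype β] (t : ℂ) (X : Op (α × β × γ)) :
    trMid (t • X) = t • trMid X := (trMidMap α β γ).map_smul t X

theorem trLast_smul {α β γ : Type*} [Fintype γ] (t : ℂ) (X : Op (α × β × γ)) :
    trLast (t • X) = t • trLast X := (trLastMap α β γ).map_smul t X

theorem padMid_smul {α β γ : Type*} [Fintype β] [DecidableEq β] (t : ℂ) (X : Op (α × γ)) :
    (padMid (t • X) : Op (α × β × γ)) = t • padMid X := (padMidMap α β γ).map_smul t X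

theorem padLast_smul {α β γ : Type*} [Fintype γ] [DecidableEq γ] (t : ℂ) (X : Op (α × β)) :
    (padLast (t • X) : Op (α × β × γ)) = t • padLast X := (padLastMap α β γ).map_smul t X

theorem ptMid_add {α β γ : Type*} (X Y : Op (α × β × γ)) : ptMid (X + Y) = ptMid X + ptMid Y := rfl

theorem ptMid_sub {α β γ : Type*} (X Y : Op (α × β × γ)) : ptMid (X - Y) = ptMid X - ptMid Y := rfl

theorem ptMid_smul {α β γ : Type*} (t : ℂ) (X : Op (α × β × γ)) : ptMid (t • X) = t • ptMid X := rfl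

theorem ptLast_add {α β γ : Type*} (X Y : Op (α × β × γ)) :
    ptLast (X + Y) = ptLast X + ptLast Y := rfl

theorem ptLast_sub {α β γ : Type*} (X Y : Op (α × β × γ)) :
    ptLast (X - Y) = ptLast X - ptLast Y := rfl

theorem ptLast_smul {α β γ : Type*} (t : ℂ) (X : Op (α × β × γ)) :
    ptLast (t • X) = t • ptLast X := rfl

theorem compress_add_left (P P' : Op (Fin r₁ × Fin r₁)) (Q : Op (Fin r₂ × Fin r₂))
    (J : Op (((Fin r₁ × Fin r₂) × b × c) × (a × Fin r₁ × Fin r₂))) :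
    compress (P + P') Q J = compress P Q J + compress P' Q J := by
  rw [compress, wtr_add_left, wtr_add, compress, compress]

theorem compress_sub_left (P P' : Op (Fin r₁ × Fin r₁)) (Q : Op (Fin r₂ × Fin r₂))
    (J : Op (((Fin r₁ × Fin r₂) × b × c) × (a × Fin r₁ × Fin r₂))) :
    compress (P - P') Q J = compress P Q J - compress P' Q J := by
  rw [compress, wtr_sub_left, wtr_sub, compress, compress]

theorem compress_smul_left (t : ℂ) (P : Op (Fin r₁ × Fin r₁)) (Q : Op (Fin r₂ × Fin r₂))
    (J : Op (((Fin r₁ × Fin r₂) × b × c) × (a × Fin r₁ × Fin r₂))) :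
    compress (t • P) Q J = t • compress P Q J := by
  rw [compress, wtr_smul_left, wtr_smul, compress]

theorem compress_add_right (P : Op (Fin r₁ × Fin r₁)) (Q Q' : Op (Fin r₂ × Fin r₂))
    (J : Op (((Fin r₁ × Fin r₂) × b × c) × (a × Fin r₁ × Fin r₂))) :
    compress P (Q + Q') J = compress P Q J + compress P Q' J := wtr_add_left _ _ _

theorem compress_sub_right (P : Op (Fin r₁ × Fin r₁)) (Q Q' : Op (Fin r₂ × Fin r₂))
    (J : Op (((Fin r₁ × Fin r₂) × b × c) × (a × Fin r₁ × Fin r₂))) :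
    compress P (Q - Q') J = compress P Q J - compress P Q' J := wtr_sub_left _ _ _

theorem compress_smul_right (t : ℂ) (P : Op (Fin r₁ × Fin r₁)) (Q : Op (Fin r₂ × Fin r₂))
    (J : Op (((Fin r₁ × Fin r₂) × b × c) × (a × Fin r₁ × Fin r₂))) :
    compress P (t • Q) J = t • compress P Q J := wtr_smul_left _ _ _

theorem one_add_sign_flip_posSemidef {n : Type*} [Fintype n] [DecidableEq n] {ε : ℂ}
    (hε : ε ^ 2 = 1) : (1 + ε • flip n).PosSemidef := by
  rcases mul_self_eq_one_iff.1 (sq ε ▸ hε) with rfl | rfl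
  · simpa using one_add_flip_posSemidef (n := n)
  · simpa [← sub_eq_add_neg] using one_sub_flip_posSemidef (n := n)

theorem ptSnd_one_add_smul_flip (r : ℕ) [NeZero r] (ε : ℂ) :
    ptSnd (1 + ε • flip (Fin r)) = 1 + (ε * r) • epr (Fin r) := by
  rw [ptSnd_add, ptSnd_one, ptSnd_smul, ptSnd_flip, ← card_smul_epr, smul_smul, Fintype.card_fin]

theorem transpose_one_add_smul_epr (r : ℕ) (t : ℂ) :
    (1 + t • epr (Fin r))ᵀ = 1 + t • epr (Fin r) := by
  rw [Matrix.transpose_add, Matrix.transpose_one, Matrix.transpose_smul, epr,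
    Matrix.transpose_smul, transpose_maxEnt]

theorem ForwardCode.exists_coreData [DecidableEq a] [Nonempty a] [Nonempty b] [Nonempty c]
    [NeZero r₁] [NeZero r₂]
    (K : ForwardCode a b c r₁ r₂) {N : Op a →ₗ[ℂ] Op (b × c)} {ρ : Op a} {f : ℝ}
    (hK : K.Attains N ρ f) : ∃ E X Y : Op (a × b × c), CoreData r₁ r₂ ρ E X Y ∧
      (f : ℂ) = (E * (choi N)ᵀ).trace ∧
      (NoSignalA K.operation → CoreMarginals r₁ r₂ E X Y) ∧
      (NoSignalB K.operation → Y = padMid (trMid Y)) ∧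
      (NoSignalC K.operation → X = padLast (trLast X)) ∧
      (IsPPT K.operation → CorePPT r₁ r₂ ρ E X Y) := by
  obtain ⟨rfl, hf⟩ := hK
  have h₁ : (r₁ : ℂ) ≠ 0 := Nat.cast_ne_zero.2 (NeZero.ne r₁)
  have h₂ : (r₂ : ℂ) ≠ 0 := Nat.cast_ne_zero.2 (NeZero.ne r₂)
  have hr : r₁ * r₂ ≠ 0 := mul_ne_zero (NeZero.ne r₁) (NeZero.ne r₂)
  have hs : (0 : ℂ) ≤ ((r₁ : ℂ) * r₂)⁻¹ := by positivity
  have hJ := K.choi_operation_posSemidef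
  have hone : ((r₁ : ℂ) * r₂)⁻¹ • compress 1 1 (choi K.operation) =
      K.avgInput ⊗ₖ (1 : Op (b × c)) := by
    ext x y
    rw [Matrix.smul_apply, compress_one_one_apply, K.sum_sum_choi_operation hr, smul_eq_mul,
      inv_mul_cancel_left₀ (mul_ne_zero h₁ h₂)]
  have pos : ∀ {P : Op (Fin r₁ × Fin r₁)} {Q : Op (Fin r₂ × Fin r₂)}
      {J : Op (((Fin r₁ × Fin r₂) × b × c) × (a × Fin r₁ × Fin r₂))},
      P.PosSemidef → Q.PosSemidef → J.PosSemidef →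
      (((r₁ : ℂ) * r₂)⁻¹ • compress P Q J).PosSemidef := fun hP hQ hJ =>
    (compress_posSemidef hP hQ hJ).smul hs
  refine ⟨((r₁ : ℂ) * r₂)⁻¹ • compress (epr (Fin r₁)) (epr (Fin r₂)) (choi K.operation),
    ((r₁ : ℂ) * r₂)⁻¹ • compress (epr (Fin r₁)) 1 (choi K.operation),
    ((r₁ : ℂ) * r₂)⁻¹ • compress 1 (epr (Fin r₂)) (choi K.operation), ⟨K.isDensity_avgInput hr,
      pos epr_posSemidef epr_posSemidef hJ, ?_, ?_, ?_, ?_, ?_⟩, ?_, fun hA => ?_, fun hB => ?_,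
      fun hC => ?_, fun hP => ?_⟩
  · have := pos (epr_posSemidef (n := Fin r₁)) (one_sub_epr_posSemidef (n := Fin r₂)) hJ
    rwa [compress_sub_right, smul_sub] at this
  · have := pos (one_sub_epr_posSemidef (n := Fin r₁)) (epr_posSemidef (n := Fin r₂)) hJ
    rwa [compress_sub_left, smul_sub] at this
  · have := pos (one_sub_epr_posSemidef (n := Fin r₁)) (one_sub_epr_posSemidef (n := Fin r₂)) hJ
    rw [compress_sub_left, compress_sub_right, compress_sub_right, smul_sub, smul_sub,
      smul_sub, hone] at this
    refine posSemidef_of_eq this ?_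
    abel
  · rintro rfl
    rw [← hone, epr_eq_one (n := Fin 1)]
    exact ⟨rfl, rfl⟩
  · rintro rfl
    rw [← hone, epr_eq_one (n := Fin 1)]
    exact ⟨rfl, rfl⟩
  · rw [← hf, K.channelFidelity_induced]
  · obtain ⟨L, hL, hA⟩ := hA.sum_choi
    constructor
    · rw [trFst_smul, trFst_compress hL hA sum_epr_fst sum_epr_fst, smul_smul, Fintype.card_fin,
        Fintype.card_fin]
      congr 1
      field_simp
    · rw [trFst_smul, trFst_compress hL hA sum_epr_fst sum_one_fst, smul_smul, Fintype.card_fin,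
        Fintype.card_fin]
      congr 1
      field_simp
    · rw [trFst_smul, trFst_compress hL hA sum_one_fst sum_epr_fst, smul_smul, Fintype.card_fin,
        Fintype.card_fin]
      congr 1
      field_simp
  · obtain ⟨L, hB⟩ := hB.sum_choi
    rw [trMid_smul, padMid_smul, ← compress_one_eq_padMid hB]
  · obtain ⟨L, hC⟩ := hC.sum_choi
    rw [trLast_smul, padLast_smul, ← compress_one_eq_padLast hC]
  · obtain ⟨hPA, hPB, hPC⟩ := hP
    constructor
    · intro ε δ hε hδ
      have := (pos (one_add_sign_flip_posSemidef hε) (one_add_sign_flip_posSemidef hδ)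
        hPA).transpose
      rw [compress_ptA, ptSnd_one_add_smul_flip, ptSnd_one_add_smul_flip,
        transpose_one_add_smul_epr, transpose_one_add_smul_epr, Matrix.transpose_smul,
        Matrix.transpose_transpose, ← ptSnd_smul, compress_add_left, compress_add_right,
        compress_add_right, compress_smul_left, compress_smul_left, compress_smul_right,
        compress_smul_right] at this
      rw [← ptSnd_kronecker_one, ← hone]
      refine posSemidef_of_eq this ?_
      simp only [ptSnd_add, ptSnd_smul]
      module
    · intro ε hε
      have := pos (one_add_sign_flip_posSemidef hε) (epr_posSemidef (n := Fin r₂)) hPB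
      rw [compress_ptB, ptSnd_one_add_smul_flip, compress_add_left, compress_smul_left] at this
      refine posSemidef_of_eq this ?_
      simp only [ptMid_add, ptMid_smul]
      module
    · intro ε hε
      have := pos (one_add_sign_flip_posSemidef hε) (one_sub_epr_posSemidef (n := Fin r₂)) hPB
      rw [compress_ptB, ptSnd_one_add_smul_flip, compress_add_left, compress_smul_left,
        compress_sub_right, compress_sub_right] at this
      rw [← ptMid_kronecker_one, ← hone]
      refine posSemidef_of_eq this ?_
      simp only [ptMid_add, ptMid_smul, ptMid_sub]
      module
    · intro ε hε
      have := pos (epr_posSemidef (n := Fin r₁)) (one_add_sign_flip_posSemidef hε) hPC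
      rw [compress_ptC, ptSnd_one_add_smul_flip, compress_add_right, compress_smul_right] at this
      refine posSemidef_of_eq this ?_
      simp only [ptLast_add, ptLast_smul]
      module
    · intro ε hε
      have := pos (one_sub_epr_posSemidef (n := Fin r₁)) (one_add_sign_flip_posSemidef hε) hPC
      rw [compress_ptC, ptSnd_one_add_smul_flip, compress_add_right, compress_smul_right,
        compress_sub_left, compress_sub_left] at this
      rw [← ptLast_kronecker_one, ← hone]
      refine posSemidef_of_eq this ?_
      simp only [ptLast_add, ptLast_smul, ptLast_sub]
      module

end Forward

section Factorization

variable {a n ι : Type*} [Fintype a] [Fintype n] [DecidableEq a] [DecidableEq n]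

theorem mul_conjTranspose_eq_zero_of_posSemidef {G B : Op n} (hG : G.PosSemidef)
    (h : B * G * Bᴴ = 0) : G * Bᴴ = 0 := by
  ext i j
  have h1 : star (fun k => Bᴴ k j) ⬝ᵥ (G *ᵥ fun k => Bᴴ k j) = 0 := by
    have := congrFun₂ h j j
    rw [Matrix.mul_assoc, Matrix.mul_apply] at this
    simp only [dotProduct, Matrix.mulVec, Pi.star_apply, Matrix.conjTranspose_apply, star_star]
    simpa [Matrix.mul_apply] using this
  have h2 := congrFun ((hG.dotProduct_mulVec_zero_iff _).1 h1) i
  simpa [Matrix.mul_apply, Matrix.mulVec, dotProduct] using h2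

/-- A factorization `ρ = S Sᴴ` together with a pseudo-inverse of `S`. -/
theorem exists_factor_pseudoinverse {ρ : Op a} (hρ : ρ.PosSemidef) :
    ∃ S T : Op a, S * Sᴴ = ρ ∧ S * (T * S) = S ∧ (T * S)ᴴ = T * S ∧ (1 - T * S).PosSemidef := by
  set U : Op a := (hρ.isHermitian.eigenvectorUnitary : Op a) with hU
  have hUU : Uᴴ * U = 1 := Unitary.coe_star_mul_self hρ.isHermitian.eigenvectorUnitary
  set l := hρ.isHermitian.eigenvalues with hl
  have hl0 : ∀ i, 0 ≤ l i := hρ.eigenvalues_nonneg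
  let d : a → ℂ := fun i => (Real.sqrt (l i) : ℂ)
  let e : a → ℂ := fun i => (d i)⁻¹
  have hTS : Matrix.diagonal e * Uᴴ * (U * Matrix.diagonal d) =
      Matrix.diagonal fun i => e i * d i := by
    rw [Matrix.mul_assoc, ← Matrix.mul_assoc Uᴴ, hUU, Matrix.one_mul, Matrix.diagonal_mul_diagonal]
  have hed : ∀ i, e i * d i = 0 ∨ e i * d i = 1 := by
    intro i
    by_cases h : d i = 0
    · simp [h]
    · exact Or.inr (inv_mul_cancel₀ h)
  refine ⟨U * Matrix.diagonal d, Matrix.diagonal e * Uᴴ, ?_, ?_, ?_, ?_⟩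
  · have h := hρ.isHermitian.spectral_theorem
    rw [Unitary.conjStarAlgAut_apply] at h
    have hd : Matrix.diagonal d * (Matrix.diagonal d)ᴴ =
        Matrix.diagonal (RCLike.ofReal ∘ l : a → ℂ) := by
      rw [Matrix.diagonal_conjTranspose, Matrix.diagonal_mul_diagonal]
      congr 1
      funext i
      simp only [d, Pi.star_apply, Function.comp, RCLike.star_def, Complex.conj_ofReal]
      rw [← Complex.ofReal_mul, Real.mul_self_sqrt (hl0 i)]
      rfl
    rw [Matrix.conjTranspose_mul, Matrix.mul_assoc, ← Matrix.mul_assoc (Matrix.diagonal d), hd,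
      ← Matrix.mul_assoc]
    exact h.symm
  · rw [hTS, Matrix.mul_assoc, Matrix.diagonal_mul_diagonal]
    congr 2
    funext i
    by_cases h : d i = 0
    · simp [h]
    · simp [e, h]
  · rw [hTS, Matrix.diagonal_conjTranspose]
    congr 1
    funext i
    rcases hed i with h | h <;> simp only [Pi.star_apply, h, star_zero, star_one]
  · rw [hTS, ← Matrix.diagonal_one, Matrix.diagonal_sub]
    refine Matrix.PosSemidef.diagonal fun i => ?_
    rcases hed i with h | h <;> simp [h]

theorem sub_kronecker_one (A : Op a) :
    (1 - A) ⊗ₖ (1 : Op n) = 1 - A ⊗ₖ (1 : Op n) := by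
  rw [← Matrix.one_kronecker_one (m := a)]
  ext x y
  simp only [Matrix.kroneckerMap_apply, Matrix.sub_apply, sub_mul]

theorem exists_conj_decomposition [Fintype ι] [DecidableEq ι] {ρ : Op a} (hρ : ρ.PosSemidef)
    (i₀ : ι)
    {G : ι → Op (a × n)} (hG : ∀ i, (G i).PosSemidef) (hsum : ∑ i, G i = ρ ⊗ₖ (1 : Op n)) :
    ∃ (S : Op a) (F : ι → Op (a × n)), S * Sᴴ = ρ ∧ (∀ i, (F i).PosSemidef) ∧ ∑ i, F i = 1 ∧
      (∀ i, (S ⊗ₖ (1 : Op n)) * F i * (S ⊗ₖ (1 : Op n))ᴴ = G i) ∧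
      ∀ i, i ≠ i₀ → G i = 0 → F i = 0 := by
  obtain ⟨S, T, hS, hSTS, hP, hP1⟩ := exists_factor_pseudoinverse hρ
  have hk : ∀ A B : Op a, (A * B) ⊗ₖ (1 : Op n) = (A ⊗ₖ 1) * (B ⊗ₖ 1) := fun A B => by
    rw [← Matrix.mul_kronecker_mul, one_mul]
  have hkH : ∀ A : Op a, (A ⊗ₖ (1 : Op n))ᴴ = Aᴴ ⊗ₖ 1 := fun A => by
    rw [Matrix.conjTranspose_kronecker, Matrix.conjTranspose_one]
  have hcomp : (1 - S * T) * ρ = 0 := by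
    rw [← hS, sub_mul, one_mul, ← Matrix.mul_assoc, Matrix.mul_assoc S T S, hSTS, sub_self]
  set B : Op (a × n) := (1 - S * T) ⊗ₖ (1 : Op n) with hB
  have hBG : ∀ i, G i * Bᴴ = 0 := by
    intro i
    refine mul_conjTranspose_eq_zero_of_posSemidef (hG i) ?_
    have h0 : ∑ j, B * G j * Bᴴ = 0 := by
      rw [← Finset.sum_mul, ← Finset.mul_sum, hsum, hB, ← hk, hcomp]
      simp
    exact (Finset.sum_eq_zero_iff_of_nonneg fun j _ => Matrix.nonneg_iff_posSemidef.2
      ((hG j).mul_mul_conjTranspose_same B)).1 h0 i (Finset.mem_univ i)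
  have hB' : B = 1 - (S * T) ⊗ₖ (1 : Op n) := by
    rw [hB, sub_kronecker_one]
  have h_right : ∀ i, G i * ((S * T) ⊗ₖ (1 : Op n))ᴴ = G i := by
    intro i
    have := hBG i
    rw [hB', Matrix.conjTranspose_sub, Matrix.conjTranspose_one, mul_sub, mul_one,
      sub_eq_zero] at this
    exact this.symm
  have h_left : ∀ i, ((S * T) ⊗ₖ (1 : Op n)) * G i = G i := by
    intro i
    have := congrArg Matrix.conjTranspose (h_right i)
    rwa [Matrix.conjTranspose_mul, Matrix.conjTranspose_conjTranspose,
      (hG i).isHermitian.eq] at this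
  refine ⟨S, fun i => (T ⊗ₖ (1 : Op n)) * G i * (T ⊗ₖ (1 : Op n))ᴴ +
    if i = i₀ then (1 - T * S) ⊗ₖ (1 : Op n) else 0, hS, fun i => ?_, ?_, fun i => ?_,
    fun i hi hGi => ?_⟩
  · refine ((hG i).mul_mul_conjTranspose_same _).add ?_
    split_ifs
    · exact posSemidef_kronecker hP1 Matrix.PosSemidef.one
    · exact Matrix.PosSemidef.zero
  · rw [Finset.sum_add_distrib, ← Finset.sum_mul, ← Finset.mul_sum, hsum, hkH, ← hk, ← hk]
    have hT : T * ρ * Tᴴ = T * S := by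
      rw [← hS, ← Matrix.mul_assoc, Matrix.mul_assoc, ← Matrix.conjTranspose_mul, hP,
        Matrix.mul_assoc, hSTS]
    simp [hT, sub_kronecker_one]
  · have hz : S * (1 - T * S) = 0 := by rw [mul_sub, mul_one, hSTS, sub_self]
    rw [mul_add, add_mul]
    have h1 : (S ⊗ₖ (1 : Op n)) * ((T ⊗ₖ (1 : Op n)) * G i * (T ⊗ₖ (1 : Op n))ᴴ) *
        (S ⊗ₖ (1 : Op n))ᴴ = G i := by
      calc _ = (((S * T) ⊗ₖ (1 : Op n)) * G i) * ((S * T) ⊗ₖ (1 : Op n))ᴴ := by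
            rw [hk, Matrix.conjTranspose_mul]
            simp only [Matrix.mul_assoc]
        _ = G i := by rw [h_left, h_right]
    rw [h1]
    split_ifs
    · rw [← hk, hz]
      simp
    · simp
  · simp [hi, hGi]

end Factorization

section Blocks

variable {a b c : Type*} {r₁ r₂ : ℕ}

/-- The normalized complement of the EPR pair. -/
def eprCompl (r : ℕ) : Op (Fin r × Fin r) := ((r : ℂ) ^ 2 - 1)⁻¹ • (1 - epr (Fin r))

/-- The EPR pair for `true`, its normalized complement for `false`. -/
def localState (r : ℕ) (k : Bool) : Op (Fin r × Fin r) := if k then epr (Fin r) else eprCompl r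

theorem sq_sub_one_nonneg (r : ℕ) [NeZero r] : (0 : ℂ) ≤ (r : ℂ) ^ 2 - 1 := by
  have h : (1 : ℝ) ≤ r := by exact_mod_cast Nat.one_le_iff_ne_zero.2 (NeZero.ne r)
  have : (0 : ℝ) ≤ (r : ℝ) ^ 2 - 1 := by nlinarith
  exact_mod_cast Complex.zero_le_real.2 this

theorem sq_sub_one_ne_zero {r : ℕ} (hr : r ≠ 1) : (r : ℂ) ^ 2 - 1 ≠ 0 := by
  intro h
  have h' : (r : ℂ) ^ 2 = 1 := sub_eq_zero.1 h
  have : r ^ 2 = 1 := by exact_mod_cast h'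
  exact hr (by nlinarith)

theorem localState_posSemidef (r : ℕ) [NeZero r] (k : Bool) : (localState r k).PosSemidef := by
  cases k
  · exact (one_sub_epr_posSemidef (n := Fin r)).smul (inv_nonneg.2 (sq_sub_one_nonneg r))
  · exact epr_posSemidef

theorem sum_epr_snd {s : Type*} [Fintype s] [DecidableEq s] (i j : s) :
    ∑ p, epr s (i, p) (j, p) = if i = j then (Fintype.card s : ℂ)⁻¹ else 0 := by
  simp only [epr, maxEnt, Matrix.smul_apply, Matrix.of_apply, smul_eq_mul, mul_ite, mul_one,
    mul_zero, ite_and, Finset.sum_ite_eq, Finset.mem_univ, if_true]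
  simp [eq_comm]

theorem sum_one_snd {s : Type*} [Fintype s] [DecidableEq s] (i j : s) :
    ∑ p, (1 : Op (s × s)) (i, p) (j, p) = if i = j then (Fintype.card s : ℂ) else 0 := by
  by_cases h : i = j <;> simp [Matrix.one_apply, h]

theorem sum_localState (r : ℕ) [NeZero r] {k : Bool} (hk : r = 1 → k = true) (i j : Fin r) :
    ∑ p, localState r k (i, p) (j, p) = if i = j then (r : ℂ)⁻¹ else 0 := by
  have hr : (r : ℂ) ≠ 0 := Nat.cast_ne_zero.2 (NeZero.ne r)
  cases k
  · have h1 := sq_sub_one_ne_zero (r := r) (fun h => by simpa using hk h)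
    simp only [localState, eprCompl, Bool.false_eq_true, if_false, Matrix.smul_apply,
      Matrix.sub_apply, smul_eq_mul, ← Finset.mul_sum, Finset.sum_sub_distrib, sum_epr_snd,
      sum_one_snd, Fintype.card_fin]
    split_ifs
    · field_simp
    · simp
  · simpa [localState] using sum_epr_snd i j

/-- The Choi matrix with block `G k` on the product of the local states `k.1` and `k.2`. -/
def blockChoi (r₁ r₂ : ℕ) (G : Bool × Bool → Op (a × b × c)) :
    Op (((Fin r₁ × Fin r₂) × b × c) × (a × Fin r₁ × Fin r₂)) :=
  (∑ k, ((r₁ : ℂ) * r₂) • (localState r₁ k.1 ⊗ₖ (localState r₂ k.2 ⊗ₖ G k))).submatrix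
    (regroup a b c r₁ r₂).symm (regroup a b c r₁ r₂).symm

theorem blockChoi_apply (G : Bool × Bool → Op (a × b × c)) (i j p q : Fin r₁ × Fin r₂)
    (x y : b × c) (u v : a) :
    blockChoi r₁ r₂ G ((i, x), (u, p)) ((j, y), (v, q)) =
      ∑ k, ((r₁ : ℂ) * r₂) * (localState r₁ k.1 (i.1, p.1) (j.1, q.1) *
        (localState r₂ k.2 (i.2, p.2) (j.2, q.2) * G k (u, x) (v, y))) := by
  simp only [blockChoi, Matrix.submatrix_apply, Matrix.sum_apply, Matrix.smul_apply, smul_eq_mul,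
    Matrix.kroneckerMap_apply]
  rfl

theorem blockChoi_posSemidef [Fintype a] [Fintype b] [Fintype c] [NeZero r₁] [NeZero r₂]
    {G : Bool × Bool → Op (a × b × c)} (hG : ∀ k, (G k).PosSemidef) :
    (blockChoi r₁ r₂ G).PosSemidef :=
  (Matrix.posSemidef_sum _ fun k _ => (posSemidef_kronecker (localState_posSemidef r₁ k.1)
    (posSemidef_kronecker (localState_posSemidef r₂ k.2) (hG k))).smul (by positivity)).submatrix _

theorem sum_blockChoi [NeZero r₁] [NeZero r₂] {G : Bool × Bool → Op (a × b × c)}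
    (h₁ : r₁ = 1 → ∀ l, G (false, l) = 0) (h₂ : r₂ = 1 → ∀ l, G (l, false) = 0)
    (i j : Fin r₁ × Fin r₂) (x y : b × c) (u v : a) :
    ∑ p, blockChoi r₁ r₂ G ((i, x), (u, p)) ((j, y), (v, p)) =
      if i = j then (∑ k, G k) (u, x) (v, y) else 0 := by
  have hr₁ : (r₁ : ℂ) ≠ 0 := Nat.cast_ne_zero.2 (NeZero.ne r₁)
  have hr₂ : (r₂ : ℂ) ≠ 0 := Nat.cast_ne_zero.2 (NeZero.ne r₂)
  simp only [blockChoi_apply, Matrix.sum_apply]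
  rw [Finset.sum_comm]
  have h : ∀ k, ∑ p : Fin r₁ × Fin r₂, ((r₁ : ℂ) * r₂) * (localState r₁ k.1 (i.1, p.1) (j.1, p.1) *
      (localState r₂ k.2 (i.2, p.2) (j.2, p.2) * G k (u, x) (v, y))) =
        if i = j then G k (u, x) (v, y) else 0 := by
    rintro ⟨k, l⟩
    by_cases hk : r₁ = 1 ∧ k = false
    · simp [hk.2, h₁ hk.1]
    by_cases hl : r₂ = 1 ∧ l = false
    · simp [hl.2, h₂ hl.1]
    have hk' : r₁ = 1 → k = true := fun h => by simpa [h] using hk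
    have hl' : r₂ = 1 → l = true := fun h => by simpa [h] using hl
    rw [← Finset.mul_sum, Fintype.sum_prod_type]
    simp only [← Finset.mul_sum, ← Finset.sum_mul, sum_localState r₁ hk', sum_localState r₂ hl',
      Prod.ext_iff]
    by_cases hi : i.1 = j.1 <;> by_cases hj : i.2 = j.2 <;> simp only [hi, hj, if_true, if_false,
      true_and, false_and, and_self, and_true, and_false, zero_mul, mul_zero]
    field_simp
  simp only [h]
  split_ifs <;> simp

end Blocks

section Construction

variable {a b c : Type*} [Fintype a] [Fintype b] [Fintype c] [DecidableEq a] [DecidableEq b]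
  [DecidableEq c] {r₁ r₂ : ℕ}

theorem exists_code_of_blocks [NeZero r₁] [NeZero r₂] {ρ : Op a} (hρ : IsDensity ρ)
    {G : Bool × Bool → Op (a × b × c)} (hG : ∀ k, (G k).PosSemidef)
    (hsum : ∑ k, G k = ρ ⊗ₖ (1 : Op (b × c)))
    (h₁ : r₁ = 1 → ∀ l, G (false, l) = 0) (h₂ : r₂ = 1 → ∀ l, G (l, false) = 0) :
    ∃ K : ForwardCode a b c r₁ r₂, K.avgInput = ρ ∧ choi K.operation = blockChoi r₁ r₂ G := by
  have hr : ((r₁ : ℂ) * r₂) ≠ 0 := mul_ne_zero (Nat.cast_ne_zero.2 (NeZero.ne r₁))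
    (Nat.cast_ne_zero.2 (NeZero.ne r₂))
  obtain ⟨S, F, hS, hF, hF1, hFG, hF0⟩ := exists_conj_decomposition hρ.1 (true, true) hG hsum
  have hSS : ∀ u v, ∑ w, S u w * star (S v w) = ρ u v := fun u v => by
    rw [← hS]; rfl
  have e := Fintype.equivFin (a × (Fin r₁ × Fin r₂))
  have hs : ∀ f : Fin (Fintype.card (a × (Fin r₁ × Fin r₂))) → ℂ, ∑ x, f x =
      ∑ w, ∑ i, f (e (w, i)) := fun f => by
    rw [← e.sum_comp, Fintype.sum_prod_type]
  let V : Matrix (a × Fin (Fintype.card (a × (Fin r₁ × Fin r₂)))) (Fin r₁ × Fin r₂) ℂ :=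
    Matrix.of fun k i => if (e.symm k.2).2 = i then S k.1 (e.symm k.2).1 else 0
  let g : (Fin (Fintype.card (a × (Fin r₁ × Fin r₂))) × b × c) × (Fin r₁ × Fin r₂) →
      ((Fin r₁ × Fin r₂) × b × c) × (a × Fin r₁ × Fin r₂) :=
    fun k => (((e.symm k.1.1).2, k.1.2), ((e.symm k.1.1).1, k.2))
  have hV : Vᴴ * V = 1 := by
    ext i j
    have htr := hρ.2
    simp only [Matrix.trace, Matrix.diag_apply, ← hSS] at htr
    simp only [Matrix.mul_apply, Matrix.conjTranspose_apply, V, Matrix.of_apply,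
      Fintype.sum_prod_type (α₁ := a), hs, Equiv.symm_apply_apply, Matrix.one_apply,
      apply_ite star, star_zero, mul_ite, ite_mul, zero_mul, mul_zero]
    by_cases hij : i = j
    · subst hij
      simpa [← ite_and, mul_comm] using htr
    · rw [if_neg hij]
      refine Finset.sum_eq_zero fun u _ => Finset.sum_eq_zero fun w _ =>
        Finset.sum_eq_zero fun k _ => ?_
      split_ifs with h h' <;> simp_all
  have hD : IsChannel (ofChoi ((blockChoi r₁ r₂ F).submatrix g g)) := by
    refine isChannel_of_choi ?_ ?_
    · rw [choi_ofChoi]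
      exact (blockChoi_posSemidef hF).submatrix g
    · rintro ⟨k, x⟩ ⟨l, y⟩
      rw [choi_ofChoi]
      have := sum_blockChoi (fun h l => hF0 _ (by simp) (h₁ h l))
        (fun h l => hF0 _ (by simp) (h₂ h l)) (e.symm k).2 (e.symm l).2 x y (e.symm k).1
        (e.symm l).1
      refine this.trans ?_
      rw [hF1]
      have hkl : k = l ↔ (e.symm k).1 = (e.symm l).1 ∧ (e.symm k).2 = (e.symm l).2 := by
        rw [← e.symm.injective.eq_iff, Prod.ext_iff]
      by_cases h1 : (e.symm k).2 = (e.symm l).2 <;> simp [h1, hkl, Matrix.one_apply]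
  refine ⟨⟨_, V, hV, _, hD⟩, ?_, ?_⟩
  · ext u v
    rw [ForwardCode.avgInput_apply, ← hSS]
    simp only [V, hs, Matrix.of_apply, Equiv.symm_apply_apply, apply_ite star, star_zero, mul_ite,
      ite_mul, zero_mul, mul_zero]
    simp only [← ite_and, and_self, Finset.sum_ite_eq, Finset.mem_univ, if_true, Finset.sum_const,
      Finset.card_univ, nsmul_eq_mul, ← Finset.mul_sum]
    simp only [Fintype.card_prod, Fintype.card_fin, Nat.cast_mul]
    rw [inv_mul_cancel_left₀ hr]
  · ext ⟨⟨i, x⟩, u, p⟩ ⟨⟨j, y⟩, v, q⟩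
    rw [ForwardCode.choi_operation_apply, blockChoi_apply]
    have hGa : ∀ k, G k (u, x) (v, y) =
        ∑ w, ∑ w', S u w * star (S v w') * F k (w, x) (w', y) := by
      intro k
      rw [← hFG]
      simp only [Matrix.mul_apply, Matrix.kroneckerMap_apply, Matrix.conjTranspose_apply,
        Matrix.one_apply, Fintype.sum_prod_type (α₁ := a), mul_ite, ite_mul, mul_one, mul_zero,
        zero_mul, apply_ite star, star_zero, Finset.sum_ite_eq, Finset.mem_univ, if_true,
        Finset.sum_mul]
      rw [Finset.sum_comm]
      refine Finset.sum_congr rfl fun w _ => Finset.sum_congr rfl fun w' _ => ?_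
      ring
    simp only [choi_ofChoi, Matrix.submatrix_apply, g, hs, V, Matrix.of_apply,
      Equiv.symm_apply_apply, apply_ite star, star_zero, mul_ite, ite_mul, zero_mul, mul_zero,
      blockChoi_apply, Finset.sum_ite_irrel, Finset.sum_const_zero, Finset.sum_ite_eq',
      Finset.mem_univ, if_true, hGa, Finset.mul_sum]
    refine Eq.trans ?_ Finset.sum_comm
    refine Finset.sum_congr rfl fun w _ => ?_
    refine Eq.trans ?_ Finset.sum_comm
    refine Finset.sum_congr rfl fun w' _ => Finset.sum_congr rfl fun k _ => ?_
    ring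

end Construction

section Positivity

theorem ptSnd_epr (r : ℕ) : ptSnd (epr (Fin r)) = (r : ℂ)⁻¹ • flip (Fin r) := by
  rw [epr, ptSnd_smul, ptSnd_maxEnt, Fintype.card_fin]

/-- Positivity of an operator on the product of the partially transposed local states is checked
on the symmetric and the antisymmetric subspace. -/
theorem posSemidef_ptSnd_localState {n : Type*} [Fintype n] {r : ℕ} [NeZero r] {M₁ M₂ : Op n}
    (hr : r = 1 → M₂ = 0)
    (h : ∀ ε : ℂ, ε ^ 2 = 1 → ((1 + ε * r) • M₁ + M₂).PosSemidef) :
    (ptSnd (localState r true) ⊗ₖ M₁ + ptSnd (localState r false) ⊗ₖ M₂).PosSemidef := by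
  have hp := h 1 (by norm_num)
  have hm := h (-1) (by norm_num)
  by_cases hr1 : r = 1
  · subst hr1
    rw [hr rfl] at hp ⊢
    have h1 := hp.smul (show (0 : ℂ) ≤ 1 / 2 by positivity)
    have h2 : M₁.PosSemidef := by
      refine posSemidef_of_eq h1 ?_
      push_cast
      module
    have : ptSnd (localState 1 true) = 1 := by
      simp [localState, epr_eq_one, ptSnd_one]
    rw [this, Matrix.kroneckerMap_zero_right _ (fun _ => mul_zero _), add_zero]
    exact posSemidef_kronecker Matrix.PosSemidef.one h2
  · have hr0 : (r : ℂ) ≠ 0 := Nat.cast_ne_zero.2 (NeZero.ne r)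
    have h2 : 1 < r := by have := NeZero.ne r; omega
    have hrp : (0 : ℂ) < (r : ℂ) + 1 := by positivity
    have hrm : (0 : ℂ) < (r : ℂ) - 1 := by
      have : (0 : ℝ) < (r : ℝ) - 1 := by
        have : (1 : ℝ) < r := by exact_mod_cast h2
        linarith
      exact_mod_cast Complex.zero_lt_real.2 this
    have h0 : (0 : ℂ) ≤ r := by positivity
    have hsq : (r : ℂ) ^ 2 - 1 ≠ 0 := sq_sub_one_ne_zero hr1
    have k1 := (posSemidef_kronecker (one_add_flip_posSemidef (n := Fin r)) hp).smul
      (inv_nonneg.2 (mul_nonneg (mul_nonneg zero_le_two h0) hrp.le))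
    have k2 := (posSemidef_kronecker (one_sub_flip_posSemidef (n := Fin r)) hm).smul
      (inv_nonneg.2 (mul_nonneg (mul_nonneg zero_le_two h0) hrm.le))
    refine posSemidef_of_eq (k1.add k2) ?_
    have hrp' := hrp.ne'
    have hrm' := hrm.ne'
    simp only [localState, eprCompl, if_true, Bool.false_eq_true, if_false, ptSnd_smul, ptSnd_sub,
      ptSnd_one, ptSnd_epr]
    ext x y
    simp only [Matrix.add_apply, Matrix.smul_apply, Matrix.kroneckerMap_apply, Matrix.sub_apply,
      smul_eq_mul]
    have hfac : (r : ℂ) ^ 2 - 1 = (r + 1) * (r - 1) := by ring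
    rw [hfac]
    field_simp
    ring

variable {a b c : Type*} [Fintype a] [Fintype b] [Fintype c] {r₁ r₂ : ℕ}

theorem sum_blocks_eq (P : Bool → Op (Fin r₁ × Fin r₁)) (Q : Bool → Op (Fin r₂ × Fin r₂))
    (G : Bool × Bool → Op (a × b × c)) :
    ∑ k, ((r₁ : ℂ) * r₂) • (P k.1 ⊗ₖ (Q k.2 ⊗ₖ G k)) = ((r₁ : ℂ) * r₂) •
      (P true ⊗ₖ (Q true ⊗ₖ G (true, true) + Q false ⊗ₖ G (true, false)) +
        P false ⊗ₖ (Q true ⊗ₖ G (false, true) + Q false ⊗ₖ G (false, false))) := by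
  simp only [Fintype.sum_prod_type, Fintype.sum_bool, Matrix.kronecker_add, smul_add]

theorem ptB_blockChoi (G : Bool × Bool → Op (a × b × c)) : ptB (blockChoi r₁ r₂ G) =
    (∑ k, ((r₁ : ℂ) * r₂) • (ptSnd (localState r₁ k.1) ⊗ₖ (localState r₂ k.2 ⊗ₖ
      ptMid (G k)))).submatrix (regroup a b c r₁ r₂).symm (regroup a b c r₁ r₂).symm := by
  ext p q
  simp only [ptB, blockChoi, Matrix.submatrix_apply, Matrix.sum_apply, Matrix.smul_apply,
    smul_eq_mul, Matrix.kroneckerMap_apply, Matrix.of_apply]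
  rfl

theorem ptC_blockChoi (G : Bool × Bool → Op (a × b × c)) : ptC (blockChoi r₁ r₂ G) =
    (∑ k, ((r₁ : ℂ) * r₂) • (localState r₁ k.1 ⊗ₖ (ptSnd (localState r₂ k.2) ⊗ₖ
      ptLast (G k)))).submatrix (regroup a b c r₁ r₂).symm (regroup a b c r₁ r₂).symm := by
  ext p q
  simp only [ptC, blockChoi, Matrix.submatrix_apply, Matrix.sum_apply, Matrix.smul_apply,
    smul_eq_mul, Matrix.kroneckerMap_apply, Matrix.of_apply]
  rfl

theorem ptA_blockChoi (G : Bool × Bool → Op (a × b × c)) : ptA (blockChoi r₁ r₂ G) =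
    ((∑ k, ((r₁ : ℂ) * r₂) • (ptSnd (localState r₁ k.1) ⊗ₖ (ptSnd (localState r₂ k.2) ⊗ₖ
      ptSnd (G k)))).submatrix (regroup a b c r₁ r₂).symm (regroup a b c r₁ r₂).symm)ᵀ := by
  ext p q
  simp only [ptA, blockChoi, Matrix.submatrix_apply, Matrix.sum_apply, Matrix.smul_apply,
    smul_eq_mul, Matrix.kroneckerMap_apply, Matrix.of_apply, Matrix.transpose_apply]
  rfl

theorem compress_blockChoi (P : Op (Fin r₁ × Fin r₁)) (Q : Op (Fin r₂ × Fin r₂))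
    (G : Bool × Bool → Op (a × b × c)) : compress P Q (blockChoi r₁ r₂ G) =
      ∑ k, ((r₁ : ℂ) * r₂ * (P * localState r₁ k.1).trace * (Q * localState r₂ k.2).trace) •
        G k := by
  have h : (blockChoi r₁ r₂ G).submatrix (regroup a b c r₁ r₂) (regroup a b c r₁ r₂) =
      ∑ k, ((r₁ : ℂ) * r₂) • (localState r₁ k.1 ⊗ₖ (localState r₂ k.2 ⊗ₖ G k)) := by
    simp [blockChoi]
  rw [compress, h]
  simp only [Fintype.sum_prod_type, Fintype.sum_bool, wtr_add, wtr_smul, wtr_kronecker]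
  module

theorem trace_epr_mul_localState (r : ℕ) [NeZero r] (k : Bool) :
    (epr (Fin r) * localState r k).trace = if k then 1 else 0 := by
  cases k <;> simp [localState, eprCompl, mul_sub, epr_mul_epr, trace_epr]

/-- The four blocks with sums `E`, `X`, `Y` and `R`. -/
def blocks (R E X Y : Op (a × b × c)) : Bool × Bool → Op (a × b × c)
  | (true, true) => E
  | (true, false) => X - E
  | (false, true) => Y - E
  | (false, false) => R - X - Y + E

variable [DecidableEq b] [DecidableEq c]

theorem ppt_blockChoi [NeZero r₁] [NeZero r₂] {ρ : Op a} {E X Y : Op (a × b × c)}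
    (h : CoreData r₁ r₂ ρ E X Y) (hP : CorePPT r₁ r₂ ρ E X Y) :
    (ptA (blockChoi r₁ r₂ (blocks (ρ ⊗ₖ 1) E X Y))).PosSemidef ∧
    (ptB (blockChoi r₁ r₂ (blocks (ρ ⊗ₖ 1) E X Y))).PosSemidef ∧
    (ptC (blockChoi r₁ r₂ (blocks (ρ ⊗ₖ 1) E X Y))).PosSemidef := by
  have h0 : (0 : ℂ) ≤ (r₁ : ℂ) * r₂ := by positivity
  have hz : ∀ {m n : Type _} (A : Op m), A ⊗ₖ (0 : Op n) = 0 := fun A =>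
    Matrix.kroneckerMap_zero_right _ (fun _ => mul_zero _) _
  have e₁ : r₁ = 1 → Y - E = 0 ∧ ρ ⊗ₖ (1 : Op (b × c)) - X - Y + E = 0 := fun hr => by
    obtain ⟨rfl, rfl⟩ := h.left_trivial hr
    constructor <;> abel
  have e₂ : r₂ = 1 → X - E = 0 ∧ ρ ⊗ₖ (1 : Op (b × c)) - X - Y + E = 0 := fun hr => by
    obtain ⟨rfl, rfl⟩ := h.right_trivial hr
    constructor <;> abel
  have s0 : ptSnd (0 : Op (a × b × c)) = 0 := rfl
  have m0 : ptMid (0 : Op (a × b × c)) = 0 := rfl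
  have l0 : ptLast (0 : Op (a × b × c)) = 0 := rfl
  rw [ptA_blockChoi, ptB_blockChoi, ptC_blockChoi,
    sum_blocks_eq (fun k => ptSnd (localState r₁ k)) (fun k => ptSnd (localState r₂ k))
      (fun k => ptSnd (blocks (ρ ⊗ₖ 1) E X Y k)),
    sum_blocks_eq (fun k => ptSnd (localState r₁ k)) (localState r₂)
      (fun k => ptMid (blocks (ρ ⊗ₖ 1) E X Y k)),
    sum_blocks_eq (localState r₁) (fun k => ptSnd (localState r₂ k))
      (fun k => ptLast (blocks (ρ ⊗ₖ 1) E X Y k))]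
  simp only [blocks]
  refine ⟨(Matrix.PosSemidef.submatrix (Matrix.PosSemidef.smul
    (posSemidef_ptSnd_localState ?_ ?_) h0) _).transpose,
    Matrix.PosSemidef.submatrix (Matrix.PosSemidef.smul
      (posSemidef_ptSnd_localState ?_ ?_) h0) _,
    Matrix.PosSemidef.submatrix (Matrix.PosSemidef.smul (Matrix.PosSemidef.add
      (posSemidef_kronecker (localState_posSemidef r₁ true) (posSemidef_ptSnd_localState ?_ ?_))
      (posSemidef_kronecker (localState_posSemidef r₁ false)
        (posSemidef_ptSnd_localState ?_ ?_))) h0) _⟩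
  · intro hr
    rw [(e₁ hr).1, (e₁ hr).2, s0, hz, hz, add_zero]
  · intro ε hε
    have := posSemidef_ptSnd_localState (r := r₂)
      (M₁ := (1 + ε * r₁) • ptSnd E + ptSnd (Y - E))
      (M₂ := (1 + ε * r₁) • ptSnd (X - E) + ptSnd (ρ ⊗ₖ (1 : Op (b × c)) - X - Y + E))
      (fun hr => by rw [(e₂ hr).1, (e₂ hr).2, s0, smul_zero, add_zero])
      (fun δ hδ => by
        refine posSemidef_of_eq (hP.sender ε δ hε hδ) ?_
        simp only [ptSnd_sub, ptSnd_add, ptSnd_kronecker_one]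
        module)
    refine posSemidef_of_eq this ?_
    simp only [Matrix.kronecker_add, Matrix.kronecker_smul, smul_add]
    abel
  · intro hr
    rw [(e₁ hr).1, (e₁ hr).2, m0, hz, hz, add_zero]
  · intro ε hε
    have k₁ : ((1 + ε * r₁) • ptMid E + ptMid (Y - E)).PosSemidef := by
      refine posSemidef_of_eq (hP.bob_pos ε hε) ?_
      simp only [ptMid_sub]
      module
    have k₂ : ((1 + ε * r₁) • ptMid (X - E) +
        ptMid (ρ ⊗ₖ (1 : Op (b × c)) - X - Y + E)).PosSemidef := by
      refine posSemidef_of_eq (hP.bob_neg ε hε) ?_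
      simp only [ptMid_sub, ptMid_add, ptMid_kronecker_one]
      module
    refine posSemidef_of_eq ((posSemidef_kronecker (localState_posSemidef r₂ true) k₁).add
      (posSemidef_kronecker (localState_posSemidef r₂ false) k₂)) ?_
    simp only [Matrix.kronecker_add, Matrix.kronecker_smul, smul_add]
    abel
  · intro hr
    rw [(e₂ hr).1, l0]
  · intro ε hε
    refine posSemidef_of_eq (hP.charlie_pos ε hε) ?_
    simp only [ptLast_sub]
    module
  · intro hr
    rw [(e₂ hr).2, l0]
  · intro ε hε
    refine posSemidef_of_eq (hP.charlie_neg ε hε) ?_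
    simp only [ptLast_sub, ptLast_add, ptLast_kronecker_one]
    module

end Positivity

section Backward

variable {a b c : Type*} [Fintype a] [Fintype b] [Fintype c] [DecidableEq b] [DecidableEq c]
  {r₁ r₂ : ℕ}

theorem sum_fst_blockChoi [NeZero r₁] {G : Bool × Bool → Op (a × b × c)}
    (h₁ : r₁ = 1 → ∀ l, G (false, l) = 0) (i j : Fin r₁ × Fin r₂) (p q : Fin r₂) (x y : b × c)
    (u v : a) :
    ∑ k, blockChoi r₁ r₂ G ((i, x), (u, (k, p))) ((j, y), (v, (k, q))) =
      if i.1 = j.1 then ∑ l, (r₂ : ℂ) * (localState r₂ l (i.2, p) (j.2, q) *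
        (G (true, l) + G (false, l)) (u, x) (v, y)) else 0 := by
  have hr : (r₁ : ℂ) ≠ 0 := Nat.cast_ne_zero.2 (NeZero.ne r₁)
  simp only [blockChoi_apply]
  rw [Finset.sum_comm]
  have h : ∀ k : Bool × Bool, ∑ m : Fin r₁, ((r₁ : ℂ) * r₂) * (localState r₁ k.1 (i.1, m) (j.1, m) *
      (localState r₂ k.2 (i.2, p) (j.2, q) * G k (u, x) (v, y))) =
        if i.1 = j.1 then (r₂ : ℂ) * (localState r₂ k.2 (i.2, p) (j.2, q) * G k (u, x) (v, y))
        else 0 := by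
    rintro ⟨k, l⟩
    by_cases hk : r₁ = 1 ∧ k = false
    · simp [hk.2, h₁ hk.1]
    have hk' : r₁ = 1 → k = true := fun h => by simpa [h] using hk
    rw [← Finset.mul_sum, ← Finset.sum_mul, sum_localState r₁ hk']
    split_ifs
    · field_simp
    · simp
  simp only [h]
  split_ifs
  · rw [Fintype.sum_prod_type, Finset.sum_comm]
    simp only [Fintype.sum_bool, Matrix.add_apply]
    ring
  · simp

theorem sum_snd_blockChoi [NeZero r₂] {G : Bool × Bool → Op (a × b × c)}
    (h₂ : r₂ = 1 → ∀ l, G (l, false) = 0) (i j : Fin r₁ × Fin r₂) (p q : Fin r₁) (x y : b × c)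
    (u v : a) :
    ∑ k, blockChoi r₁ r₂ G ((i, x), (u, (p, k))) ((j, y), (v, (q, k))) =
      if i.2 = j.2 then ∑ l, (r₁ : ℂ) * (localState r₁ l (i.1, p) (j.1, q) *
        (G (l, true) + G (l, false)) (u, x) (v, y)) else 0 := by
  have hr : (r₂ : ℂ) ≠ 0 := Nat.cast_ne_zero.2 (NeZero.ne r₂)
  simp only [blockChoi_apply]
  rw [Finset.sum_comm]
  have h : ∀ k : Bool × Bool, ∑ m : Fin r₂, ((r₁ : ℂ) * r₂) * (localState r₁ k.1 (i.1, p) (j.1, q) *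
      (localState r₂ k.2 (i.2, m) (j.2, m) * G k (u, x) (v, y))) =
        if i.2 = j.2 then (r₁ : ℂ) * (localState r₁ k.1 (i.1, p) (j.1, q) * G k (u, x) (v, y))
        else 0 := by
    rintro ⟨l, k⟩
    by_cases hk : r₂ = 1 ∧ k = false
    · simp [hk.2, h₂ hk.1]
    have hk' : r₂ = 1 → k = true := fun h => by simpa [h] using hk
    rw [← Finset.mul_sum, ← Finset.mul_sum, ← Finset.sum_mul, sum_localState r₂ hk']
    split_ifs
    · field_simp
    · simp
  simp only [h]
  split_ifs
  · rw [Fintype.sum_prod_type]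
    simp only [Fintype.sum_bool, Matrix.add_apply]
    ring
  · simp

theorem trFst_add {α γ : Type*} [Fintype α] (X Y : Op (α × γ)) :
    trFst (X + Y) = trFst X + trFst Y := (trFstMap α γ).map_add X Y

theorem trFst_sub {α γ : Type*} [Fintype α] (X Y : Op (α × γ)) :
    trFst (X - Y) = trFst X - trFst Y := (trFstMap α γ).map_sub X Y

theorem trFst_kronecker_one {α γ : Type*} [Fintype α] [DecidableEq γ] {ρ : Op α}
    (hρ : ρ.trace = 1) : trFst (ρ ⊗ₖ (1 : Op γ)) = 1 := by
  ext x y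
  change ∑ i, ρ i i * (1 : Op γ) x y = _
  rw [← Finset.sum_mul, show ∑ i, ρ i i = 1 from hρ, one_mul]

/-- The weight of the local state `k` in the identity. -/
def localWeight (r : ℕ) (k : Bool) : ℂ := if k then 1 else (r : ℂ) ^ 2 - 1

theorem sum_localWeight_smul (r : ℕ) [NeZero r] :
    ∑ k, localWeight r k • localState r k = 1 := by
  simp only [Fintype.sum_bool, localWeight, localState, eprCompl, if_true, Bool.false_eq_true,
    if_false, one_smul, smul_smul]
  by_cases hr : r = 1
  · subst hr
    simp [epr_eq_one]
  · rw [mul_inv_cancel₀ (sq_sub_one_ne_zero hr), one_smul, add_sub_cancel]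

theorem trFst_blocks [NeZero r₁] [NeZero r₂] {ρ : Op a} {E X Y : Op (a × b × c)}
    (hρ : ρ.trace = 1) (h : CoreMarginals r₁ r₂ E X Y) (k : Bool × Bool) :
    trFst (blocks (ρ ⊗ₖ (1 : Op (b × c))) E X Y k) = (1 / ((r₁ : ℂ) ^ 2 * (r₂ : ℂ) ^ 2) *
      (localWeight r₁ k.1 * localWeight r₂ k.2)) • (1 : Op (b × c)) := by
  have hr₁ : (r₁ : ℂ) ≠ 0 := Nat.cast_ne_zero.2 (NeZero.ne r₁)
  have hr₂ : (r₂ : ℂ) ≠ 0 := Nat.cast_ne_zero.2 (NeZero.ne r₂)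
  rcases k with ⟨_ | _, _ | _⟩ <;>
    simp only [blocks, trFst_sub, trFst_add, trFst_kronecker_one hρ, h.both, h.left, h.right,
      localWeight, if_true, Bool.false_eq_true, if_false]
  · match_scalars
    field_simp
    ring
  · match_scalars
    field_simp
  · match_scalars
    field_simp
  · match_scalars
    field_simp

theorem sum_sender_blockChoi [NeZero r₁] [NeZero r₂] {ρ : Op a} {E X Y : Op (a × b × c)}
    (hρ : ρ.trace = 1) (h : CoreMarginals r₁ r₂ E X Y) (i j p q : Fin r₁ × Fin r₂)
    (x y : b × c) :
    ∑ u, blockChoi r₁ r₂ (blocks (ρ ⊗ₖ (1 : Op (b × c))) E X Y) ((i, x), (u, p)) ((j, y), (u, q)) =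
      if i = j then (((r₁ : ℂ) * r₂)⁻¹ • (1 : Op ((b × c) × (Fin r₁ × Fin r₂)))) (x, p) (y, q)
      else 0 := by
  have hr₁ : (r₁ : ℂ) ≠ 0 := Nat.cast_ne_zero.2 (NeZero.ne r₁)
  have hr₂ : (r₂ : ℂ) ≠ 0 := Nat.cast_ne_zero.2 (NeZero.ne r₂)
  have ht : ∀ k, ∑ u, blocks (ρ ⊗ₖ (1 : Op (b × c))) E X Y k (u, x) (u, y) =
      1 / ((r₁ : ℂ) ^ 2 * (r₂ : ℂ) ^ 2) * (localWeight r₁ k.1 * localWeight r₂ k.2) *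
        (1 : Op (b × c)) x y := fun k => congrFun₂ (trFst_blocks hρ h k) x y
  have w₁ := congrFun₂ (sum_localWeight_smul r₁) (i.1, p.1) (j.1, q.1)
  have w₂ := congrFun₂ (sum_localWeight_smul r₂) (i.2, p.2) (j.2, q.2)
  simp only [Matrix.sum_apply, Matrix.smul_apply, smul_eq_mul] at w₁ w₂
  simp only [blockChoi_apply]
  rw [Finset.sum_comm]
  simp only [← Finset.mul_sum, ht]
  calc _ = ((r₁ : ℂ) * r₂)⁻¹ * (1 : Op (b × c)) x y *
        ((∑ k, localWeight r₁ k * localState r₁ k (i.1, p.1) (j.1, q.1)) *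
          ∑ k, localWeight r₂ k * localState r₂ k (i.2, p.2) (j.2, q.2)) := by
        simp only [Fintype.sum_prod_type, Fintype.sum_bool]
        field_simp
    _ = _ := by
        rw [w₁, w₂]
        simp only [Matrix.one_apply, Matrix.smul_apply, smul_eq_mul, Prod.ext_iff]
        by_cases h1 : i.1 = j.1 <;> by_cases h2 : i.2 = j.2 <;> by_cases h3 : p.1 = q.1 <;>
          by_cases h4 : p.2 = q.2 <;> simp [h1, h2, h3, h4]

theorem exists_code_of_coreData [DecidableEq a] [Nonempty b] [Nonempty c] [NeZero r₁] [NeZero r₂]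
    (N : Op a →ₗ[ℂ] Op (b × c)) {ρ : Op a} {f : ℝ} {E X Y : Op (a × b × c)}
    (h : CoreData r₁ r₂ ρ E X Y) (hf : (f : ℂ) = (E * (choi N)ᵀ).trace) :
    ∃ K : ForwardCode a b c r₁ r₂, K.Attains N ρ f ∧
      (CoreMarginals r₁ r₂ E X Y → NoSignalA K.operation) ∧
      (Y = padMid (trMid Y) → NoSignalB K.operation) ∧
      (X = padLast (trLast X) → NoSignalC K.operation) ∧
      (CorePPT r₁ r₂ ρ E X Y → IsPPT K.operation) := by
  have hr₁ : (r₁ : ℂ) ≠ 0 := Nat.cast_ne_zero.2 (NeZero.ne r₁)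
  have hr₂ : (r₂ : ℂ) ≠ 0 := Nat.cast_ne_zero.2 (NeZero.ne r₂)
  have e₁ : r₁ = 1 → ∀ l, blocks (ρ ⊗ₖ (1 : Op (b × c))) E X Y (false, l) = 0 := fun hr l => by
    obtain ⟨rfl, rfl⟩ := h.left_trivial hr
    cases l <;> simp [blocks]
  have e₂ : r₂ = 1 → ∀ l, blocks (ρ ⊗ₖ (1 : Op (b × c))) E X Y (l, false) = 0 := fun hr l => by
    obtain ⟨rfl, rfl⟩ := h.right_trivial hr
    cases l <;> simp [blocks]
  obtain ⟨K, hK, hJ⟩ := exists_code_of_blocks h.density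
    (G := blocks (ρ ⊗ₖ (1 : Op (b × c))) E X Y)
    (by
      rintro ⟨_ | _, _ | _⟩
      exacts [h.pos_none, h.pos_right, h.pos_left, h.pos_both])
    (by
      simp only [Fintype.sum_prod_type, Fintype.sum_bool, blocks]
      abel) e₁ e₂
  have : Nonempty (Fin r₁ × Fin r₂) := inferInstance
  refine ⟨K, ⟨hK, ?_⟩, fun hA => ?_, fun hB => ?_, fun hC => ?_, fun hP => ?_⟩
  · rw [K.channelFidelity_induced, hJ, compress_blockChoi, hf]
    congr 2
    simp only [Fintype.sum_prod_type, Fintype.sum_bool, trace_epr_mul_localState, if_true,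
      Bool.false_eq_true, if_false, mul_one, mul_zero, zero_smul, add_zero, smul_smul, blocks]
    rw [inv_mul_cancel₀ (mul_ne_zero hr₁ hr₂), one_smul]
  · refine noSignalA_of_sum_choi K.isChannel_operation
      (L := ((r₁ : ℂ) * r₂)⁻¹ • (1 : Op ((b × c) × (Fin r₁ × Fin r₂)))) ?_
    intro i j x y p q
    rw [hJ]
    exact sum_sender_blockChoi h.density.2 hA i j p q x y
  · refine noSignalB_of_sum_choi K.isChannel_operation
      (L := Matrix.of fun s t => if s.1.1.1 = t.1.1.1 then (r₂ : ℂ) *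
        (localState r₂ true (s.1.1.2, s.2.2) (t.1.1.2, t.2.2) *
          (trMid Y (s.2.1, s.1.2) (t.2.1, t.1.2) / Fintype.card b) +
        localState r₂ false (s.1.1.2, s.2.2) (t.1.1.2, t.2.2) *
          (ρ s.2.1 t.2.1 * (1 : Op c) s.1.2 t.1.2 -
            trMid Y (s.2.1, s.1.2) (t.2.1, t.1.2) / Fintype.card b)) else 0) ?_
    rintro y z ⟨i, x⟩ ⟨j, w⟩ ⟨u, p⟩ ⟨v, q⟩
    rw [hJ]
    refine (sum_fst_blockChoi e₁ i j p q (y, x) (z, w) u v).trans ?_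
    have hY : Y (u, y, x) (v, z, w) = if y = z then trMid Y (u, x) (v, w) / Fintype.card b
        else 0 := congrFun₂ hB (u, y, x) (v, z, w)
    simp only [Fintype.sum_bool, blocks, Matrix.of_apply, Matrix.add_apply, Matrix.sub_apply,
      Matrix.kroneckerMap_apply, hY, Matrix.one_apply, Prod.mk.injEq]
    by_cases h1 : y = z <;> by_cases h2 : i.1 = j.1 <;>
      simp only [h1, h2, if_true, if_false, true_and, false_and] <;> ring
  · refine noSignalC_of_sum_choi K.isChannel_operation
      (L := Matrix.of fun s t => if s.1.1.2 = t.1.1.2 then (r₁ : ℂ) *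
        (localState r₁ true (s.1.1.1, s.2.2) (t.1.1.1, t.2.2) *
          (trLast X (s.2.1, s.1.2) (t.2.1, t.1.2) / Fintype.card c) +
        localState r₁ false (s.1.1.1, s.2.2) (t.1.1.1, t.2.2) *
          (ρ s.2.1 t.2.1 * (1 : Op b) s.1.2 t.1.2 -
            trLast X (s.2.1, s.1.2) (t.2.1, t.1.2) / Fintype.card c)) else 0) ?_
    rintro y z ⟨i, x⟩ ⟨j, w⟩ ⟨u, p⟩ ⟨v, q⟩
    rw [hJ]
    refine (sum_snd_blockChoi e₂ i j p q (x, y) (w, z) u v).trans ?_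
    have hX : X (u, x, y) (v, w, z) = if y = z then trLast X (u, x) (v, w) / Fintype.card c
        else 0 := congrFun₂ hC (u, x, y) (v, w, z)
    simp only [Fintype.sum_bool, blocks, Matrix.of_apply, Matrix.add_apply, Matrix.sub_apply,
      Matrix.kroneckerMap_apply, hX, Matrix.one_apply, Prod.mk.injEq]
    by_cases h1 : y = z <;> by_cases h2 : i.2 = j.2 <;>
      simp only [h1, h2, if_true, if_false, and_true, and_false] <;> ring
  · rw [IsPPT, hJ]
    exact ppt_blockChoi h hP

end Backward

section Reduction

theorem forall_sign {p : ℂ → Prop} : (∀ ε : ℂ, ε ^ 2 = 1 → p ε) ↔ p 1 ∧ p (-1) := by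
  refine ⟨fun h => ⟨h 1 (by norm_num), h (-1) (by norm_num)⟩, fun h ε hε => ?_⟩
  rcases mul_self_eq_one_iff.1 (sq ε ▸ hε) with rfl | rfl
  exacts [h.1, h.2]

theorem forall_sign₂ {p : ℂ → ℂ → Prop} : (∀ ε δ : ℂ, ε ^ 2 = 1 → δ ^ 2 = 1 → p ε δ) ↔
    (p 1 1 ∧ p 1 (-1)) ∧ p (-1) 1 ∧ p (-1) (-1) := by
  rw [← forall_sign (p := fun ε => p ε 1 ∧ p ε (-1))]
  exact forall_congr' fun ε => by
    rw [← forall_sign (p := p ε)]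
    exact ⟨fun h hε δ hδ => h δ hε hδ, fun h δ hε hδ => h hε δ hδ⟩

theorem absLE_iff {n : Type*} [Fintype n] {X Y : Op n} :
    AbsLE X Y ↔ (Y + X).PosSemidef ∧ (Y - X).PosSemidef := by
  rw [AbsLE, Matrix.le_iff, Matrix.le_iff, sub_neg_eq_add, add_comm]

section PartialTransposes

variable {α β γ : Type*}

theorem ptSnd_eq_ptMid_ptLast (X : Op (α × β × γ)) : ptSnd X = ptMid (ptLast X) := rfl

theorem ptSnd_eq_ptLast_ptMid (X : Op (α × β × γ)) : ptSnd X = ptLast (ptMid X) := rfl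

theorem ptLast_padLast [Fintype γ] [DecidableEq γ] (S : Op (α × β)) :
    ptLast (padLast S : Op (α × β × γ)) = padLast S := by
  ext x y
  simp [ptLast, padLast, eq_comm]

theorem ptMid_padMid [Fintype β] [DecidableEq β] (S : Op (α × γ)) :
    ptMid (padMid S : Op (α × β × γ)) = padMid S := by
  ext x y
  simp [ptMid, padMid, eq_comm]

end PartialTransposes

variable {a b c : Type*} [Fintype a] [Fintype b] [Fintype c] [DecidableEq b] [DecidableEq c]
  {r₁ r₂ : ℕ}

theorem opBT_eq_ptMid [DecidableEq a] (r : ℕ) (E : Op (a × b × c)) (E₂ : Op (a × b)) :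
    opBT r E E₂ = ptMid (opB r E E₂) := rfl

theorem opCT_eq_ptLast [DecidableEq a] (r : ℕ) (E : Op (a × b × c)) (E₃ : Op (a × c)) :
    opCT r E E₃ = ptLast (opC r E E₃) := rfl

theorem pptConstraints_iff [DecidableEq a] [NeZero r₁] [NeZero r₂] {ρ : Op a}
    {E : Op (a × b × c)} {E₂ : Op (a × b)} {E₃ : Op (a × c)} :
    PPTConstraints r₁ r₂ ρ E E₂ E₃ ↔ CorePPT r₁ r₂ ρ E (opB r₂ E E₂) (opC r₁ E E₃) := by
  have hr₁ : (r₁ : ℂ) ≠ 0 := Nat.cast_ne_zero.2 (NeZero.ne r₁)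
  have hr₂ : (r₂ : ℂ) ≠ 0 := Nat.cast_ne_zero.2 (NeZero.ne r₂)
  have p₁ : (0 : ℂ) ≤ r₁ := by positivity
  have p₂ : (0 : ℂ) ≤ r₂ := by positivity
  have p₃ : (0 : ℂ) ≤ (r₁ : ℂ) * r₂ := by positivity
  have q₁ : (0 : ℂ) ≤ 1 / (r₁ : ℂ) := by positivity
  have q₂ : (0 : ℂ) ≤ 1 / (r₂ : ℂ) := by positivity
  have q₃ : (0 : ℂ) ≤ 1 / ((r₁ : ℂ) * r₂) := by positivity
  have hX : ptLast (opB r₂ E E₂) = opB r₂ E E₂ := ptLast_padLast _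
  have hY : ptMid (opC r₁ E E₃) = opC r₁ E E₃ := ptMid_padMid _
  have hX' : ptSnd (opB r₂ E E₂) = ptMid (opB r₂ E E₂) := by rw [ptSnd_eq_ptMid_ptLast, hX]
  have hY' : ptSnd (opC r₁ E E₃) = ptLast (opC r₁ E E₃) := by rw [ptSnd_eq_ptLast_ptMid, hY]
  rw [PPTConstraints, opBT_eq_ptMid, opCT_eq_ptLast]
  simp only [absLE_iff]
  constructor
  · rintro ⟨⟨a1, a2⟩, ⟨b1, b2⟩, ⟨c1, c2⟩, ⟨d1, d2⟩, ⟨e1, e2⟩, ⟨f1, f2⟩⟩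
    constructor
    · rw [forall_sign₂, hX', hY']
      refine ⟨⟨posSemidef_of_eq (a1.smul p₃) ?_, posSemidef_of_eq (b1.smul p₃) ?_⟩,
        posSemidef_of_eq (b2.smul p₃) ?_, posSemidef_of_eq (a2.smul p₃) ?_⟩ <;>
      · match_scalars <;> field_simp
    · rw [forall_sign, hY]
      refine ⟨posSemidef_of_eq (c1.smul p₁) ?_, posSemidef_of_eq (c2.smul p₁) ?_⟩ <;>
      · match_scalars <;> field_simp
    · rw [forall_sign, hY]
      refine ⟨posSemidef_of_eq d1 ?_, posSemidef_of_eq d2 ?_⟩ <;> module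
    · rw [forall_sign, hX]
      refine ⟨posSemidef_of_eq (e1.smul p₂) ?_, posSemidef_of_eq (e2.smul p₂) ?_⟩ <;>
      · match_scalars <;> field_simp
    · rw [forall_sign, hX]
      refine ⟨posSemidef_of_eq f1 ?_, posSemidef_of_eq f2 ?_⟩ <;> module
  · rintro ⟨ha, hc, hd, he, hf⟩
    rw [forall_sign₂, hX', hY'] at ha
    rw [forall_sign, hY] at hc hd
    rw [forall_sign, hX] at he hf
    obtain ⟨⟨a1, b1⟩, b2, a2⟩ := ha
    refine ⟨⟨posSemidef_of_eq (a1.smul q₃) ?_, posSemidef_of_eq (a2.smul q₃) ?_⟩,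
      ⟨posSemidef_of_eq (b1.smul q₃) ?_, posSemidef_of_eq (b2.smul q₃) ?_⟩,
      ⟨posSemidef_of_eq (hc.1.smul q₁) ?_, posSemidef_of_eq (hc.2.smul q₁) ?_⟩,
      ⟨posSemidef_of_eq hd.1 ?_, posSemidef_of_eq hd.2 ?_⟩,
      ⟨posSemidef_of_eq (he.1.smul q₂) ?_, posSemidef_of_eq (he.2.smul q₂) ?_⟩,
      ⟨posSemidef_of_eq hf.1 ?_, posSemidef_of_eq hf.2 ?_⟩⟩ <;>
    · match_scalars <;> field_simp

/-- The constraints on `E`, `X`, `Y` short of the equalities that hold when `r₁ = 1` or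
`r₂ = 1`. -/
structure PreCore (r₁ r₂ : ℕ) (ρ : Op a) (E X Y : Op (a × b × c)) : Prop where
  density : IsDensity ρ
  pos_both : E.PosSemidef
  pos_left : (X - E).PosSemidef
  pos_right : (Y - E).PosSemidef
  pos_none : (ρ ⊗ₖ (1 : Op (b × c)) - X - Y + E).PosSemidef
  left_trivial : r₁ = 1 → Y = E
  right_trivial : r₂ = 1 → X = E

/-- When one of the messages is trivial, the missing part of the identity can be added without
affecting the PPT conditions. -/
theorem PreCore.exists_completion {ρ : Op a} {E X Y : Op (a × b × c)}
    (h : PreCore r₁ r₂ ρ E X Y) (hr : 1 < r₁ * r₂) (hP : CorePPT r₁ r₂ ρ E X Y) :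
    ∃ X' Y', CoreData r₁ r₂ ρ E X' Y' ∧ CorePPT r₁ r₂ ρ E X' Y' ∧
      (X' = X ∨ X' = ρ ⊗ₖ (1 : Op (b × c))) ∧ (Y' = Y ∨ Y' = ρ ⊗ₖ (1 : Op (b × c))) := by
  set R := ρ ⊗ₖ (1 : Op (b × c)) with hR
  have zero_of {M : Op (a × b × c)} (hM : M = 0) : M.PosSemidef := hM ▸ Matrix.PosSemidef.zero
  by_cases h₁ : r₁ = 1
  · subst h₁
    obtain rfl := h.left_trivial rfl
    have h₂ : r₂ ≠ 1 := by rintro rfl; simp at hr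
    refine ⟨R, Y, ⟨h.density, h.pos_both, ?_, h.pos_right, zero_of ?_, fun _ => ⟨rfl, rfl⟩,
      fun h' => absurd h' h₂⟩, ?_, Or.inr rfl, Or.inl rfl⟩
    · refine posSemidef_of_eq (h.pos_none.add h.pos_left) ?_
      abel
    · abel
    · obtain ⟨ha, hb, hb', hc, hc'⟩ := hP
      rw [forall_sign₂] at ha
      rw [forall_sign] at hb hb' hc hc'
      constructor
      · rw [forall_sign₂, ptSnd_kronecker_one]
        refine ⟨⟨posSemidef_of_eq (ha.1.1.add ha.2.1) ?_, posSemidef_of_eq (ha.1.2.add ha.2.2) ?_⟩,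
          zero_of ?_, zero_of ?_⟩ <;>
        · push_cast; module
      · rw [forall_sign]
        exact hb
      · rw [forall_sign, ptMid_kronecker_one]
        refine ⟨posSemidef_of_eq (hb'.1.add hb'.2) ?_, zero_of ?_⟩ <;>
        · push_cast; module
      · rw [forall_sign, ptLast_kronecker_one]
        refine ⟨posSemidef_of_eq (hc.1.add hc'.1) ?_, posSemidef_of_eq (hc.2.add hc'.1) ?_⟩ <;>
        module
      · rw [forall_sign, ptLast_kronecker_one]
        refine ⟨zero_of ?_, zero_of ?_⟩ <;> module
  by_cases h₂ : r₂ = 1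
  · subst h₂
    obtain rfl := h.right_trivial rfl
    refine ⟨X, R, ⟨h.density, h.pos_both, h.pos_left, ?_, zero_of ?_, fun h' => absurd h' h₁,
      fun _ => ⟨rfl, rfl⟩⟩, ?_, Or.inl rfl, Or.inr rfl⟩
    · refine posSemidef_of_eq (h.pos_none.add h.pos_right) ?_
      abel
    · abel
    · obtain ⟨ha, hb, hb', hc, hc'⟩ := hP
      rw [forall_sign₂] at ha
      rw [forall_sign] at hb hb' hc hc'
      constructor
      · rw [forall_sign₂, ptSnd_kronecker_one]
        refine ⟨⟨posSemidef_of_eq (ha.1.1.add ha.1.2) ?_, zero_of ?_⟩,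
          posSemidef_of_eq (ha.2.1.add ha.2.2) ?_, zero_of ?_⟩ <;>
        · push_cast; module
      · rw [forall_sign, ptMid_kronecker_one]
        refine ⟨posSemidef_of_eq (hb.1.add hb'.1) ?_, posSemidef_of_eq (hb.2.add hb'.1) ?_⟩ <;>
        module
      · rw [forall_sign, ptMid_kronecker_one]
        refine ⟨zero_of ?_, zero_of ?_⟩ <;> module
      · rw [forall_sign]
        exact hc
      · rw [forall_sign, ptLast_kronecker_one]
        refine ⟨posSemidef_of_eq (hc'.1.add hc'.2) ?_, zero_of ?_⟩ <;>
        · push_cast; module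
  exact ⟨X, Y, ⟨h.density, h.pos_both, h.pos_left, h.pos_right, h.pos_none,
    fun h' => absurd h' h₁, fun h' => absurd h' h₂⟩, hP, Or.inl rfl, Or.inl rfl⟩

end Reduction

section ReducedOperators

variable {a b c : Type*} [Fintype a] [Fintype b] [Fintype c] [DecidableEq a] [DecidableEq b]
  [DecidableEq c] {r₁ r₂ : ℕ}

theorem eq_of_posSemidef_sub {n : Type*} [Fintype n] {X Y : Op n} (h : (X - Y).PosSemidef)
    (ht : X.trace = Y.trace) : X = Y :=
  sub_eq_zero.1 (h.trace_eq_zero_iff.1 (by rw [Matrix.trace_sub, ht, sub_self]))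

theorem trace_trFst {α γ : Type*} [Fintype α] [Fintype γ] (X : Op (α × γ)) :
    (trFst X).trace = X.trace := isChannel_trFstMap.2 X

theorem trace_padMid_trMid [Nonempty b] (X : Op (a × b × c)) :
    (padMid (trMid X) : Op (a × b × c)).trace = X.trace :=
  (isChannel_padMidMap.2 _).trans (isChannel_trMidMap.2 X)

theorem trace_padLast_trLast [Nonempty c] (X : Op (a × b × c)) :
    (padLast (trLast X) : Op (a × b × c)).trace = X.trace :=
  (isChannel_padLastMap.2 _).trans (isChannel_trLastMap.2 X)

theorem opC_one [Nonempty b] {E : Op (a × b × c)} {E₃ : Op (a × c)}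
    (h : (opC 1 E E₃ - E).PosSemidef) : opC 1 E E₃ = E := by
  have e : opC 1 E E₃ = padMid (trMid E) := by simp [opC]
  rw [e] at h ⊢
  exact eq_of_posSemidef_sub h (trace_padMid_trMid E)

theorem opB_one [Nonempty c] {E : Op (a × b × c)} {E₂ : Op (a × b)}
    (h : (opB 1 E E₂ - E).PosSemidef) : opB 1 E E₂ = E := by
  have e : opB 1 E E₂ = padLast (trLast E) := by simp [opB]
  rw [e] at h ⊢
  exact eq_of_posSemidef_sub h (trace_padLast_trLast E)

theorem opC_eq_padMid_trMid [Nonempty b] (r : ℕ) (E : Op (a × b × c)) (E₃ : Op (a × c)) :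
    opC r E E₃ = padMid (trMid (opC r E E₃)) := by
  rw [opC, trMid_padMid]

theorem opB_eq_padLast_trLast [Nonempty c] (r : ℕ) (E : Op (a × b × c)) (E₂ : Op (a × b)) :
    opB r E E₂ = padLast (trLast (opB r E E₂)) := by
  rw [opB, trLast_padLast]

theorem kronecker_one_eq_padMid [Nonempty b] (ρ : Op a) :
    ρ ⊗ₖ (1 : Op (b × c)) = padMid (trMid (ρ ⊗ₖ (1 : Op (b × c)))) := by
  refine eq_padMid_trMid (M := ρ ⊗ₖ (1 : Op c)) fun x y => ?_
  by_cases h : x.2.1 = y.2.1 <;> simp [Matrix.one_apply, Prod.ext_iff, h]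

theorem kronecker_one_eq_padLast [Nonempty c] (ρ : Op a) :
    ρ ⊗ₖ (1 : Op (b × c)) = padLast (trLast (ρ ⊗ₖ (1 : Op (b × c)))) := by
  refine eq_padLast_trLast (M := ρ ⊗ₖ (1 : Op b)) fun x y => ?_
  by_cases h : x.2.2 = y.2.2 <;> simp [Matrix.one_apply, Prod.ext_iff, h]

theorem trFst_padMid [Nonempty b] {S : Op (a × c)} {t : ℂ} (h : trFst S = t • (1 : Op c)) :
    trFst (padMid S : Op (a × b × c)) = (t / Fintype.card b) • (1 : Op (b × c)) := by
  ext y z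
  have h' : ∑ u, S (u, y.2) (u, z.2) = t * (1 : Op c) y.2 z.2 := congrFun₂ h y.2 z.2
  by_cases h1 : y.1 = z.1
  · simp only [trFst, padMid, Matrix.of_apply, h1, if_true, ← Finset.sum_div, h',
      Matrix.smul_apply, smul_eq_mul, Matrix.one_apply, Prod.ext_iff, true_and]
    ring
  · simp [trFst, padMid, h1, Matrix.one_apply, Prod.ext_iff]

theorem trFst_padLast [Nonempty c] {S : Op (a × b)} {t : ℂ} (h : trFst S = t • (1 : Op b)) :
    trFst (padLast S : Op (a × b × c)) = (t / Fintype.card c) • (1 : Op (b × c)) := by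
  ext y z
  have h' : ∑ u, S (u, y.1) (u, z.1) = t * (1 : Op b) y.1 z.1 := congrFun₂ h y.1 z.1
  by_cases h1 : y.2 = z.2
  · simp only [trFst, padLast, Matrix.of_apply, h1, if_true, ← Finset.sum_div, h',
      Matrix.smul_apply, smul_eq_mul, Matrix.one_apply, Prod.ext_iff, and_true]
    ring
  · simp [trFst, padLast, h1, Matrix.one_apply, Prod.ext_iff]

theorem trFst_trMid {E : Op (a × b × c)} {t : ℂ} (h : trFst E = t • (1 : Op (b × c))) :
    trFst (trMid E) = (Fintype.card b * t) • (1 : Op c) := by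
  ext y z
  have h' : ∀ k, ∑ u, E (u, k, y) (u, k, z) = t * (1 : Op c) y z := fun k =>
    (congrFun₂ h (k, y) (k, z)).trans (by simp [Matrix.one_apply])
  simp only [trFst, trMid, Matrix.of_apply]
  rw [Finset.sum_comm]
  simp [h', mul_assoc]

theorem trFst_trLast {E : Op (a × b × c)} {t : ℂ} (h : trFst E = t • (1 : Op (b × c))) :
    trFst (trLast E) = (Fintype.card c * t) • (1 : Op b) := by
  ext y z
  have h' : ∀ k, ∑ u, E (u, y, k) (u, z, k) = t * (1 : Op b) y z := fun k =>
    (congrFun₂ h (y, k) (z, k)).trans (by simp [Matrix.one_apply])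
  simp only [trFst, trLast, Matrix.of_apply]
  rw [Finset.sum_comm]
  simp [h', mul_assoc]

theorem MarginalConstraints.coreMarginals [Nonempty b] [Nonempty c] [NeZero r₁] [NeZero r₂]
    {E : Op (a × b × c)} {E₂ : Op (a × b)} {E₃ : Op (a × c)}
    (h : MarginalConstraints r₁ r₂ E E₂ E₃) :
    CoreMarginals r₁ r₂ E (opB r₂ E E₂) (opC r₁ E E₃) := by
  have hr₁ : (r₁ : ℂ) ≠ 0 := Nat.cast_ne_zero.2 (NeZero.ne r₁)
  have hr₂ : (r₂ : ℂ) ≠ 0 := Nat.cast_ne_zero.2 (NeZero.ne r₂)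
  have hb : (Fintype.card b : ℂ) ≠ 0 := by simp
  have hc : (Fintype.card c : ℂ) ≠ 0 := by simp
  obtain ⟨h₁, h₃, h₂⟩ := h
  refine ⟨h₁, ?_, ?_⟩
  · rw [opB, trFst_padLast (t := (Fintype.card c : ℂ) / (r₁ : ℂ) ^ 2)]
    · congr 1
      field_simp
    · rw [trFst_add, trFst_smul, trFst_trLast h₁, h₂]
      match_scalars
      field_simp
      ring
  · rw [opC, trFst_padMid (t := (Fintype.card b : ℂ) / (r₂ : ℂ) ^ 2)]
    · congr 1
      field_simp
    · rw [trFst_add, trFst_smul, trFst_trMid h₁, h₃]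
      match_scalars
      field_simp
      ring

theorem exists_opC_eq [Nonempty b] [NeZero r₁] [NeZero r₂] {ρ : Op a} {E X Y : Op (a × b × c)}
    (h : CoreData r₁ r₂ ρ E X Y) (hY : Y = padMid (trMid Y)) :
    ∃ E₃ : Op (a × c), opC r₁ E E₃ = Y ∧ (CoreMarginals r₁ r₂ E X Y →
      trFst E₃ = ((Fintype.card b : ℂ) / ((r₁ : ℂ) ^ 2 * (r₂ : ℂ) ^ 2)) • (1 : Op c)) := by
  have hr₁ : (r₁ : ℂ) ≠ 0 := Nat.cast_ne_zero.2 (NeZero.ne r₁)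
  have hr₂ : (r₂ : ℂ) ≠ 0 := Nat.cast_ne_zero.2 (NeZero.ne r₂)
  by_cases hr : r₁ = 1
  · refine ⟨((Fintype.card b : ℂ) / ((r₁ : ℂ) ^ 2 * (r₂ : ℂ) ^ 2)) • (ρ ⊗ₖ (1 : Op c)), ?_,
      fun _ => ?_⟩
    · subst hr
      obtain ⟨-, rfl⟩ := h.left_trivial rfl
      simpa [opC] using hY.symm
    · rw [trFst_smul, trFst_kronecker_one h.density.2]
  · have hs := sq_sub_one_ne_zero hr
    refine ⟨((r₁ : ℂ) ^ 2 - 1)⁻¹ • (trMid Y - trMid E), ?_, fun hm => ?_⟩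
    · rw [opC, smul_smul, mul_inv_cancel₀ hs, one_smul, add_sub_cancel, ← hY]
    · rw [trFst_smul, trFst_sub, trFst_trMid hm.both, trFst_trMid hm.right]
      match_scalars
      field_simp

theorem exists_opB_eq [Nonempty c] [NeZero r₁] [NeZero r₂] {ρ : Op a} {E X Y : Op (a × b × c)}
    (h : CoreData r₁ r₂ ρ E X Y) (hX : X = padLast (trLast X)) :
    ∃ E₂ : Op (a × b), opB r₂ E E₂ = X ∧ (CoreMarginals r₁ r₂ E X Y →
      trFst E₂ = ((Fintype.card c : ℂ) / ((r₁ : ℂ) ^ 2 * (r₂ : ℂ) ^ 2)) • (1 : Op b)) := by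
  have hr₁ : (r₁ : ℂ) ≠ 0 := Nat.cast_ne_zero.2 (NeZero.ne r₁)
  have hr₂ : (r₂ : ℂ) ≠ 0 := Nat.cast_ne_zero.2 (NeZero.ne r₂)
  by_cases hr : r₂ = 1
  · refine ⟨((Fintype.card c : ℂ) / ((r₁ : ℂ) ^ 2 * (r₂ : ℂ) ^ 2)) • (ρ ⊗ₖ (1 : Op b)), ?_,
      fun _ => ?_⟩
    · subst hr
      obtain ⟨-, rfl⟩ := h.right_trivial rfl
      simpa [opB] using hX.symm
    · rw [trFst_smul, trFst_kronecker_one h.density.2]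
  · have hs := sq_sub_one_ne_zero hr
    refine ⟨((r₂ : ℂ) ^ 2 - 1)⁻¹ • (trLast X - trLast E), ?_, fun hm => ?_⟩
    · rw [opB, smul_smul, mul_inv_cancel₀ hs, one_smul, add_sub_cancel, ← hX]
    · rw [trFst_smul, trFst_sub, trFst_trLast hm.both, trFst_trLast hm.left]
      match_scalars
      field_simp

/-- Core data in which `X` and `Y` carry maximally mixed factors come from reduced operators. -/
theorem CoreData.exists_baseConstraints [Nonempty b] [Nonempty c] [NeZero r₁] [NeZero r₂]
    {N : Op a →ₗ[ℂ] Op (b × c)} {ρ : Op a} {f : ℝ} {E X Y : Op (a × b × c)}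
    (h : CoreData r₁ r₂ ρ E X Y) (hf : (f : ℂ) = (E * (choi N)ᵀ).trace)
    (hY : Y = padMid (trMid Y)) (hX : X = padLast (trLast X)) :
    ∃ (E₂ : Op (a × b)) (E₃ : Op (a × c)), BaseConstraints N r₁ r₂ ρ f E E₂ E₃ ∧
      (CoreMarginals r₁ r₂ E X Y → MarginalConstraints r₁ r₂ E E₂ E₃) ∧
      (CorePPT r₁ r₂ ρ E X Y → PPTConstraints r₁ r₂ ρ E E₂ E₃) := by
  obtain ⟨E₂, rfl, h₂⟩ := exists_opB_eq h hX
  obtain ⟨E₃, rfl, h₃⟩ := exists_opC_eq h hY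
  refine ⟨E₂, E₃, ⟨hf, h.density, Matrix.nonneg_iff_posSemidef.2 h.pos_both, h.pos_right,
    h.pos_left, Matrix.le_iff.2 (posSemidef_of_eq h.pos_none ?_)⟩,
    fun hm => ⟨hm.both, h₃ hm, h₂ hm⟩, pptConstraints_iff.2⟩
  abel

theorem BaseConstraints.preCore [Nonempty b] [Nonempty c] {N : Op a →ₗ[ℂ] Op (b × c)} {ρ : Op a}
    {f : ℝ} {E : Op (a × b × c)} {E₂ : Op (a × b)} {E₃ : Op (a × c)}
    (h : BaseConstraints N r₁ r₂ ρ f E E₂ E₃) :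
    PreCore r₁ r₂ ρ E (opB r₂ E E₂) (opC r₁ E E₃) := by
  obtain ⟨-, hρ, h0, hC, hB, hs⟩ := h
  refine ⟨hρ, Matrix.nonneg_iff_posSemidef.1 h0, hB, hC, posSemidef_of_eq hs ?_, ?_, ?_⟩
  · abel
  · rintro rfl
    exact opC_one hC
  · rintro rfl
    exact opB_one hB

/-- The marginal constraints force the equalities that hold for trivial messages. -/
theorem PreCore.coreData {ρ : Op a} {E X Y : Op (a × b × c)} (h : PreCore r₁ r₂ ρ E X Y)
    (hm : CoreMarginals r₁ r₂ E X Y) : CoreData r₁ r₂ ρ E X Y := by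
  have htr : (ρ ⊗ₖ (1 : Op (b × c))).trace = (1 : Op (b × c)).trace := by
    rw [← trace_trFst, trFst_kronecker_one h.density.2]
  refine ⟨h.density, h.pos_both, h.pos_left, h.pos_right, h.pos_none, fun hr => ?_, fun hr => ?_⟩
  · have hY := h.left_trivial hr
    refine ⟨(eq_of_posSemidef_sub (posSemidef_of_eq h.pos_none ?_) ?_).symm, hY⟩
    · rw [hY]
      abel
    · rw [htr, ← trace_trFst X, hm.left, hr]
      simp
  · have hX := h.right_trivial hr
    refine ⟨(eq_of_posSemidef_sub (posSemidef_of_eq h.pos_none ?_) ?_).symm, hX⟩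
    · rw [hX]
      abel
    · rw [htr, ← trace_trFst Y, hm.right, hr]
      simp

end ReducedOperators

section Unreduced

variable {a b c : Type*} [Fintype a] [Fintype b] [Fintype c] [DecidableEq a] [DecidableEq b]
  [DecidableEq c] {r₁ r₂ : ℕ}

/-- Partial transposition of the middle factor as a linear map. -/
def ptMidMap (α β γ : Type*) : Op (α × β × γ) →ₗ[ℂ] Op (α × β × γ) where
  toFun := ptMid
  map_add' _ _ := rfl
  map_smul' _ _ := rfl

/-- Partial transposition of the last factor as a linear map. -/
def ptLastMap (α β γ : Type*) : Op (α × β × γ) →ₗ[ℂ] Op (α × β × γ) where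
  toFun := ptLast
  map_add' _ _ := rfl
  map_smul' _ _ := rfl

theorem sub_one_nonneg (r : ℕ) [NeZero r] : (0 : ℂ) ≤ (r : ℂ) - 1 := by
  have h : (1 : ℝ) ≤ r := by exact_mod_cast Nat.one_le_iff_ne_zero.2 (NeZero.ne r)
  exact_mod_cast Complex.zero_le_real.2 (sub_nonneg.2 h)

/-- The complementary block `E'` with `X = E + (r² - 1) E'`, also when `r = 1`. -/
theorem exists_complement_block {n : Type*} [Fintype n] {r : ℕ} [NeZero r] {E X : Op n}
    (hE : E.PosSemidef) (hX : (X - E).PosSemidef) (hr : r = 1 → X = E) :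
    ∃ E' : Op n, E'.PosSemidef ∧ X = E + ((r : ℂ) ^ 2 - 1) • E' ∧
      ∀ T : Op n →ₗ[ℂ] Op n, (∀ ε : ℂ, ε ^ 2 = 1 → (T X + (ε * r) • T E).PosSemidef) →
        (T E + ((r : ℂ) - 1) • T E').PosSemidef ∧ (((r : ℂ) + 1) • T E' - T E).PosSemidef := by
  by_cases h : r = 1
  · subst h
    obtain rfl := hr rfl
    refine ⟨X, hE, by simp, fun T hT => ?_⟩
    have h1 := (hT 1 (by norm_num)).smul (show (0 : ℂ) ≤ 1 / 2 by positivity)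
    have h2 : (T X).PosSemidef := by
      refine posSemidef_of_eq h1 ?_
      push_cast
      module
    constructor <;> refine posSemidef_of_eq h2 ?_ <;>
    · push_cast
      module
  · have hs := sq_sub_one_ne_zero h
    have hfac : (r : ℂ) ^ 2 - 1 = (r + 1) * (r - 1) := by ring
    have hp : (r : ℂ) + 1 ≠ 0 := fun h => hs (by rw [hfac, h, zero_mul])
    have hm : (r : ℂ) - 1 ≠ 0 := fun h => hs (by rw [hfac, h, mul_zero])
    refine ⟨((r : ℂ) ^ 2 - 1)⁻¹ • (X - E), hX.smul (inv_nonneg.2 (sq_sub_one_nonneg r)), ?_,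
      fun T hT => ?_⟩
    · rw [smul_smul, mul_inv_cancel₀ hs, one_smul, add_sub_cancel]
    · have h1 := (hT 1 (by norm_num)).smul (show (0 : ℂ) ≤ ((r : ℂ) + 1)⁻¹ by positivity)
      have h2 := (hT (-1) (by norm_num)).smul (inv_nonneg.2 (sub_one_nonneg r))
      constructor
      · refine posSemidef_of_eq h1 ?_
        rw [map_smul, map_sub, hfac]
        match_scalars <;> field_simp <;> ring
      · refine posSemidef_of_eq h2 ?_
        rw [map_smul, map_sub, hfac]
        match_scalars <;> field_simp <;> ring

theorem exists_unreducedPPTConstraints [NeZero r₁] [NeZero r₂] {N : Op a →ₗ[ℂ] Op (b × c)}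
    {ρ : Op a} {f : ℝ} {E X Y : Op (a × b × c)} (h : CoreData r₁ r₂ ρ E X Y)
    (hf : (f : ℂ) = (E * (choi N)ᵀ).trace) (hP : CorePPT r₁ r₂ ρ E X Y) :
    ∃ E₁ E₂ E₃ : Op (a × b × c), UnreducedPPTConstraints N r₁ r₂ ρ f E₁ E₂ E₃ := by
  have hr₁ : (r₁ : ℂ) ≠ 0 := Nat.cast_ne_zero.2 (NeZero.ne r₁)
  have hr₂ : (r₂ : ℂ) ≠ 0 := Nat.cast_ne_zero.2 (NeZero.ne r₂)
  have q₃ : (0 : ℂ) ≤ 1 / ((r₁ : ℂ) * r₂) := by positivity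
  obtain ⟨E₂, h₂, rfl, ht₂⟩ := exists_complement_block h.pos_both h.pos_left
    fun hr => (h.right_trivial hr).2
  obtain ⟨E₃, h₃, rfl, ht₃⟩ := exists_complement_block h.pos_both h.pos_right
    fun hr => (h.left_trivial hr).2
  obtain ⟨c₁, c₂⟩ := ht₂ (ptLastMap a b c) hP.charlie_pos
  obtain ⟨b₁, b₂⟩ := ht₃ (ptMidMap a b c) hP.bob_pos
  obtain ⟨ha, -, hb, -, hc⟩ := hP
  rw [forall_sign₂] at ha
  rw [forall_sign] at hb hc
  obtain ⟨⟨a1, a2⟩, a3, a4⟩ := ha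
  simp only [ptSnd_add, ptSnd_smul, ptMid_add, ptMid_smul, ptLast_add, ptLast_smul] at a1 a2 a3 a4 hb hc
  refine ⟨E, E₂, E₃, hf, h.density, Matrix.nonneg_iff_posSemidef.2 h.pos_both,
    Matrix.nonneg_iff_posSemidef.2 h₂, Matrix.nonneg_iff_posSemidef.2 h₃,
    posSemidef_of_eq h.pos_none ?_,
    posSemidef_of_eq (a1.smul q₃) ?_, posSemidef_of_eq (a4.smul q₃) ?_,
    posSemidef_of_eq (a2.smul q₃) ?_, posSemidef_of_eq (a3.smul q₃) ?_,
    posSemidef_of_eq b₁ ?_, b₂, absLE_iff.2 ⟨posSemidef_of_eq hb.1 ?_, posSemidef_of_eq hb.2 ?_⟩,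
    posSemidef_of_eq c₁ ?_, c₂, absLE_iff.2 ⟨posSemidef_of_eq hc.1 ?_, posSemidef_of_eq hc.2 ?_⟩⟩
  · abel
  · match_scalars <;> field_simp <;> ring
  · match_scalars <;> field_simp <;> ring
  · match_scalars <;> field_simp <;> ring
  · match_scalars <;> field_simp <;> ring
  · exact (sub_neg_eq_add _ _).symm
  · module
  · module
  · exact (sub_neg_eq_add _ _).symm
  · module
  · module

theorem UnreducedPPTConstraints.preCore [NeZero r₁] [NeZero r₂] {N : Op a →ₗ[ℂ] Op (b × c)}
    {ρ : Op a} {f : ℝ} {E₁ E₂ E₃ : Op (a × b × c)}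
    (h : UnreducedPPTConstraints N r₁ r₂ ρ f E₁ E₂ E₃) :
    PreCore r₁ r₂ ρ E₁ (E₁ + ((r₂ : ℂ) ^ 2 - 1) • E₂) (E₁ + ((r₁ : ℂ) ^ 2 - 1) • E₃) ∧
    CorePPT r₁ r₂ ρ E₁ (E₁ + ((r₂ : ℂ) ^ 2 - 1) • E₂) (E₁ + ((r₁ : ℂ) ^ 2 - 1) • E₃) := by
  have hr₁ : (r₁ : ℂ) ≠ 0 := Nat.cast_ne_zero.2 (NeZero.ne r₁)
  have hr₂ : (r₂ : ℂ) ≠ 0 := Nat.cast_ne_zero.2 (NeZero.ne r₂)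
  have p₃ : (0 : ℂ) ≤ (r₁ : ℂ) * r₂ := by positivity
  have p₁ : (0 : ℂ) ≤ (r₁ : ℂ) + 1 := by positivity
  have p₂ : (0 : ℂ) ≤ (r₂ : ℂ) + 1 := by positivity
  obtain ⟨-, hρ, h₁, h₂, h₃, hs, a1, a4, a2, a3, b1, b2, hb, c1, c2, hc⟩ := h
  rw [Matrix.nonneg_iff_posSemidef] at h₁ h₂ h₃
  rw [absLE_iff] at hb hc
  rw [Matrix.le_iff] at hs a1 a2 a3 a4 b1 b2 c1 c2
  refine ⟨⟨hρ, h₁, posSemidef_of_eq (h₂.smul (sq_sub_one_nonneg r₂)) (add_sub_cancel_left _ _).symm,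
    posSemidef_of_eq (h₃.smul (sq_sub_one_nonneg r₁)) (add_sub_cancel_left _ _).symm,
    posSemidef_of_eq hs ?_, ?_, ?_⟩, ?_⟩
  · abel
  · rintro rfl
    simp
  · rintro rfl
    simp
  · constructor
    · rw [forall_sign₂]
      simp only [ptSnd_add, ptSnd_smul]
      refine ⟨⟨posSemidef_of_eq (a1.smul p₃) ?_, posSemidef_of_eq (a2.smul p₃) ?_⟩,
        posSemidef_of_eq (a3.smul p₃) ?_, posSemidef_of_eq (a4.smul p₃) ?_⟩ <;>
      · match_scalars <;> field_simp <;> ring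
    · rw [forall_sign]
      simp only [ptMid_add, ptMid_smul]
      refine ⟨posSemidef_of_eq (b1.smul p₁) ?_, posSemidef_of_eq (b2.smul (sub_one_nonneg r₁)) ?_⟩ <;>
      module
    · rw [forall_sign]
      simp only [ptMid_add, ptMid_smul]
      refine ⟨posSemidef_of_eq hb.1 ?_, posSemidef_of_eq hb.2 ?_⟩ <;> module
    · rw [forall_sign]
      simp only [ptLast_add, ptLast_smul]
      refine ⟨posSemidef_of_eq (c1.smul p₂) ?_, posSemidef_of_eq (c2.smul (sub_one_nonneg r₂)) ?_⟩ <;>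
      module
    · rw [forall_sign]
      simp only [ptLast_add, ptLast_smul]
      refine ⟨posSemidef_of_eq hc.1 ?_, posSemidef_of_eq hc.2 ?_⟩ <;> module

end Unreduced

end BroadcastCode

end

theorem mainTheorem9 {a b c : Type*} [Fintype a] [Fintype b] [Fintype c]
    [DecidableEq a] [DecidableEq b] [DecidableEq c] [Nonempty a] [Nonempty b] [Nonempty c]
    (N : BroadcastCode.Op a →ₗ[ℂ] BroadcastCode.Op (b × c)) (hN : BroadcastCode.IsChannel N)
    (r₁ r₂ : ℕ) (hr₁ : 1 ≤ r₁) (hr₂ : 1 ≤ r₂) (ρ : BroadcastCode.Op a) (f : ℝ) :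
    -- no-signalling codes
    ((∃ K : BroadcastCode.ForwardCode a b c r₁ r₂, K.Attains N ρ f ∧ K.IsNS) ↔
      ∃ (E₁ : BroadcastCode.Op (a × b × c)) (E₂ : BroadcastCode.Op (a × b))
        (E₃ : BroadcastCode.Op (a × c)),
        BroadcastCode.BaseConstraints N r₁ r₂ ρ f E₁ E₂ E₃ ∧
        BroadcastCode.MarginalConstraints r₁ r₂ E₁ E₂ E₃) ∧
    -- codes that are both no-signalling and PPT-preserving
    ((∃ K : BroadcastCode.ForwardCode a b c r₁ r₂,
        K.Attains N ρ f ∧ K.IsNS ∧ BroadcastCode.IsPPT K.operation) ↔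
      ∃ (E₁ : BroadcastCode.Op (a × b × c)) (E₂ : BroadcastCode.Op (a × b))
        (E₃ : BroadcastCode.Op (a × c)),
        BroadcastCode.BaseConstraints N r₁ r₂ ρ f E₁ E₂ E₃ ∧
        BroadcastCode.MarginalConstraints r₁ r₂ E₁ E₂ E₃ ∧
        BroadcastCode.PPTConstraints r₁ r₂ ρ E₁ E₂ E₃) ∧
    -- PPT-preserving codes in which the sender may signal, but neither receiver may
    (1 < r₁ * r₂ →
      ((∃ K : BroadcastCode.ForwardCode a b c r₁ r₂,
          K.Attains N ρ f ∧ BroadcastCode.NoSignalB K.operation ∧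
          BroadcastCode.NoSignalC K.operation ∧ BroadcastCode.IsPPT K.operation) ↔
        ∃ (E₁ : BroadcastCode.Op (a × b × c)) (E₂ : BroadcastCode.Op (a × b))
          (E₃ : BroadcastCode.Op (a × c)),
          BroadcastCode.BaseConstraints N r₁ r₂ ρ f E₁ E₂ E₃ ∧
          BroadcastCode.PPTConstraints r₁ r₂ ρ E₁ E₂ E₃)) ∧
    -- PPT-preserving codes without any no-signalling requirement: nothing is eliminated
    (1 < r₁ * r₂ →
      ((∃ K : BroadcastCode.ForwardCode a b c r₁ r₂,
          K.Attains N ρ f ∧ BroadcastCode.IsPPT K.operation) ↔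
        ∃ E₁ E₂ E₃ : BroadcastCode.Op (a × b × c),
          BroadcastCode.UnreducedPPTConstraints N r₁ r₂ ρ f E₁ E₂ E₃)) := by
  have : NeZero r₁ := ⟨by omega⟩
  have : NeZero r₂ := ⟨by omega⟩
  refine ⟨⟨?_, ?_⟩, ⟨?_, ?_⟩, fun hr => ⟨?_, ?_⟩, fun hr => ⟨?_, ?_⟩⟩
  · rintro ⟨K, hK, hA, hB, hC⟩
    obtain ⟨E, X, Y, h, hf, mA, mB, mC, -⟩ := K.exists_coreData hK
    obtain ⟨E₂, E₃, hbase, hm, -⟩ := h.exists_baseConstraints hf (mB hB) (mC hC)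
    exact ⟨E, E₂, E₃, hbase, hm (mA hA)⟩
  · rintro ⟨E, E₂, E₃, hbase, hm⟩
    obtain ⟨K, hK, kA, kB, kC, -⟩ := BroadcastCode.exists_code_of_coreData N
      (hbase.preCore.coreData hm.coreMarginals) hbase.1
    exact ⟨K, hK, kA hm.coreMarginals, kB (BroadcastCode.opC_eq_padMid_trMid _ _ _),
      kC (BroadcastCode.opB_eq_padLast_trLast _ _ _)⟩
  · rintro ⟨K, hK, ⟨hA, hB, hC⟩, hP⟩
    obtain ⟨E, X, Y, h, hf, mA, mB, mC, mP⟩ := K.exists_coreData hK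
    obtain ⟨E₂, E₃, hbase, hm, hp⟩ := h.exists_baseConstraints hf (mB hB) (mC hC)
    exact ⟨E, E₂, E₃, hbase, hm (mA hA), hp (mP hP)⟩
  · rintro ⟨E, E₂, E₃, hbase, hm, hp⟩
    obtain ⟨K, hK, kA, kB, kC, kP⟩ := BroadcastCode.exists_code_of_coreData N
      (hbase.preCore.coreData hm.coreMarginals) hbase.1
    exact ⟨K, hK, ⟨kA hm.coreMarginals, kB (BroadcastCode.opC_eq_padMid_trMid _ _ _),
      kC (BroadcastCode.opB_eq_padLast_trLast _ _ _)⟩,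
      kP (BroadcastCode.pptConstraints_iff.1 hp)⟩
  · rintro ⟨K, hK, hB, hC, hP⟩
    obtain ⟨E, X, Y, h, hf, -, mB, mC, mP⟩ := K.exists_coreData hK
    obtain ⟨E₂, E₃, hbase, -, hp⟩ := h.exists_baseConstraints hf (mB hB) (mC hC)
    exact ⟨E, E₂, E₃, hbase, hp (mP hP)⟩
  · rintro ⟨E, E₂, E₃, hbase, hp⟩
    obtain ⟨X, Y, h, hP, hX, hY⟩ := hbase.preCore.exists_completion hr
      (BroadcastCode.pptConstraints_iff.1 hp)
    obtain ⟨K, hK, -, kB, kC, kP⟩ := BroadcastCode.exists_code_of_coreData N h hbase.1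
    refine ⟨K, hK, kB ?_, kC ?_, kP hP⟩
    · rcases hY with rfl | rfl
      exacts [BroadcastCode.opC_eq_padMid_trMid _ _ _, BroadcastCode.kronecker_one_eq_padMid ρ]
    · rcases hX with rfl | rfl
      exacts [BroadcastCode.opB_eq_padLast_trLast _ _ _, BroadcastCode.kronecker_one_eq_padLast ρ]
  · rintro ⟨K, hK, hP⟩
    obtain ⟨E, X, Y, h, hf, -, -, -, mP⟩ := K.exists_coreData hK
    exact BroadcastCode.exists_unreducedPPTConstraints h hf (mP hP)
  · rintro ⟨E₁, E₂, E₃, hu⟩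
    obtain ⟨hpre, hppt⟩ := hu.preCore
    obtain ⟨X, Y, h, hP, -, -⟩ := hpre.exists_completion hr hppt
    obtain ⟨K, hK, -, -, -, kP⟩ := BroadcastCode.exists_code_of_coreData N h hu.1
    exact ⟨K, hK, kP hP⟩
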